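/- **Theorem (pathwise master formula).** Let $d\ge 1$, $p\in(2,3)$, and let $S\in C([0,\infty);(0,\infty)^d)$ be a price path: there are partitions $\mathcal P^n=\{0=t^n_0<t^n_1<\cdots\}$, $t^n_k\to\infty$, of $[0,\infty)$ such that, for every $T>0$, $S|_{[0,T]}$ satisfies Property (RIE) with respect to $p$ and the restrictions $(\mathcal P^n\cup\{T\})\cap[0,T]=\{0=t^n_0<\dots<t^n_{N_n}=T\}$. That is: the mesh sizes tend to $0$; the Riemann sums $\int_0^t S^n_u\otimes \mathrm dS_u:=\sum_k S_{t^n_k}\otimes (S_{t^n_{k+1}\wedge t}-S_{t^n_k\wedge t})$ converge uniformly in $t\in[0,T]$ to a limit $\int_0^tS_u\otimes \mathrm dS_u$; and there is a superadditive function $c\ge0$ of $0\le s\le t\le T$ with (convention $0/0=0$) $$\sup_{s\le t}\frac{|S_{s,t}|^p}{c(s,t)}+\sup_n\sup_{k<\ell}\frac{\big|\int_{t^n_k}^{t^n_\ell}S^n_u\otimes \mathrm dS_u-S_{t^n_k}\otimes S_{t^n_k,t^n_\ell}\big|^{p/2}}{c(t^n_k,t^n_\ell)}\le 1,\qquad S_{s,t}:=S_t-S_s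 .$$ Let $\mathbf S=(S,\mathbb S)$, $\mathbb S_{s,t}=\int_s^tS_u\otimes \mathrm dS_u-S_s\otimes S_{s,t}$, be the associated rough path, and $[\mathbf S]_t=S_{0,t}\otimes S_{0,t}-2\,\mathrm{Sym}(\mathbb S_{0,t})$ its bracket. For $q\ge p$ with $2/p+1/q>1$ and $1/r=1/p+1/q$, an $S$-controlled path on $[0,T]$ is a pair $(F,F')$ of continuous paths, with values in $\mathbb R^d$ and $\mathcal L(\mathbb R^d;\mathbb R^d)$, such that $F'$ has finite $q$-variation and $R_{s,t}=F_{s,t}-F'_sS_{s,t}$ has finite $r$-variation; its rough integral is $\int_0^tF_u\,\mathrm d\mathbf S_u=\lim_{|\mathcal P|\to0}\sum_{[u,v]\in\mathcal P}(F_uS_{u,v}+F'_u\mathbb S_{u,v})$. A portfolio (for the exponent $q$) is a path $\pi:[0,\infty)\to\mathbb R^d$ with $\sum_i\pi^i_t=1$ for all $t$ which, on each $[0,T]$, is controlled for some $F'$. Its wealth process is $$W^\pi_t=\exp\Big(\int_0^t\frac{\pi_s}{S_s}\,\mathrm d\mathbf S_s-\frac12\sum_{i,j}\int_0^t\frac{\pi^i_s\pi^j_s}{S^i_sS^j_s}\,\mathrm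 d[\mathbf S]^{ij}_s\Big),$$ where $\pi/S$ is the componentwise quotient (the value does not depend on the choice of its Gubinelli derivative) and the second integrals are Riemann–Stieltjes integrals. Let $\mu^i=S^i/(S^1+\dots+S^d)$ be the market portfolio, $V^\pi=W^\pi/W^\mu$, $a^{ij}(\mathrm ds)=\frac{1}{S^i_sS^j_s}\mathrm d[\mathbf S]^{ij}_s$ and $\tau^\mu_{ij}(\mathrm ds)=(\mu_s-e_i)^\top a(\mathrm ds)(\mu_s-e_j)$. Let $\varepsilon>0$, and let $G$ be a real function that is strictly positive on the open simplex $\Delta^d_+=\{x:\sum_ix^i=1,\ x^i>0\}$ and of class $C^{p+\varepsilon}$ on an open neighbourhood of $\Delta^d_+$ in $\mathbb R^d$ (with $p+\varepsilon=k+\gamma$, $k\in\mathbb N$, $\gamma\in(0,1]$: $G$ is $C^k$ with locally $\gamma$-Hölder $k$-th derivative). Let $$\pi^i_t=\mu^i_t\Big(\partial_i\log G(\mu_t)+1-\sum_{k=1}^d\mu^k_t\,\partial_k\log G(\mu_t)\Big),\qquad i=1,\dots,d.$$ Then $\pi$ is a portfolio for some exponent $q\ge p$ with $2/p+1/q>1$.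 Moreover, for every such $q$ for which $\pi$ is a portfolio, the wealth processes $W^\pi$, $W^\mu$ and the integrals below exist, and $$\log V^\pi_t=\log\frac{G(\mu_t)}{G(\mu_0)}-\frac12\sum_{i,j=1}^d\int_0^t\frac{1}{G(\mu_s)}\frac{\partial^2G(\mu_s)}{\partial x_i\partial x_j}\,\mu^i_s\mu^j_s\,\tau^\mu_{ij}(\mathrm ds),\qquad t\in[0,\infty).$$ -/

import Mathlib

open Filter Topology
open scoped NNReal ENNReal

noncomputable section

namespace RoughSPT

/-- The Euclidean space `ℝ^d`. -/
abbrev Vec (d : ℕ) : Type := EuclideanSpace ℝ (Fin d)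

/-- The space `ℝ^{d × d}` of `d × d` tensors, with the Euclidean (Frobenius) norm. -/
abbrev Tensor (d : ℕ) : Type := EuclideanSpace ℝ (Fin d × Fin d)

/-- The tensor product `[A ⊗ B]^{ij} = A^i B^j`. -/
def tprod {d : ℕ} (A B : Vec d) : Tensor d :=
  WithLp.toLp 2 (fun ij : Fin d × Fin d => A ij.1 * B ij.2)

/-- The `i`-th vector of the canonical basis of `ℝ^d`. -/
def stdVec {d : ℕ} (i : Fin d) : Vec d := EuclideanSpace.single i (1 : ℝ)

/-! ### Partitions -/

/-- A finite partition `0 = t_0 < t_1 < ⋯ < t_N = T` of the interval `[0, T]`. -/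
structure FinPartition (T : ℝ≥0) where
  N : ℕ
  pt : Fin (N + 1) → ℝ≥0
  strictMono : StrictMono pt
  pt_zero : pt 0 = 0
  pt_last : pt (Fin.last N) = T

namespace FinPartition

variable {T : ℝ≥0}

/-- The left end point `t_k` of the `k`-th interval of the partition. -/
def left (P : FinPartition T) (k : Fin P.N) : ℝ≥0 := P.pt k.castSucc

/-- The right end point `t_{k+1}` of the `k`-th interval of the partition. -/
def right (P : FinPartition T) (k : Fin P.N) : ℝ≥0 := P.pt k.succ

/-- The mesh size `max_k |t_{k+1} - t_k|`. -/
def mesh (P : FinPartition T) : ℝ≥0 := Finset.univ.sup (fun k => P.right k - P.left k)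

end FinPartition

/-- The filter "mesh size tends to zero" on the partitions of `[0, T]`. -/
def meshToZero (T : ℝ≥0) : Filter (FinPartition T) := comap FinPartition.mesh (𝓝 0)

/-- A partition `0 = t_0 < t_1 < ⋯`, `t_i → ∞`, of the interval `[0, ∞)`. -/
structure InfPartition where
  pt : ℕ → ℝ≥0
  strictMono : StrictMono pt
  pt_zero : pt 0 = 0
  tendsto_pt : Tendsto pt atTop atTop

namespace InfPartition

theorem exists_le_pt (P : InfPartition) (T : ℝ≥0) : ∃ n, T ≤ P.pt n :=
  (P.tendsto_pt.eventually_ge_atTop T).exists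

open Classical in
/-- The restriction `(P ∪ {T}) ∩ [0, T]` of a partition `P` of `[0, ∞)` to `[0, T]`: its points are
the points of `P` lying strictly before `T`, followed by `T`. -/
def restrict (P : InfPartition) (T : ℝ≥0) : FinPartition T where
  N := Nat.find (P.exists_le_pt T)
  pt k := min (P.pt k) T
  strictMono := by
    intro i j hij
    have hi : P.pt i < T := by
      have h1 : (i : ℕ) < Nat.find (P.exists_le_pt T) := by
        have h2 := j.is_lt
        have h3 : (i : ℕ) < (j : ℕ) := hij
        omega
      exact not_le.mp (Nat.find_min (P.exists_le_pt T) h1)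
    have hlt : P.pt i < P.pt j := P.strictMono hij
    simp only [min_eq_left hi.le]
    exact lt_min hlt hi
  pt_zero := by simp [P.pt_zero]
  pt_last := by
    simpa using Nat.find_spec (P.exists_le_pt T)

end InfPartition

/-! ### Finite variation, control functions and Property (RIE) -/

/-- The two-parameter function `Ξ` has finite `p`-variation over `[0, T]`. -/
def HasFiniteVariation {E : Type*} [NormedAddCommGroup E] (p : ℝ) (Ξ : ℝ≥0 → ℝ≥0 → E)
    (T : ℝ≥0) : Prop :=
  ∃ C : ℝ, ∀ P : FinPartition T, ∑ k, ‖Ξ (P.left k) (P.right k)‖ ^ p ≤ C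

/-- A control function on `[0, T]`: a nonnegative superadditive function of `s ≤ t`. -/
def IsControl (T : ℝ≥0) (c : ℝ≥0 → ℝ≥0 → ℝ≥0) : Prop :=
  ∀ s u t, s ≤ u → u ≤ t → t ≤ T → c s u + c u t ≤ c s t

/-- The Riemann sum `∑_k S_{t_k} ⊗ (S_{t_{k+1} ∧ t} - S_{t_k ∧ t})` along a partition. -/
def riemannSum {d : ℕ} {T : ℝ≥0} (S : ℝ≥0 → Vec d) (P : FinPartition T) (t : ℝ≥0) : Tensor d :=
  ∑ k, tprod (S (P.left k)) (S (min (P.right k) t) - S (min (P.left k) t))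

/-- Property (RIE) on `[0, T]` for the path `S`, the exponent `p` and the sequence `P` of partitions
of `[0, T]`. The quotients are taken in `[0, ∞]`, where `0 / 0 = 0` and `x / 0 = ∞` for `x > 0`. -/
structure SatisfiesRIE {d : ℕ} (p : ℝ) (T : ℝ≥0) (S : ℝ≥0 → Vec d)
    (P : ℕ → FinPartition T) : Prop where
  continuousOn : ContinuousOn S (Set.Icc 0 T)
  mesh_tendsto : Tendsto (fun n => (P n).mesh) atTop (𝓝 0)
  riemann_converges : ∃ J : ℝ≥0 → Tensor d,
    TendstoUniformlyOn (fun n t => riemannSum S (P n) t) J atTop (Set.Icc 0 T)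
  control : ∃ c : ℝ≥0 → ℝ≥0 → ℝ≥0, IsControl T c ∧
    (⨆ (s : ℝ≥0) (t : ℝ≥0) (_ : s ≤ t ∧ t ≤ T),
        ENNReal.ofReal (‖S t - S s‖ ^ p) / (c s t : ℝ≥0∞)) +
      (⨆ (n : ℕ) (k : Fin ((P n).N + 1)) (l : Fin ((P n).N + 1)) (_ : k < l),
        ENNReal.ofReal (‖riemannSum S (P n) ((P n).pt l) - riemannSum S (P n) ((P n).pt k)
            - tprod (S ((P n).pt k)) (S ((P n).pt l) - S ((P n).pt k))‖ ^ (p / 2)) /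
          (c ((P n).pt k) ((P n).pt l) : ℝ≥0∞)) ≤ 1

/-- `S` is a price path, with `Pn` as corresponding sequence of partitions of `[0, ∞)`: a continuous
path with strictly positive components whose restriction to every `[0, T]` satisfies (RIE) along
the restricted partitions (in particular the mesh sizes vanish on compacts). -/
structure IsPricePath {d : ℕ} (p : ℝ) (S : ℝ≥0 → Vec d) (Pn : ℕ → InfPartition) : Prop where
  continuous : Continuous S
  pos : ∀ t i, 0 < S t i
  rie : ∀ T : ℝ≥0, 0 < T → SatisfiesRIE p T S (fun n => (Pn n).restrict T)

/-! ### The rough path of a price path and its bracket -/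

/-- The integral `∫_0^t S_u ⊗ dS_u`, the limit of the Riemann sums along `Pn`. -/
def itoIntegral {d : ℕ} (S : ℝ≥0 → Vec d) (Pn : ℕ → InfPartition) (t : ℝ≥0) : Tensor d :=
  limUnder atTop (fun n => riemannSum S ((Pn n).restrict t) t)

/-- The second level `∫_s^t S_u ⊗ dS_u - S_s ⊗ S_{s,t}` of the rough path associated to `S`. -/
def secondLevel {d : ℕ} (S : ℝ≥0 → Vec d) (Pn : ℕ → InfPartition) (s t : ℝ≥0) : Tensor d :=
  itoIntegral S Pn t - itoIntegral S Pn s - tprod (S s) (S t - S s)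

/-- The `(i, j)` component of the bracket `S_{0,t} ⊗ S_{0,t} - 2 Sym(𝕊_{0,t})`. -/
def bracket {d : ℕ} (S : ℝ≥0 → Vec d) (Pn : ℕ → InfPartition) (i j : Fin d) (t : ℝ≥0) : ℝ :=
  (S t i - S 0 i) * (S t j - S 0 j)
    - (secondLevel S Pn 0 t (i, j) + secondLevel S Pn 0 t (j, i))

/-! ### Controlled paths and rough integration -/

/-- The standing conditions on the regularity parameters. -/
structure RegularityParams (p q : ℝ) : Prop where
  two_lt : 2 < p
  lt_three : p < 3
  le : p ≤ q
  one_lt : 1 < 2 / p + 1 / q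

/-- The exponent `r` with `1 / r = 1 / p + 1 / q`. -/
def remainderExponent (p q : ℝ) : ℝ := (1 / p + 1 / q)⁻¹

/-- `(F, F')` is an `X`-controlled path on `[0, T]`. -/
structure IsControlledPath {d : ℕ} (p q : ℝ) (X : ℝ≥0 → Vec d) (T : ℝ≥0)
    (F : ℝ≥0 → Vec d) (F' : ℝ≥0 → Vec d →L[ℝ] Vec d) : Prop where
  continuousOn_path : ContinuousOn F (Set.Icc 0 T)
  continuousOn_deriv : ContinuousOn F' (Set.Icc 0 T)
  variation_deriv : HasFiniteVariation q (fun s t => F' t - F' s) T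
  variation_remainder : HasFiniteVariation (remainderExponent p q)
    (fun s t => F t - F s - F' s (X t - X s)) T

/-- The compensated Riemann sum `∑ F_s X_{s,t} + F'_s 𝕏_{s,t}`. With `𝕏^{ji} = ∫ X^j dX^i`, the
second product is `∑_{i,j} (F')^{ij} 𝕏^{ji}`, where `(F')^{ij}` is the derivative of `F^i` in the
direction of `X^j`. -/
def compensatedSum {d : ℕ} {T : ℝ≥0} (X : ℝ≥0 → Vec d) (XX : ℝ≥0 → ℝ≥0 → Tensor d)
    (F : ℝ≥0 → Vec d) (F' : ℝ≥0 → Vec d →L[ℝ] Vec d) (P : FinPartition T) : ℝ :=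
  ∑ k, (∑ i, F (P.left k) i * (X (P.right k) i - X (P.left k) i)
    + ∑ i, ∑ j, F' (P.left k) (stdVec j) i * XX (P.left k) (P.right k) (j, i))

/-- `I` is the rough integral `∫_0^t F_u d𝐗_u` of `(F, F')` against `𝐗 = (X, XX)`. -/
def HasRoughIntegral {d : ℕ} (X : ℝ≥0 → Vec d) (XX : ℝ≥0 → ℝ≥0 → Tensor d)
    (F : ℝ≥0 → Vec d) (F' : ℝ≥0 → Vec d →L[ℝ] Vec d) (t : ℝ≥0) (I : ℝ) : Prop :=
  Tendsto (fun P : FinPartition t => compensatedSum X XX F F' P) (meshToZero t) (𝓝 I)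

/-! ### Riemann–Stieltjes integrals -/

/-- `I` is the Riemann–Stieltjes integral `∫_0^t f dA`: the limit, as the mesh size tends to zero,
of the sums with arbitrary intermediate points. -/
def HasRSIntegral (f A : ℝ≥0 → ℝ) (t : ℝ≥0) (I : ℝ) : Prop :=
  ∀ ε : ℝ, 0 < ε → ∃ δ : ℝ≥0, 0 < δ ∧ ∀ P : FinPartition t, P.mesh < δ →
    ∀ ξ : Fin P.N → ℝ≥0, (∀ k, ξ k ∈ Set.Icc (P.left k) (P.right k)) →
      |∑ k, f (ξ k) * (A (P.right k) - A (P.left k)) - I| < ε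

/-- The Riemann–Stieltjes integral `∫_0^t f dA` exists. -/
def RSIntegrable (f A : ℝ≥0 → ℝ) (t : ℝ≥0) : Prop := ∃ I, HasRSIntegral f A t I

open Classical in
/-- The Riemann–Stieltjes integral `∫_0^t f dA` (and `0` if it does not exist). -/
def rsIntegral (f A : ℝ≥0 → ℝ) (t : ℝ≥0) : ℝ :=
  if h : RSIntegrable f A t then h.choose else 0

/-! ### Strategies, portfolios and wealth -/

/-- `F` is an admissible strategy for `S`. -/
def IsAdmissible {d : ℕ} (p q : ℝ) (S F : ℝ≥0 → Vec d) : Prop :=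
  ∀ T : ℝ≥0, 0 < T → ∃ F' : ℝ≥0 → Vec d →L[ℝ] Vec d, IsControlledPath p q S T F F'

/-- `π` is a portfolio for `S`: an admissible strategy with `∑_i π^i_t = 1` for all `t`. -/
def IsPortfolio {d : ℕ} (p q : ℝ) (S π : ℝ≥0 → Vec d) : Prop :=
  IsAdmissible p q S π ∧ ∀ t, ∑ i, π t i = 1

/-- The componentwise quotient `π / S`. -/
def quotientPath {d : ℕ} (π S : ℝ≥0 → Vec d) (t : ℝ≥0) : Vec d :=
  WithLp.toLp 2 (fun i => π t i / S t i)

/-- `W` is the wealth process (with unit initial wealth) of the portfolio `π`, that is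
`W_t = exp(∫_0^t (π_s / S_s) d𝐒_s - (1/2) ∑_{i,j} ∫_0^t (π^i_s π^j_s) / (S^i_s S^j_s) d[𝐒]^{ij}_s)`.
The path `π / S` has to be controlled by `S`, all integrals have to exist, and the identity is
required for every choice of the Gubinelli derivative of `π / S`; this determines `W`. -/
def IsWealthProcess {d : ℕ} (p q : ℝ) (S : ℝ≥0 → Vec d) (Pn : ℕ → InfPartition)
    (π : ℝ≥0 → Vec d) (W : ℝ≥0 → ℝ) : Prop :=
  ∀ T : ℝ≥0, 0 < T →
    (∃ K' : ℝ≥0 → Vec d →L[ℝ] Vec d, IsControlledPath p q S T (quotientPath π S) K') ∧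
    ∀ K' : ℝ≥0 → Vec d →L[ℝ] Vec d, IsControlledPath p q S T (quotientPath π S) K' →
      ∀ t ≤ T,
        (∀ i j, RSIntegrable (fun s => π s i * π s j / (S s i * S s j)) (bracket S Pn i j) t) ∧
        ∃ I : ℝ, HasRoughIntegral S (secondLevel S Pn) (quotientPath π S) K' t I ∧
          W t = Real.exp (I - 1 / 2 * ∑ i, ∑ j,
            rsIntegral (fun s => π s i * π s j / (S s i * S s j)) (bracket S Pn i j) t)

/-- The market portfolio `μ^i = S^i / (S^1 + ⋯ + S^d)`. -/
def marketPortfolio {d : ℕ} (S : ℝ≥0 → Vec d) (t : ℝ≥0) : Vec d :=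
  WithLp.toLp 2 (fun i => S t i / ∑ k, S t k)

/-! ### Market covariance and relative covariance -/

/-- The density, with respect to `d[𝐒]^{kl}`, of the `(k, l)` summand of `f(s) τ^π_{ij}(ds)`, where
`τ^π_{ij}(ds) = (π_s - e_i)ᵀ a(ds) (π_s - e_j)` and `a^{kl}(ds) = (S^k_s S^l_s)⁻¹ d[𝐒]^{kl}_s`. -/
def tauDensity {d : ℕ} (S π : ℝ≥0 → Vec d) (f : ℝ≥0 → ℝ) (i j k l : Fin d) (s : ℝ≥0) : ℝ :=
  f s * ((π s - stdVec i) k * (1 / (S s k * S s l)) * (π s - stdVec j) l)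

/-- The integral `∫_0^t f(s) τ^π_{ij}(ds)` exists. -/
def TauIntegrable {d : ℕ} (S : ℝ≥0 → Vec d) (Pn : ℕ → InfPartition) (π : ℝ≥0 → Vec d)
    (f : ℝ≥0 → ℝ) (i j : Fin d) (t : ℝ≥0) : Prop :=
  ∀ k l, RSIntegrable (tauDensity S π f i j k l) (bracket S Pn k l) t

/-- The integral `∫_0^t f(s) τ^π_{ij}(ds)` against the relative covariance of `π`. -/
def tauIntegral {d : ℕ} (S : ℝ≥0 → Vec d) (Pn : ℕ → InfPartition) (π : ℝ≥0 → Vec d)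
    (f : ℝ≥0 → ℝ) (i j : Fin d) (t : ℝ≥0) : ℝ :=
  ∑ k, ∑ l, rsIntegral (tauDensity S π f i j k l) (bracket S Pn k l) t

/-! ### Portfolio generating functions -/

/-- The open simplex `Δ^d_+`. -/
def openSimplex (d : ℕ) : Set (Vec d) := {x | ∑ i, x i = 1 ∧ ∀ i, 0 < x i}

/-- `f ∈ C^β(U)` for an open set `U`, where `β = k + γ` with `k ∈ ℕ` and `γ ∈ (0, 1]`: `f` is `k`
times continuously differentiable on `U`, with locally `γ`-Hölder continuous `k`-th derivative. -/
def HolderSmoothOn {d : ℕ} (β : ℝ) (U : Set (Vec d)) (f : Vec d → ℝ) : Prop :=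
  ∃ (k : ℕ) (γ : ℝ≥0), 0 < γ ∧ γ ≤ 1 ∧ β = (k : ℝ) + (γ : ℝ) ∧ ContDiffOn ℝ k f U ∧
    ∀ x ∈ U, ∃ V ∈ 𝓝 x, ∃ C : ℝ≥0, HolderOnWith C γ (iteratedFDeriv ℝ k f) V

/-- The partial derivative `∂f / ∂x_i`. -/
def partialDeriv {d : ℕ} (i : Fin d) (f : Vec d → ℝ) (x : Vec d) : ℝ := fderiv ℝ f x (stdVec i)

/-- `G` is a portfolio generating function of class `C^β(Δ^d_+; ℝ_+)`: it is positive on `Δ^d_+` and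
of class `C^β` on some open neighbourhood of `Δ^d_+` in `ℝ^d`. -/
def IsGeneratingFunction {d : ℕ} (β : ℝ) (G : Vec d → ℝ) : Prop :=
  (∀ x ∈ openSimplex d, 0 < G x) ∧
    ∃ U : Set (Vec d), IsOpen U ∧ openSimplex d ⊆ U ∧ HolderSmoothOn β U G

/-- The portfolio generated by `G`. -/
def generatedPortfolio {d : ℕ} (G : Vec d → ℝ) (μ : ℝ≥0 → Vec d) (t : ℝ≥0) : Vec d :=
  WithLp.toLp 2 (fun i => μ t i * (partialDeriv i (fun x => Real.log (G x)) (μ t) + 1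
    - ∑ k, μ t k * partialDeriv k (fun x => Real.log (G x)) (μ t)))

/-- The integrand `(1 / G(μ_s)) ∂²G(μ_s)/∂x_i∂x_j μ^i_s μ^j_s`. -/
def masterIntegrand {d : ℕ} (G : Vec d → ℝ) (μ : ℝ≥0 → Vec d) (i j : Fin d) (s : ℝ≥0) : ℝ :=
  1 / G (μ s) * partialDeriv i (partialDeriv j G) (μ s) * μ s i * μ s j

end RoughSPT

end

/-!
The proof rests on two observations.

The first is a computation. On the open positive orthant let `H(x) = σ(x) G(x / σ(x))`, with
`σ(x) = ∑ x_i`, be the extension of `G` which is homogeneous of degree one (`homExt`). Then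
`π^i / S^i = ∂_i log H(S)` (`quotientPath_generatedPortfolio`), so that the integrand in the wealth
process is a gradient, and all first derivatives of `G` cancel in the Hessian of `H`:
`D²H(x)(v, w) = σ(x)⁻¹ D²G(x / σ(x))(Pv, Pw)`, where `Pv = v - σ(v) x / σ(x)`. Since
`D² log H + D log H ⊗ D log H = D²H / H`, Itô's formula for `log H(S)` turns the logarithm of the
wealth into `log H(S_t) - log H(S_0)` minus half the integral of `D²H / H` against the bracket, and
the latter is the integral against the relative covariance (`integrand_identity`). The market
portfolio is the case `G = 1`, where the integral vanishes; subtracting the two formulas gives the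
result.

The second is that Itô's formula and the independence of the rough integral of the choice of the
Gubinelli derivative are accessible without constructing general rough integrals. For the
Gubinelli derivative `D² log H(S)`, the convergence of the compensated sums is Taylor's formula,
combined with the existence of the Riemann–Stieltjes integrals against the bracket, which holds
because the quadratic forms of the bracket are monotone (`IsPricePath.hasRoughIntegral_gradient`,
`IsPricePath.monotone_bracket`). For any other Gubinelli derivative the compensated sums differ by
`∑ L_s 𝕊_{s,t}`, with `L` the difference of the derivatives. Along the partitions of Property (RIE)
such sums tend to zero, because the block sums of `𝕊` are the differences between the integral and
its Riemann sums, which vanish uniformly and are bounded in `p/2`-variation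
(`IsPricePath.weighted_blockSum_small`). Since `L_s S_{s,t}` is a difference of remainders,
`L_s 𝕊_{s,t}` is almost additive, and the discrete sewing lemma `norm_sub_sum_le_of_defect` carries
the conclusion over to all partitions with vanishing mesh (`IsPricePath.tendsto_sum_pair`). The
control function of Property (RIE) need not be continuous; the smallness near the diagonal comes
from the continuity of the paths, by interpolation (`le_interpolate`).
-/

noncomputable section

namespace RoughSPT

/-! ### Partitions as sequences -/

namespace FinPartition

variable {T : ℝ≥0}

/-- The points of a finite partition as a sequence indexed by `ℕ`, constant equal to `T` after the
last point. -/
def seq (P : FinPartition T) (i : ℕ) : ℝ≥0 := P.pt ⟨min i P.N, by omega⟩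

theorem seq_zero (P : FinPartition T) : P.seq 0 = 0 := by
  rw [← P.pt_zero]
  exact congrArg P.pt (Fin.ext (by simp))

theorem seq_last (P : FinPartition T) : P.seq P.N = T := by
  conv_rhs => rw [← P.pt_last]
  exact congrArg P.pt (Fin.ext (by simp))

theorem seq_mono (P : FinPartition T) : Monotone P.seq := fun i j h =>
  P.strictMono.monotone (by simp only [Fin.mk_le_mk]; omega)

theorem pt_eq_seq (P : FinPartition T) (k : Fin (P.N + 1)) : P.pt k = P.seq k :=
  congrArg P.pt (Fin.ext (by simp; omega))

theorem seq_eq_pt (P : FinPartition T) {i : ℕ} (hi : i ≤ P.N) :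
    P.seq i = P.pt ⟨i, by omega⟩ :=
  congrArg P.pt (Fin.ext (by simpa using hi))

theorem seq_le (P : FinPartition T) (i : ℕ) : P.seq i ≤ T := by
  conv_rhs => rw [← P.pt_last]
  exact P.strictMono.monotone (Fin.le_last _)

theorem left_eq_seq (P : FinPartition T) (k : Fin P.N) : P.left k = P.seq k :=
  P.pt_eq_seq _

theorem right_eq_seq (P : FinPartition T) (k : Fin P.N) : P.right k = P.seq (k + 1) :=
  P.pt_eq_seq _

theorem left_le_right (P : FinPartition T) (k : Fin P.N) : P.left k ≤ P.right k := by
  rw [P.left_eq_seq, P.right_eq_seq]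
  exact P.seq_mono (Nat.le_succ _)

theorem right_le (P : FinPartition T) (k : Fin P.N) : P.right k ≤ T := by
  rw [P.right_eq_seq]
  exact P.seq_le _

theorem sum_eq_sum_range {E : Type*} [AddCommMonoid E] (P : FinPartition T)
    (f : ℝ≥0 → ℝ≥0 → E) :
    ∑ k, f (P.left k) (P.right k) = ∑ i ∈ Finset.range P.N, f (P.seq i) (P.seq (i + 1)) := by
  rw [Finset.sum_range]
  exact Finset.sum_congr rfl fun k _ => by rw [P.left_eq_seq, P.right_eq_seq]

theorem right_sub_left_le_mesh (P : FinPartition T) (k : Fin P.N) :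
    P.right k - P.left k ≤ P.mesh :=
  Finset.le_sup (f := fun k => P.right k - P.left k) (Finset.mem_univ k)

theorem seq_succ_le (P : FinPartition T) (i : ℕ) : P.seq (i + 1) ≤ P.seq i + P.mesh := by
  rcases lt_or_ge i P.N with h | h
  · have := P.right_sub_left_le_mesh ⟨i, h⟩
    rw [P.left_eq_seq, P.right_eq_seq] at this
    exact tsub_le_iff_left.mp this
  · have : P.seq (i + 1) = P.seq i := congrArg P.pt (Fin.ext (by simp; omega))
    rw [this]
    exact le_self_add

theorem sum_sub {E : Type*} [AddCommGroup E] (P : FinPartition T) (f : ℝ≥0 → E) :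
    ∑ k, (f (P.right k) - f (P.left k)) = f T - f 0 := by
  rw [P.sum_eq_sum_range (fun s t => f t - f s), Finset.sum_range_sub (fun i => f (P.seq i)),
    P.seq_last, P.seq_zero]

/-- A point of `[0, T]` is approximated from above by a point of the partition. -/
theorem exists_seq_ge (P : FinPartition T) {s : ℝ≥0} (hs : s ≤ T) :
    ∃ k ≤ P.N, s ≤ P.seq k ∧ P.seq k ≤ s + P.mesh := by
  classical
  have hex : ∃ k, s ≤ P.seq k := ⟨P.N, by rwa [P.seq_last]⟩
  refine ⟨Nat.find hex, Nat.find_min' hex (by rwa [P.seq_last]), Nat.find_spec hex, ?_⟩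
  rcases h : Nat.find hex with _ | k
  · rw [P.seq_zero]; exact zero_le
  · have hk : P.seq k < s := not_le.mp (Nat.find_min hex (by omega))
    calc P.seq (k + 1) ≤ P.seq k + P.mesh := P.seq_succ_le k
      _ ≤ s + P.mesh := by gcongr

/-- A point of `[0, T]` is approximated from below by a point of the partition. -/
theorem exists_seq_le (P : FinPartition T) {t : ℝ≥0} (ht : t ≤ T) :
    ∃ l ≤ P.N, P.seq l ≤ t ∧ t ≤ P.seq l + P.mesh := by
  obtain ⟨k, hk, h1, h2⟩ := P.exists_seq_ge ht
  rcases k with _ | k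
  · refine ⟨0, hk, by rw [P.seq_zero]; exact zero_le, h1.trans le_self_add⟩
  · by_cases h : P.seq (k + 1) ≤ t
    · exact ⟨k + 1, hk, h, h1.trans le_self_add⟩
    · clear h2
      classical
      have hex : ∃ k, t ≤ P.seq k := ⟨k + 1, h1⟩
      have hf := Nat.find_spec hex
      have hle : Nat.find hex ≤ k + 1 := Nat.find_min' hex h1
      rcases hm : Nat.find hex with _ | m
      · rw [hm] at hf
        exact ⟨0, by omega, by rw [P.seq_zero]; exact zero_le, hf.trans le_self_add⟩
      · rw [hm] at hf
        have hlt : P.seq m < t := not_le.mp (Nat.find_min hex (by omega))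
        exact ⟨m, by omega, hlt.le, hf.trans (P.seq_succ_le m)⟩

/-- The partition of `[0, T]` into `N + 1` intervals of equal length. -/
def uniform (T : ℝ≥0) (hT : 0 < T) (N : ℕ) : FinPartition T where
  N := N + 1
  pt k := T * ((k : ℕ) / ((N : ℝ≥0) + 1))
  strictMono := by
    intro i j hij
    have hij' : ((i : ℕ) : ℝ≥0) < ((j : ℕ) : ℝ≥0) := by exact_mod_cast hij
    simp only
    gcongr
  pt_zero := by simp
  pt_last := by
    simp

end FinPartition

instance meshToZero_neBot (T : ℝ≥0) : (meshToZero T).NeBot := by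
  rw [meshToZero, comap_neBot_iff]
  intro s hs
  rcases eq_or_ne T 0 with rfl | hT
  · refine ⟨⟨0, fun _ => 0, fun i j h => absurd h (by omega), rfl, rfl⟩, ?_⟩
    have : FinPartition.mesh (⟨0, fun _ => 0, fun i j h => absurd h (by omega), rfl, rfl⟩ :
        FinPartition 0) = 0 := by simp [FinPartition.mesh]
    rw [this]
    exact mem_of_mem_nhds hs
  · have hT : 0 < T := pos_iff_ne_zero.mpr hT
    have hlim : Tendsto (fun N : ℕ => T * (1 / ((N : ℝ≥0) + 1))) atTop (𝓝 0) := by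
      simpa using (tendsto_one_div_add_atTop_nhds_zero_nat (𝕜 := ℝ≥0)).const_mul T
    have hmesh : Tendsto (fun N : ℕ => (FinPartition.uniform T hT N).mesh) atTop (𝓝 0) := by
      refine tendsto_of_tendsto_of_tendsto_of_le_of_le tendsto_const_nhds hlim
        (fun _ => zero_le) fun N => ?_
      refine Finset.sup_le fun k _ => ?_
      refine tsub_le_iff_left.mpr (le_of_eq ?_)
      simp only [FinPartition.left, FinPartition.right, FinPartition.uniform,
        ← mul_add, ← add_div]
      have h : ((k.succ : ℕ) : ℝ≥0) = (k.castSucc : ℕ) + 1 := by push_cast [Fin.val_succ]; rfl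
      exact congrArg (fun z => T * (z / ((N : ℝ≥0) + 1))) h
    obtain ⟨N, hN⟩ := (hmesh.eventually hs).exists
    exact ⟨_, hN⟩

theorem eventually_mesh_lt {T δ : ℝ≥0} (hδ : 0 < δ) :
    ∀ᶠ P : FinPartition T in meshToZero T, P.mesh < δ :=
  tendsto_comap.eventually (gt_mem_nhds hδ)

/-! ### Control functions and variation bounds -/

namespace IsControl

variable {T : ℝ≥0} {c c' : ℝ≥0 → ℝ≥0 → ℝ≥0}

theorem mono (hc : IsControl T c) {s u v t : ℝ≥0} (h1 : s ≤ u) (h2 : u ≤ v) (h3 : v ≤ t)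
    (h4 : t ≤ T) : c u v ≤ c s t :=
  calc c u v ≤ c s u + c u v := le_add_self
    _ ≤ c s v := hc s u v h1 h2 (h3.trans h4)
    _ ≤ c s v + c v t := le_self_add
    _ ≤ c s t := hc s v t (h1.trans h2) h3 h4

theorem restrict (hc : IsControl T c) {t : ℝ≥0} (ht : t ≤ T) : IsControl t c :=
  fun s u v h1 h2 h3 => hc s u v h1 h2 (h3.trans ht)

theorem add (hc : IsControl T c) (hc' : IsControl T c') :
    IsControl T (fun s t => c s t + c' s t) := fun s u t h1 h2 h3 => by
  have := add_le_add (hc s u t h1 h2 h3) (hc' s u t h1 h2 h3)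
  calc _ = c s u + c u t + (c' s u + c' u t) := by ring
    _ ≤ _ := this

theorem sum_le (hc : IsControl T c) {x : ℕ → ℝ≥0} (hx : Monotone x) (n : ℕ) (hn : x n ≤ T) :
    ∑ i ∈ Finset.range n, c (x i) (x (i + 1)) ≤ c (x 0) (x n) := by
  induction n with
  | zero => simp
  | succ n ih =>
    rw [Finset.sum_range_succ]
    have h := hx (Nat.le_succ n)
    exact (add_le_add_left (ih (h.trans hn)) _).trans (hc _ _ _ (hx (Nat.zero_le n)) h hn)

theorem sum_partition_le (hc : IsControl T c) (P : FinPartition T) :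
    ∑ k, c (P.left k) (P.right k) ≤ c 0 T := by
  rw [P.sum_eq_sum_range]
  have := hc.sum_le P.seq_mono P.N P.seq_last.le
  rwa [P.seq_zero, P.seq_last] at this

/-- Powers with exponent at least one of a control sum up to at most the power of the total. -/
theorem sum_partition_rpow_le (hc : IsControl T c) {θ : ℝ} (hθ : 1 ≤ θ) (P : FinPartition T) :
    ∑ k, (c (P.left k) (P.right k) : ℝ) ^ θ ≤ (c 0 T : ℝ) ^ θ := by
  have h : ∀ x : ℝ≥0, x ≤ c 0 T → (x : ℝ) ^ θ ≤ x * (c 0 T : ℝ) ^ (θ - 1) := fun x hx => by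
    rcases eq_or_ne x 0 with rfl | h0
    · simp [Real.zero_rpow (by linarith : θ ≠ 0)]
    · have hx0 : (0 : ℝ) < x := by exact_mod_cast pos_iff_ne_zero.mpr h0
      have : (x : ℝ) ^ θ = x * (x : ℝ) ^ (θ - 1) := by
        rw [← Real.rpow_one_add' hx0.le (by linarith)]; congr 1; ring
      rw [this]
      gcongr
  calc ∑ k, (c (P.left k) (P.right k) : ℝ) ^ θ
      ≤ ∑ k, (c (P.left k) (P.right k) : ℝ) * (c 0 T : ℝ) ^ (θ - 1) :=
        Finset.sum_le_sum fun k _ => h _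
          (hc.mono zero_le (P.left_le_right k) (P.right_le k) le_rfl)
    _ = ((∑ k, c (P.left k) (P.right k) : ℝ≥0) : ℝ) * (c 0 T : ℝ) ^ (θ - 1) := by
        rw [← Finset.sum_mul]; push_cast; rfl
    _ ≤ (c 0 T : ℝ) * (c 0 T : ℝ) ^ (θ - 1) := by
        gcongr
        exact_mod_cast hc.sum_partition_le P
    _ = (c 0 T : ℝ) ^ θ := by
        rw [← Real.rpow_one_add' (NNReal.coe_nonneg _) (by linarith)]; congr 1; ring

end IsControl

/-- `‖Ξ s t‖ ≤ C ω(s, t)^a` on `[0, T]` for some control `ω` and some constant `C`. With `a = 1 / p`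
this is the control form of finite `p`-variation. -/
def VarBound {E : Type*} [NormedAddCommGroup E] (T : ℝ≥0) (a : ℝ) (Ξ : ℝ≥0 → ℝ≥0 → E) : Prop :=
  ∃ (ω : ℝ≥0 → ℝ≥0 → ℝ≥0) (C : ℝ), IsControl T ω ∧ 0 ≤ C ∧
    ∀ s t, s ≤ t → t ≤ T → ‖Ξ s t‖ ≤ C * (ω s t : ℝ) ^ a

namespace VarBound

variable {E F H : Type*} [NormedAddCommGroup E] [NormedAddCommGroup F] [NormedAddCommGroup H]
  {T : ℝ≥0} {a b : ℝ} {Ξ : ℝ≥0 → ℝ≥0 → E} {Θ : ℝ≥0 → ℝ≥0 → F} {Λ : ℝ≥0 → ℝ≥0 → H}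

theorem of_le (h : VarBound T a Ξ) (C : ℝ) (hC : 0 ≤ C)
    (hΘ : ∀ s t, s ≤ t → t ≤ T → ‖Θ s t‖ ≤ C * ‖Ξ s t‖) : VarBound T a Θ := by
  obtain ⟨ω, D, hω, hD, h⟩ := h
  refine ⟨ω, C * D, hω, by positivity, fun s t h1 h2 => (hΘ s t h1 h2).trans ?_⟩
  rw [mul_assoc]
  exact mul_le_mul_of_nonneg_left (h s t h1 h2) hC

theorem of_le_add (ha : 0 ≤ a) (h : VarBound T a Ξ) (h' : VarBound T a Θ)
    (hΛ : ∀ s t, s ≤ t → t ≤ T → ‖Λ s t‖ ≤ ‖Ξ s t‖ + ‖Θ s t‖) : VarBound T a Λ := by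
  obtain ⟨ω, C, hω, hC, h⟩ := h
  obtain ⟨ω', C', hω', hC', h'⟩ := h'
  refine ⟨_, C + C', hω.add hω', by positivity, fun s t h1 h2 => (hΛ s t h1 h2).trans ?_⟩
  rw [add_mul]
  refine add_le_add ((h s t h1 h2).trans ?_) ((h' s t h1 h2).trans ?_)
  · gcongr; simp
  · gcongr; simp

theorem of_le_mul (ha : 0 ≤ a) (hb : 0 ≤ b) (h : VarBound T a Ξ) (h' : VarBound T b Θ)
    (C : ℝ) (hC : 0 ≤ C)
    (hΛ : ∀ s t, s ≤ t → t ≤ T → ‖Λ s t‖ ≤ C * (‖Ξ s t‖ * ‖Θ s t‖)) :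
    VarBound T (a + b) Λ := by
  obtain ⟨ω, D, hω, hD, h⟩ := h
  obtain ⟨ω', D', hω', hD', h'⟩ := h'
  refine ⟨_, C * (D * D'), hω.add hω', by positivity, fun s t h1 h2 => (hΛ s t h1 h2).trans ?_⟩
  rw [mul_assoc]
  refine mul_le_mul_of_nonneg_left ?_ hC
  rw [Real.rpow_add_of_nonneg (NNReal.coe_nonneg _) ha hb, mul_mul_mul_comm]
  refine mul_le_mul ((h s t h1 h2).trans ?_) ((h' s t h1 h2).trans ?_) (norm_nonneg _)
    (by positivity)
  · gcongr; simp
  · gcongr; simp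

theorem exponent_le (hb : 0 ≤ b) (hab : b ≤ a) (h : VarBound T a Ξ) : VarBound T b Ξ := by
  obtain ⟨ω, C, hω, hC, h⟩ := h
  refine ⟨ω, C * (ω 0 T : ℝ) ^ (a - b), hω, by positivity, fun s t h1 h2 =>
    (h s t h1 h2).trans ?_⟩
  rw [mul_assoc]
  refine mul_le_mul_of_nonneg_left ?_ hC
  have hle : (ω s t : ℝ) ≤ ω 0 T := by exact_mod_cast hω.mono zero_le h1 h2 le_rfl
  calc (ω s t : ℝ) ^ a = (ω s t : ℝ) ^ (a - b) * (ω s t : ℝ) ^ b := by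
        rw [← Real.rpow_add_of_nonneg (NNReal.coe_nonneg _) (by linarith) hb]; congr 1; ring
    _ ≤ _ := by gcongr

theorem of_le_rpow {γ : ℝ} (hγ : 0 ≤ γ) (h : VarBound T a Ξ) (C : ℝ) (hC : 0 ≤ C)
    (hΘ : ∀ s t, s ≤ t → t ≤ T → ‖Θ s t‖ ≤ C * ‖Ξ s t‖ ^ γ) : VarBound T (a * γ) Θ := by
  obtain ⟨ω, D, hω, hD, h⟩ := h
  refine ⟨ω, C * D ^ γ, hω, by positivity, fun s t h1 h2 => (hΘ s t h1 h2).trans ?_⟩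
  rw [mul_assoc, Real.rpow_mul (NNReal.coe_nonneg _), ← Real.mul_rpow hD (by positivity)]
  gcongr
  exact h s t h1 h2

theorem restrict (h : VarBound T a Ξ) {t : ℝ≥0} (ht : t ≤ T) : VarBound t a Ξ := by
  obtain ⟨ω, C, hω, hC, h⟩ := h
  exact ⟨ω, C, hω.restrict ht, hC, fun s u h1 h2 => h s u h1 (h2.trans ht)⟩

/-- A variation bound with exponent `a > 0` may be given with constant `1`. -/
theorem exists_control (ha : 0 < a) (h : VarBound T a Ξ) :
    ∃ ω, IsControl T ω ∧ ∀ s t, s ≤ t → t ≤ T → ‖Ξ s t‖ ≤ (ω s t : ℝ) ^ a := by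
  obtain ⟨ω, C, hω, hC, h⟩ := h
  refine ⟨fun s t => (C ^ a⁻¹).toNNReal * ω s t, fun s u t h1 h2 h3 => ?_,
    fun s t h1 h2 => (h s t h1 h2).trans_eq ?_⟩
  · simp only [← mul_add]
    gcongr
    exact hω s u t h1 h2 h3
  · rw [NNReal.coe_mul, Real.mul_rpow (NNReal.coe_nonneg _) (NNReal.coe_nonneg _),
      Real.coe_toNNReal _ (by positivity),
      ← Real.rpow_mul hC, inv_mul_cancel₀ ha.ne', Real.rpow_one]

theorem hasFiniteVariation {p : ℝ} (hp : 0 < p) (h : VarBound T (1 / p) Ξ) :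
    HasFiniteVariation p Ξ T := by
  obtain ⟨ω, C, hω, hC, h⟩ := h
  refine ⟨C ^ p * ω 0 T, fun P => ?_⟩
  calc ∑ k, ‖Ξ (P.left k) (P.right k)‖ ^ p
      ≤ ∑ k, C ^ p * (ω (P.left k) (P.right k) : ℝ) := Finset.sum_le_sum fun k _ => by
        calc ‖Ξ (P.left k) (P.right k)‖ ^ p
            ≤ (C * (ω (P.left k) (P.right k) : ℝ) ^ (1 / p)) ^ p := by
              gcongr
              exact h _ _ (P.left_le_right k) (P.right_le k)
          _ = _ := by
              rw [Real.mul_rpow hC (by positivity), ← Real.rpow_mul (NNReal.coe_nonneg _),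
                one_div_mul_cancel hp.ne', Real.rpow_one]
    _ = C ^ p * ((∑ k, ω (P.left k) (P.right k) : ℝ≥0) : ℝ) := by
        rw [← Finset.mul_sum]; push_cast; rfl
    _ ≤ _ := by
        gcongr
        exact_mod_cast hω.sum_partition_le P

end VarBound

/-- `ChainSum g s t x`: the number `x` is the sum of `g` over consecutive points of some finite
strictly increasing chain from `s` to `t`. -/
inductive ChainSum (g : ℝ≥0 → ℝ≥0 → ℝ) : ℝ≥0 → ℝ≥0 → ℝ → Prop
  | refl (s : ℝ≥0) : ChainSum g s s 0
  | step {s u t : ℝ≥0} {x : ℝ} : s < u → ChainSum g u t x → ChainSum g s t (g s u + x)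

namespace ChainSum

variable {g : ℝ≥0 → ℝ≥0 → ℝ}

theorem append {s u t : ℝ≥0} {x y : ℝ} (h : ChainSum g s u x) (h' : ChainSum g u t y) :
    ChainSum g s t (x + y) := by
  induction h with
  | refl s => simpa using h'
  | step hlt _ ih => rw [add_assoc]; exact step hlt (ih h')

theorem single (hg : ∀ s, g s s = 0) {s t : ℝ≥0} (h : s ≤ t) : ChainSum g s t (g s t) := by
  rcases h.eq_or_lt with rfl | h
  · rw [hg]; exact refl _
  · simpa using step (g := g) h (refl t)

theorem exists_seq {s t : ℝ≥0} {x : ℝ} (h : ChainSum g s t x) :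
    ∃ (n : ℕ) (u : ℕ → ℝ≥0), (∀ i < n, u i < u (i + 1)) ∧ u 0 = s ∧ u n = t ∧
      ∑ i ∈ Finset.range n, g (u i) (u (i + 1)) = x := by
  induction h with
  | refl s => exact ⟨0, fun _ => s, by simp, rfl, rfl, by simp⟩
  | @step s v t x hlt _ ih =>
    obtain ⟨n, u, h1, h2, h3, h4⟩ := ih
    refine ⟨n + 1, fun i => Nat.casesOn i s u, ?_, rfl, h3, ?_⟩
    · rintro (_ | i) hi
      · simpa [h2] using hlt
      · exact h1 i (by omega)
    · rw [Finset.sum_range_succ', add_comm]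
      simp only [h4]
      rw [← h2]
      rfl

theorem exists_finPartition {T : ℝ≥0} {x : ℝ} (h : ChainSum g 0 T x) :
    ∃ P : FinPartition T, ∑ k, g (P.left k) (P.right k) = x := by
  obtain ⟨n, u, h1, h2, h3, h4⟩ := h.exists_seq
  refine ⟨⟨n, fun k => u k, Fin.strictMono_iff_lt_succ.mpr fun i => ?_, h2, h3⟩, ?_⟩
  · simpa using h1 i i.2
  · rw [← h4, Finset.sum_range]
    rfl

end ChainSum

/-- Finite variation, tested on partitions of `[0, T]` only, is witnessed by a control function: the
supremum of the chain sums over each subinterval. -/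
theorem HasFiniteVariation.varBound {E : Type*} [NormedAddCommGroup E] {p : ℝ} (hp : 0 < p)
    {Ξ : ℝ≥0 → ℝ≥0 → E} {T : ℝ≥0} (hΞ : ∀ s, Ξ s s = 0) (h : HasFiniteVariation p Ξ T) :
    VarBound T (1 / p) Ξ := by
  obtain ⟨C, hC⟩ := h
  set g : ℝ≥0 → ℝ≥0 → ℝ := fun s t => ‖Ξ s t‖ ^ p with hg
  have hg0 : ∀ s, g s s = 0 := fun s => by simp [hg, hΞ, Real.zero_rpow hp.ne']
  have hgn : ∀ s t, 0 ≤ g s t := fun s t => by positivity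
  have hbdd : ∀ s t, s ≤ t → t ≤ T → ∀ x, ChainSum g s t x → x ≤ C := fun s t _ h2 x hx => by
    obtain ⟨P, hP⟩ := (((ChainSum.single hg0 (zero_le (a := s))).append hx).append
      (ChainSum.single hg0 h2)).exists_finPartition
    have := hC P
    rw [hP] at this
    linarith [hgn 0 s, hgn t T]
  set W : ℝ≥0 → ℝ≥0 → ℝ := fun s t => sSup {x | ChainSum g s t x}
  have hle : ∀ s t, s ≤ t → t ≤ T → ∀ x, ChainSum g s t x → x ≤ W s t := fun s t h1 h2 x hx =>
    le_csSup ⟨C, fun y hy => hbdd s t h1 h2 y hy⟩ hx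
  have hW0 : ∀ s t, s ≤ t → t ≤ T → 0 ≤ W s t := fun s t h1 h2 =>
    (hgn s t).trans (hle s t h1 h2 _ (ChainSum.single hg0 h1))
  refine ⟨fun s t => (W s t).toNNReal, 1, fun s u t h1 h2 h3 => ?_, zero_le_one,
    fun s t h1 h2 => ?_⟩
  · rw [← Real.toNNReal_add (hW0 s u h1 (h2.trans h3)) (hW0 u t h2 h3)]
    refine Real.toNNReal_le_toNNReal ?_
    have hne : ∀ s t, s ≤ t → {x | ChainSum g s t x}.Nonempty := fun s t h =>
      ⟨_, ChainSum.single hg0 h⟩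
    rw [← le_sub_iff_add_le]
    refine csSup_le (hne s u h1) fun x hx => ?_
    rw [le_sub_comm]
    refine csSup_le (hne u t h2) fun y hy => ?_
    rw [le_sub_iff_add_le']
    exact hle s t (h1.trans h2) h3 _ (ChainSum.append hx hy)
  · rw [one_mul, Real.coe_toNNReal _ (hW0 s t h1 h2)]
    have := hle s t h1 h2 _ (ChainSum.single hg0 h1)
    calc ‖Ξ s t‖ = (g s t) ^ (1 / p) := by
          rw [hg, ← Real.rpow_mul (norm_nonneg _), mul_one_div_cancel hp.ne', Real.rpow_one]
      _ ≤ _ := Real.rpow_le_rpow (hgn s t) this (by positivity)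

/-! ### The discrete sewing lemma -/

/-- Discrete sewing lemma: if the defect of additivity of `Ξ` is at most `B ω^θ` with `ω`
superadditive and `θ > 1`, then `Ξ i j` differs from the sum over the consecutive pairs between `i`
and `j` by a multiple of `B ω(i, j)^θ` which does not depend on the number of points. The interval
is split at an index on both sides of which `ω` is at most half its total. -/
theorem norm_sub_sum_le_of_defect {E : Type*} [SeminormedAddCommGroup E] {Ξ : ℕ → ℕ → E}
    {ω : ℕ → ℕ → ℝ} {B θ : ℝ} (hθ : 1 < θ) (hB : 0 ≤ B) {a n : ℕ} (hω0 : ∀ i j, 0 ≤ ω i j)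
    (hω : ∀ i j k, a ≤ i → i ≤ j → j ≤ k → k ≤ n → ω i j + ω j k ≤ ω i k)
    (hΞ : ∀ i j k, a ≤ i → i ≤ j → j ≤ k → k ≤ n →
      ‖Ξ i k - Ξ i j - Ξ j k‖ ≤ B * ω i k ^ θ)
    (i j : ℕ) (hi : a ≤ i) (hij : i ≤ j) (hj : j ≤ n) :
    ‖Ξ i j - ∑ k ∈ Finset.Ico i j, Ξ k (k + 1)‖ ≤
      2 / (1 - 2 ^ (1 - θ)) * B * ω i j ^ θ := by
  have h2 : (2 : ℝ) ^ (1 - θ) < 1 := Real.rpow_lt_one_of_one_lt_of_neg (by norm_num) (by linarith)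
  set K : ℝ := 2 / (1 - 2 ^ (1 - θ)) with hK
  have hK0 : 0 ≤ K := div_nonneg zero_le_two (by linarith)
  have hKe : 2 + K * 2 ^ (1 - θ) = K := by
    have : (1 - (2 : ℝ) ^ (1 - θ)) ≠ 0 := by linarith
    rw [hK]; field_simp; ring
  have hdiag : ∀ i, a ≤ i → i ≤ n → ω i i = 0 := fun i ha hi =>
    le_antisymm (by linarith [hω i i i ha le_rfl le_rfl hi]) (hω0 i i)
  obtain ⟨m, hm⟩ : ∃ m, j - i ≤ m := ⟨_, le_rfl⟩
  induction m generalizing i j with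
  | zero =>
    obtain rfl : i = j := by omega
    have := hΞ i i i hi le_rfl le_rfl hj
    rw [hdiag i hi hj, Real.zero_rpow (by linarith), mul_zero] at this
    rw [hdiag i hi hj, Real.zero_rpow (by linarith), mul_zero]
    simpa using this
  | succ m ih =>
    rcases hij.eq_or_lt with rfl | hlt
    · exact ih i i hi le_rfl hj (by omega)
    classical
    -- the last index up to which `ω` has at most half of its mass
    let s := (Finset.Ico i j).filter fun l => ω i l ≤ ω i j / 2
    have hs : s.Nonempty := ⟨i, by
      simp only [s, Finset.mem_filter, Finset.mem_Ico, le_refl, true_and, hlt,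
        hdiag i hi (hij.trans hj)]
      linarith [hω0 i j]⟩
    set l := s.max' hs
    have hl : l ∈ s := s.max'_mem hs
    simp only [s, Finset.mem_filter, Finset.mem_Ico] at hl
    obtain ⟨⟨hil, hlj⟩, hl2⟩ := hl
    have hr2 : ω (l + 1) j ≤ ω i j / 2 := by
      rcases (Nat.succ_le_of_lt hlj).eq_or_lt with h | h
      · rw [← h, hdiag _ (by omega) (by omega)]
        rw [h]; linarith [hω0 i j]
      · have : ¬ ω i (l + 1) ≤ ω i j / 2 := fun hc => by
          have hmem : l + 1 ∈ s := by
            simp only [s, Finset.mem_filter, Finset.mem_Ico]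
            exact ⟨⟨by omega, h⟩, hc⟩
          have := s.le_max' _ hmem
          change l + 1 ≤ l at this
          omega
        linarith [hω i (l + 1) j hi (by omega) (by omega) hj]
    have e1 := ih i l hi hil (by omega) (by omega)
    have e2 := ih (l + 1) j (by omega) (by omega) hj (by omega)
    have e3 := hΞ i l j hi hil hlj.le hj
    have e4 := hΞ l (l + 1) j (by omega) (by omega) (by omega) hj
    have hlj' : ω l j ≤ ω i j := by linarith [hω i l j hi hil hlj.le hj, hω0 i l]
    have hsum : ∑ k ∈ Finset.Ico i j, Ξ k (k + 1) = ∑ k ∈ Finset.Ico i l, Ξ k (k + 1) +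
        (Ξ l (l + 1) + ∑ k ∈ Finset.Ico (l + 1) j, Ξ k (k + 1)) := by
      rw [← Finset.sum_Ico_consecutive _ hil hlj.le, Finset.sum_eq_sum_Ico_succ_bot hlj]
    have hdec : Ξ i j - ∑ k ∈ Finset.Ico i j, Ξ k (k + 1) =
        (Ξ i l - ∑ k ∈ Finset.Ico i l, Ξ k (k + 1)) +
        (Ξ (l + 1) j - ∑ k ∈ Finset.Ico (l + 1) j, Ξ k (k + 1)) +
        (Ξ i j - Ξ i l - Ξ l j) + (Ξ l j - Ξ l (l + 1) - Ξ (l + 1) j) := by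
      rw [hsum]; abel
    have hhalf : ∀ x, 0 ≤ x → x ≤ ω i j / 2 →
        K * B * x ^ θ ≤ K * B * (ω i j ^ θ * (2 ^ (1 - θ) / 2)) := fun x hx0 hx => by
      have : (ω i j / 2) ^ θ = ω i j ^ θ * (2 ^ (1 - θ) / 2) := by
        rw [Real.div_rpow (hω0 i j) zero_le_two, Real.rpow_sub zero_lt_two, Real.rpow_one]
        have : (2 : ℝ) ^ θ ≠ 0 := by positivity
        field_simp
      rw [← this]
      gcongr
    have e4' : B * ω l j ^ θ ≤ B * ω i j ^ θ := by
      have := hω0 l j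
      gcongr
    calc _ ≤ K * B * (ω i j ^ θ * (2 ^ (1 - θ) / 2)) + K * B * (ω i j ^ θ * (2 ^ (1 - θ) / 2)) +
          B * ω i j ^ θ + B * ω i j ^ θ := by
          rw [hdec]
          refine (norm_add_le _ _).trans (add_le_add ((norm_add_le _ _).trans
            (add_le_add ((norm_add_le _ _).trans (add_le_add ?_ ?_)) e3)) (e4.trans e4'))
          · exact e1.trans (hhalf _ (hω0 i l) hl2)
          · exact e2.trans (hhalf _ (hω0 _ _) hr2)
      _ = (2 + K * 2 ^ (1 - θ)) * B * ω i j ^ θ := by ring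
      _ = K * B * ω i j ^ θ := by rw [hKe]

/-- Interpolation between a bound `A w^θ` and a small bound `η`, keeping an exponent `θ' ≤ θ`. -/
theorem le_interpolate {x A w η θ θ' : ℝ} (hx : 0 ≤ x) (hA : 0 ≤ A) (hw : 0 ≤ w)
    (hθ' : 0 < θ') (hθ : θ' ≤ θ) (h1 : x ≤ A * w ^ θ) (h2 : x ≤ η) :
    x ≤ A ^ (θ' / θ) * η ^ (1 - θ' / θ) * w ^ θ' := by
  have hθ0 : 0 < θ := hθ'.trans_le hθ
  have hr : θ' / θ ≤ 1 := (div_le_one hθ0).mpr hθ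
  have hr0 : 0 ≤ θ' / θ := by positivity
  calc x = x ^ (θ' / θ) * x ^ (1 - θ' / θ) := by
        rw [← Real.rpow_add_of_nonneg hx hr0 (by linarith)]; simp
    _ ≤ (A * w ^ θ) ^ (θ' / θ) * η ^ (1 - θ' / θ) := by
        gcongr
    _ = _ := by
        rw [Real.mul_rpow hA (by positivity), ← Real.rpow_mul hw, mul_div_cancel₀ _ hθ0.ne']
        ring

/-! ### Tensors and the pairing of Gubinelli derivatives with the second level -/

section Pairing

variable {d : ℕ}

@[simp]
theorem tprod_apply (A B : Vec d) (ij : Fin d × Fin d) : tprod A B ij = A ij.1 * B ij.2 := rfl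

@[fun_prop]
theorem _root_.Continuous.tprod {X : Type*} [TopologicalSpace X] {f g : X → Vec d}
    (hf : Continuous f) (hg : Continuous g) : Continuous fun x => RoughSPT.tprod (f x) (g x) := by
  unfold RoughSPT.tprod
  fun_prop

/-- The pairing `∑_{i,j} L^{ij} Z^{ji}` by which a Gubinelli derivative acts on the second level. -/
def pair (L : Vec d →L[ℝ] Vec d) (Z : Tensor d) : ℝ :=
  ∑ i, ∑ j, L (stdVec j) i * Z (j, i)

theorem pair_sub_left (L L' : Vec d →L[ℝ] Vec d) (Z : Tensor d) :
    pair (L - L') Z = pair L Z - pair L' Z := by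
  simp [pair, sub_mul, Finset.sum_sub_distrib]

theorem pair_add_right (L : Vec d →L[ℝ] Vec d) (Z Z' : Tensor d) :
    pair L (Z + Z') = pair L Z + pair L Z' := by
  simp [pair, mul_add, Finset.sum_add_distrib]

@[simp]
theorem pair_zero_right (L : Vec d →L[ℝ] Vec d) : pair L 0 = 0 := by
  simp [pair]

theorem abs_pair_le (L : Vec d →L[ℝ] Vec d) (Z : Tensor d) :
    |pair L Z| ≤ (d * d : ℝ) * (‖L‖ * ‖Z‖) := by
  have h : ∀ i j, |L (stdVec j) i * Z (j, i)| ≤ ‖L‖ * ‖Z‖ := fun i j => by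
    rw [abs_mul]
    refine mul_le_mul ?_ (PiLp.norm_apply_le Z (j, i)) (abs_nonneg _) (norm_nonneg _)
    refine (PiLp.norm_apply_le (L (stdVec j)) i).trans ((L.le_opNorm _).trans_eq ?_)
    simp [stdVec]
  calc |pair L Z| ≤ ∑ i : Fin d, ∑ j : Fin d, ‖L‖ * ‖Z‖ :=
        (Finset.abs_sum_le_sum_abs _ _).trans (Finset.sum_le_sum fun i _ =>
          (Finset.abs_sum_le_sum_abs _ _).trans (Finset.sum_le_sum fun j _ => h i j))
    _ = _ := by simp [mul_assoc]

theorem sum_smul_stdVec (v : Vec d) : ∑ j, v j • stdVec j = v := by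
  ext i
  simp [stdVec, Finset.sum_apply, Pi.single_apply]

theorem pair_tprod (L : Vec d →L[ℝ] Vec d) (a b : Vec d) :
    pair L (tprod a b) = ∑ i, L a i * b i := by
  refine Finset.sum_congr rfl fun i _ => ?_
  conv_rhs => rw [← sum_smul_stdVec a]
  simp only [map_sum, map_smul, PiLp.smul_apply, WithLp.ofLp_sum, Finset.sum_apply, smul_eq_mul,
    Finset.sum_mul, tprod_apply]
  exact Finset.sum_congr rfl fun j _ => by ring

theorem abs_pair_tprod_le (L : Vec d →L[ℝ] Vec d) (a b : Vec d) :
    |pair L (tprod a b)| ≤ ‖L a‖ * ‖b‖ := by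
  have : pair L (tprod a b) = inner ℝ (L a) b := by
    rw [pair_tprod, PiLp.inner_apply]
    exact Finset.sum_congr rfl fun i _ => by simp [mul_comm]
  rw [this]
  exact abs_real_inner_le_norm _ _

@[fun_prop]
theorem _root_.ContinuousOn.pair {X : Type*} [TopologicalSpace X] {f : X → Vec d →L[ℝ] Vec d}
    {g : X → Tensor d} {s : Set X} (hf : ContinuousOn f s) (hg : ContinuousOn g s) :
    ContinuousOn (fun x => RoughSPT.pair (f x) (g x)) s := by
  unfold RoughSPT.pair
  fun_prop

end Pairing

/-! ### Riemann sums along the partitions and the second level -/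

section SecondLevel

variable {d : ℕ} {S : ℝ≥0 → Vec d} {Pn : ℕ → InfPartition} {T : ℝ≥0}

/-- The Riemann sum up to time `t` depends on the points of the partition before `t` only. -/
theorem riemannSum_restrict (S : ℝ≥0 → Vec d) (P : InfPartition) {t T : ℝ≥0} (h : t ≤ T) :
    riemannSum S (P.restrict T) t = riemannSum S (P.restrict t) t := by
  classical
  set g : ℕ → Tensor d := fun i =>
    tprod (S (P.pt i)) (S (min (P.pt (i + 1)) t) - S (min (P.pt i) t)) with hg
  have key : ∀ R, t ≤ R → riemannSum S (P.restrict R) t =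
      ∑ i ∈ Finset.range (Nat.find (P.exists_le_pt R)), g i := fun R hR => by
    rw [Finset.sum_range]
    refine Finset.sum_congr rfl fun k _ => ?_
    have hk : P.pt k < R := not_le.mp (Nat.find_min (P.exists_le_pt R) k.2)
    have h1 : (P.restrict R).left k = P.pt k := min_eq_left hk.le
    have h2 : (P.restrict R).right k = min (P.pt (k + 1)) R := rfl
    rw [h1, h2, min_assoc, min_eq_right hR]
  rw [key T h, key t le_rfl]
  symm
  refine Finset.sum_subset (Finset.range_mono (Nat.find_min' _
    (h.trans (Nat.find_spec (P.exists_le_pt T))))) fun i _ hi => ?_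
  have hi' : t ≤ P.pt i := (Nat.find_spec (P.exists_le_pt t)).trans
    (P.strictMono.monotone (by simpa using hi))
  have hi'' : t ≤ P.pt (i + 1) := hi'.trans (P.strictMono.monotone (Nat.le_succ i))
  simp only [hg, min_eq_right hi', min_eq_right hi'', sub_self]
  ext ij
  simp

theorem riemannSum_seq_succ (S : ℝ≥0 → Vec d) (P : FinPartition T) {i : ℕ} (hi : i < P.N) :
    riemannSum S P (P.seq (i + 1)) - riemannSum S P (P.seq i) =
      tprod (S (P.seq i)) (S (P.seq (i + 1)) - S (P.seq i)) := by
  rw [riemannSum, riemannSum, ← Finset.sum_sub_distrib,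
    Finset.sum_eq_single (⟨i, hi⟩ : Fin P.N)]
  · rw [P.left_eq_seq, P.right_eq_seq]
    have h := P.seq_mono (Nat.le_succ i)
    ext jk
    simp only [PiLp.sub_apply, tprod_apply, min_self,
      min_eq_left (show P.seq i ≤ P.seq (i + 1) from h),
      min_eq_right (show P.seq i ≤ P.seq (i + 1) from h)]
    ring
  · intro k _ hk
    rw [P.left_eq_seq, P.right_eq_seq]
    have hne : (k : ℕ) ≠ i := fun h => hk (Fin.ext h)
    ext jk
    rcases lt_or_gt_of_ne hne with h | h
    · have h1 : P.seq (k + 1) ≤ P.seq i := P.seq_mono h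
      have h2 : P.seq k ≤ P.seq i := P.seq_mono h.le
      have h3 := P.seq_mono (Nat.le_succ i)
      simp [min_eq_left h1, min_eq_left h2, min_eq_left (h1.trans h3), min_eq_left (h2.trans h3)]
    · have h1 : P.seq (i + 1) ≤ P.seq k := P.seq_mono h
      have h2 : P.seq k ≤ P.seq (k + 1) := P.seq_mono (Nat.le_succ _)
      have h3 := P.seq_mono (Nat.le_succ i)
      simp [min_eq_right h1, min_eq_right (h1.trans h2), min_eq_right (h3.trans h1),
        min_eq_right (h3.trans (h1.trans h2))]
  · simp

theorem continuous_riemannSum (hS : Continuous S) (P : FinPartition T) :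
    Continuous (riemannSum S P) := by
  unfold riemannSum
  fun_prop

/-- Chen's relation. -/
theorem secondLevel_chen (S : ℝ≥0 → Vec d) (Pn : ℕ → InfPartition) (s u t : ℝ≥0) :
    secondLevel S Pn s t - secondLevel S Pn s u - secondLevel S Pn u t =
      tprod (S u - S s) (S t - S u) := by
  ext ij
  simp only [secondLevel, PiLp.sub_apply, tprod_apply]
  ring

@[simp]
theorem secondLevel_self (S : ℝ≥0 → Vec d) (Pn : ℕ → InfPartition) (s : ℝ≥0) :
    secondLevel S Pn s s = 0 := by
  ext ij
  simp [secondLevel]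

theorem bracket_sub (S : ℝ≥0 → Vec d) (Pn : ℕ → InfPartition) (i j : Fin d) (s t : ℝ≥0) :
    bracket S Pn i j t - bracket S Pn i j s = (S t i - S s i) * (S t j - S s j)
      - (secondLevel S Pn s t (i, j) + secondLevel S Pn s t (j, i)) := by
  simp only [bracket, secondLevel, PiLp.sub_apply, tprod_apply]
  ring

theorem bracket_comm (S : ℝ≥0 → Vec d) (Pn : ℕ → InfPartition) (i j : Fin d) (t : ℝ≥0) :
    bracket S Pn i j t = bracket S Pn j i t := by
  simp only [bracket]
  ring

/-- Points `s < t` of `[0, T]` are approximated from within `[s, t]` by points of partitions with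
vanishing mesh. -/
theorem exists_seq_tendsto {P : ℕ → FinPartition T}
    (hP : Tendsto (fun n => (P n).mesh) atTop (𝓝 0)) {s t : ℝ≥0} (hst : s < t) (ht : t ≤ T) :
    ∃ a b : ℕ → ℕ, (∀ᶠ n in atTop, a n ≤ b n ∧ b n ≤ (P n).N ∧ s ≤ (P n).seq (a n) ∧
        (P n).seq (a n) ≤ (P n).seq (b n) ∧ (P n).seq (b n) ≤ t) ∧
      Tendsto (fun n => (P n).seq (a n)) atTop (𝓝 s) ∧
      Tendsto (fun n => (P n).seq (b n)) atTop (𝓝 t) := by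
  choose a ha1 ha2 ha3 using fun n => (P n).exists_seq_ge (hst.le.trans ht)
  choose b hb1 hb2 hb3 using fun n => (P n).exists_seq_le ht
  have hta : Tendsto (fun n => (P n).seq (a n)) atTop (𝓝 s) :=
    tendsto_of_tendsto_of_tendsto_of_le_of_le tendsto_const_nhds
      (by simpa using (tendsto_const_nhds (x := s)).add hP) ha2 ha3
  have htb : Tendsto (fun n => (P n).seq (b n)) atTop (𝓝 t) :=
    tendsto_of_tendsto_of_tendsto_of_le_of_le
      (by simpa using (tendsto_const_nhds (x := t)).sub hP) tendsto_const_nhds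
      (fun n => tsub_le_iff_right.mpr (hb3 n)) hb2
  refine ⟨a, b, ?_, hta, htb⟩
  filter_upwards [hta.eventually_lt htb hst] with n hn
  refine ⟨?_, hb1 n, ha2 n, hn.le, hb2 n⟩
  by_contra! h
  exact absurd ((P n).seq_mono h.le) (not_le.mpr hn)

/-- The sum of the second level over consecutive points of a partition. -/
def blockSum (S : ℝ≥0 → Vec d) (Pn : ℕ → InfPartition) (P : FinPartition T) (i j : ℕ) :
    Tensor d :=
  ∑ k ∈ Finset.Ico i j, secondLevel S Pn (P.seq k) (P.seq (k + 1))

theorem blockSum_eq (S : ℝ≥0 → Vec d) (Pn : ℕ → InfPartition) (P : FinPartition T) {i j : ℕ}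
    (hij : i ≤ j) (hj : j ≤ P.N) :
    blockSum S Pn P i j = (itoIntegral S Pn (P.seq j) - riemannSum S P (P.seq j)) -
      (itoIntegral S Pn (P.seq i) - riemannSum S P (P.seq i)) := by
  rw [blockSum, ← Finset.sum_Ico_sub (fun k =>
    itoIntegral S Pn (P.seq k) - riemannSum S P (P.seq k)) hij]
  refine Finset.sum_congr rfl fun k hk => ?_
  rw [secondLevel, ← riemannSum_seq_succ S P ((Finset.mem_Ico.mp hk).2.trans_le hj)]
  abel

theorem IsPricePath.tendstoUniformlyOn {p : ℝ} (hS : IsPricePath p S Pn) (hT : 0 < T) :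
    TendstoUniformlyOn (fun n t => riemannSum S ((Pn n).restrict T) t) (itoIntegral S Pn) atTop
      (Set.Icc 0 T) := by
  obtain ⟨J, hJ⟩ := (hS.rie T hT).riemann_converges
  refine hJ.congr_right fun t ht => ?_
  have h := hJ.tendsto_at ht
  simp only [riemannSum_restrict S _ ht.2] at h
  exact h.limUnder_eq.symm

theorem IsPricePath.continuous_itoIntegral {p : ℝ} (hS : IsPricePath p S Pn) :
    Continuous (itoIntegral S Pn) := by
  refine continuous_iff_continuousAt.mpr fun t => ?_
  have hT : 0 < t + 1 := by positivity
  have h : ContinuousOn (itoIntegral S Pn) (Set.Icc 0 (t + 1)) :=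
    (hS.tendstoUniformlyOn hT).continuousOn (Eventually.frequently
      (.of_forall fun _ => (continuous_riemannSum hS.continuous _).continuousOn))
  refine h.continuousAt (mem_of_superset (Iio_mem_nhds (lt_add_one t)) fun x hx => ?_)
  exact ⟨zero_le, le_of_lt hx⟩

theorem IsPricePath.continuous_secondLevel {p : ℝ} (hS : IsPricePath p S Pn) :
    Continuous fun x : ℝ≥0 × ℝ≥0 => secondLevel S Pn x.1 x.2 := by
  have h1 := hS.continuous
  have h2 := hS.continuous_itoIntegral
  unfold secondLevel
  fun_prop

theorem IsPricePath.continuous_bracket {p : ℝ} (hS : IsPricePath p S Pn) (i j : Fin d) :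
    Continuous (bracket S Pn i j) := by
  have h1 := hS.continuous
  have h2 := hS.continuous_itoIntegral
  unfold bracket secondLevel
  fun_prop

theorem IsPricePath.tendsto_secondLevel {p : ℝ} (hS : IsPricePath p S Pn) {a b : ℕ → ℝ≥0}
    {s t : ℝ≥0} (ha : Tendsto a atTop (𝓝 s)) (hb : Tendsto b atTop (𝓝 t)) :
    Tendsto (fun n => secondLevel S Pn (a n) (b n)) atTop (𝓝 (secondLevel S Pn s t)) :=
  (hS.continuous_secondLevel.tendsto (s, t)).comp (f := fun n => (a n, b n)) (ha.prodMk_nhds hb)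

theorem IsPricePath.blockSum_small {p : ℝ} (hS : IsPricePath p S Pn) (hT : 0 < T) {ε : ℝ}
    (hε : 0 < ε) : ∀ᶠ n in atTop, ∀ i j, i ≤ j → j ≤ ((Pn n).restrict T).N →
      ‖blockSum S Pn ((Pn n).restrict T) i j‖ ≤ ε := by
  filter_upwards [Metric.tendstoUniformlyOn_iff.mp (hS.tendstoUniformlyOn hT) (ε / 2) (half_pos hε)]
    with n hn i j hij hj
  rw [blockSum_eq S Pn _ hij hj]
  have h := fun k => hn (((Pn n).restrict T).seq k) ⟨zero_le, FinPartition.seq_le _ k⟩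
  simp only [dist_eq_norm] at h
  exact (norm_sub_le _ _).trans (by linarith [h i, h j])

theorem le_of_ofReal_div_le {x : ℝ} {c : ℝ≥0} (h : ENNReal.ofReal x / (c : ℝ≥0∞) ≤ 1) :
    x ≤ c := by
  rcases eq_or_ne c 0 with rfl | hc
  · by_contra! hx
    rw [ENNReal.coe_zero, ENNReal.div_zero (by simpa using hx)] at h
    simp at h
  · rw [ENNReal.div_le_iff (by simpa using hc) ENNReal.coe_ne_top, one_mul] at h
    rw [← ENNReal.ofReal_coe_nnreal] at h
    exact (ENNReal.ofReal_le_ofReal_iff c.2).mp h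

theorem le_rpow_of_rpow_le {x y a : ℝ} (hx : 0 ≤ x) (ha : 0 < a) (h : x ^ a ≤ y) :
    x ≤ y ^ (1 / a) := by
  calc x = (x ^ a) ^ (1 / a) := by
        rw [← Real.rpow_mul hx, mul_one_div_cancel ha.ne', Real.rpow_one]
    _ ≤ _ := by gcongr

/-- The estimates contained in Property (RIE): one control function bounds the increments of the
path, the second level, and the sums of the second level over blocks of the partitions. -/
theorem IsPricePath.exists_control {p : ℝ} (hp : 0 < p) (hS : IsPricePath p S Pn) (hT : 0 < T) :
    ∃ c, IsControl T c ∧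
      (∀ s t, s ≤ t → t ≤ T → ‖S t - S s‖ ≤ (c s t : ℝ) ^ (1 / p)) ∧
      (∀ s t, s ≤ t → t ≤ T → ‖secondLevel S Pn s t‖ ≤ (c s t : ℝ) ^ (2 / p)) ∧
      ∀ n i j, i ≤ j → j ≤ ((Pn n).restrict T).N → ‖blockSum S Pn ((Pn n).restrict T) i j‖ ≤
        2 * (c (((Pn n).restrict T).seq i) (((Pn n).restrict T).seq j) : ℝ) ^ (2 / p) := by
  obtain ⟨c, hc, hsup⟩ := (hS.rie T hT).control
  set P := fun n => (Pn n).restrict T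
  have h1 : ∀ s t, s ≤ t → t ≤ T → ‖S t - S s‖ ≤ (c s t : ℝ) ^ (1 / p) := fun s t hst ht => by
    refine le_rpow_of_rpow_le (norm_nonneg _) hp (le_of_ofReal_div_le ?_)
    refine le_trans ?_ ((self_le_add_right _ _).trans hsup)
    exact le_iSup_of_le s (le_iSup_of_le t (le_iSup_of_le ⟨hst, ht⟩ le_rfl))
  -- the estimate for the second level of the discretised path
  have h2 : ∀ n i j, i ≤ j → j ≤ (P n).N →
      ‖riemannSum S (P n) ((P n).seq j) - riemannSum S (P n) ((P n).seq i) -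
        tprod (S ((P n).seq i)) (S ((P n).seq j) - S ((P n).seq i))‖ ≤
      (c ((P n).seq i) ((P n).seq j) : ℝ) ^ (2 / p) := fun n i j hij hj => by
    rcases hij.eq_or_lt with rfl | hij
    · have : tprod (S ((P n).seq i)) (S ((P n).seq i) - S ((P n).seq i)) = 0 := by ext; simp
      rw [this, sub_self, sub_self, norm_zero]
      positivity
    · rw [show 2 / p = 1 / (p / 2) by field_simp]
      refine le_rpow_of_rpow_le (norm_nonneg _) (by positivity) (le_of_ofReal_div_le ?_)
      refine le_trans ?_ ((self_le_add_left _ _).trans hsup)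
      rw [(P n).seq_eq_pt (hij.le.trans hj), (P n).seq_eq_pt hj]
      exact le_iSup_of_le n (le_iSup_of_le _ (le_iSup_of_le _ (le_iSup_of_le
        (by simpa using hij) le_rfl)))
  have hblock : ∀ n i j, i ≤ j → j ≤ (P n).N →
      secondLevel S Pn ((P n).seq i) ((P n).seq j) = blockSum S Pn (P n) i j +
        (riemannSum S (P n) ((P n).seq j) - riemannSum S (P n) ((P n).seq i) -
        tprod (S ((P n).seq i)) (S ((P n).seq j) - S ((P n).seq i))) := fun n i j hij hj => by
    rw [blockSum_eq S Pn _ hij hj, secondLevel]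
    abel
  have h3 : ∀ s t, s ≤ t → t ≤ T → ‖secondLevel S Pn s t‖ ≤ (c s t : ℝ) ^ (2 / p) := by
    intro s t hst ht
    rcases hst.eq_or_lt with rfl | hst
    · simp only [secondLevel_self, norm_zero]
      positivity
    obtain ⟨a, b, hab, ha, hb⟩ := exists_seq_tendsto (hS.rie T hT).mesh_tendsto hst ht
    refine le_of_forall_pos_le_add fun ε hε => ?_
    have hlim : Tendsto (fun n => ‖secondLevel S Pn ((P n).seq (a n)) ((P n).seq (b n))‖) atTop
        (𝓝 ‖secondLevel S Pn s t‖) := (hS.tendsto_secondLevel ha hb).norm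
    refine le_of_tendsto hlim ?_
    filter_upwards [hab, hS.blockSum_small hT hε] with n ⟨g1, g2, g3, g4, g5⟩ hn
    rw [hblock n _ _ g1 g2, add_comm ((c s t : ℝ) ^ (2 / p))]
    refine (norm_add_le _ _).trans (add_le_add (hn _ _ g1 g2) ((h2 n _ _ g1 g2).trans ?_))
    gcongr
    exact hc.mono g3 g4 g5 ht
  refine ⟨c, hc, h1, h3, fun n i j hij hj => ?_⟩
  have e : blockSum S Pn (P n) i j = secondLevel S Pn ((P n).seq i) ((P n).seq j) -
      (riemannSum S (P n) ((P n).seq j) - riemannSum S (P n) ((P n).seq i) -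
        tprod (S ((P n).seq i)) (S ((P n).seq j) - S ((P n).seq i))) := by
    rw [hblock n i j hij hj]; abel
  change ‖blockSum S Pn (P n) i j‖ ≤ _
  rw [e, two_mul]
  exact (norm_sub_le _ _).trans (add_le_add
    (h3 _ _ ((P n).seq_mono hij) ((P n).seq_le _)) (h2 n i j hij hj))

end SecondLevel

/-! ### Vanishing of weighted sums of the second level -/

section Vanishing

variable {d : ℕ} {S : ℝ≥0 → Vec d} {Pn : ℕ → InfPartition} {T : ℝ≥0} {p q : ℝ}

/-- A continuous two-parameter function on `[0, T]` vanishing on the diagonal is uniformly small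
near the diagonal. -/
theorem exists_modulus {E : Type*} [NormedAddCommGroup E] {g : ℝ≥0 → ℝ≥0 → E}
    (hg : ContinuousOn (fun x : ℝ≥0 × ℝ≥0 => g x.1 x.2) (Set.Icc 0 T ×ˢ Set.Icc 0 T))
    (hdiag : ∀ s, g s s = 0) {η : ℝ} (hη : 0 < η) :
    ∃ δ : ℝ≥0, 0 < δ ∧ ∀ s t, s ≤ t → t ≤ T → t - s < δ → ‖g s t‖ < η := by
  have hu := (isCompact_Icc.prod isCompact_Icc).uniformContinuousOn_of_continuous hg
  obtain ⟨δ, hδ, h⟩ := Metric.uniformContinuousOn_iff.mp hu η hη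
  refine ⟨δ.toNNReal, by simpa using hδ, fun s t hst ht hd => ?_⟩
  have hs : s ∈ Set.Icc 0 T := ⟨zero_le, hst.trans ht⟩
  have ht' : t ∈ Set.Icc 0 T := ⟨zero_le, ht⟩
  have := h (s, t) ⟨hs, ht'⟩ (s, s) ⟨hs, hs⟩ (by
    rw [Prod.dist_eq, dist_self, max_eq_right dist_nonneg, NNReal.dist_eq, ← NNReal.coe_sub hst,
      NNReal.abs_eq]
    have := NNReal.coe_lt_coe.mpr hd
    rwa [Real.coe_toNNReal _ hδ.le] at this)
  simpa [hdiag] using this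

theorem tendsto_of_continuousOn_prod {E : Type*} [TopologicalSpace E] {g : ℝ≥0 → ℝ≥0 → E}
    (hg : ContinuousOn (fun x : ℝ≥0 × ℝ≥0 => g x.1 x.2) (Set.Icc 0 T ×ˢ Set.Icc 0 T))
    {a b : ℕ → ℝ≥0} (ha : ∀ n, a n ≤ T) (hb : ∀ n, b n ≤ T) {s t : ℝ≥0}
    (has : Tendsto a atTop (𝓝 s)) (hbt : Tendsto b atTop (𝓝 t)) :
    Tendsto (fun n => g (a n) (b n)) atTop (𝓝 (g s t)) := by
  have h1 : Tendsto (fun n => (a n, b n)) atTop (𝓝[Set.Icc 0 T ×ˢ Set.Icc 0 T] (s, t)) :=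
    tendsto_nhdsWithin_iff.mpr ⟨has.prodMk_nhds hbt, .of_forall fun n =>
      ⟨⟨zero_le, ha n⟩, ⟨zero_le, hb n⟩⟩⟩
  have h2 := hg (s, t) ⟨⟨zero_le, le_of_tendsto' has ha⟩, ⟨zero_le, le_of_tendsto' hbt hb⟩⟩
  exact h2.tendsto.comp h1

theorem exists_pos_lt_of_continuous {f : ℝ → ℝ} (hf : Continuous f) {ε : ℝ} (hε : f 0 < ε) :
    ∃ η, 0 < η ∧ f η < ε := by
  have h1 : ∀ᶠ η in 𝓝[>] (0 : ℝ), f η < ε :=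
    (hf.continuousAt.eventually (gt_mem_nhds hε)).filter_mono nhdsWithin_le_nhds
  obtain ⟨η, h2, h3⟩ := (h1.and self_mem_nhdsWithin).exists
  exact ⟨η, h3, h2⟩

/-- Along the partitions of Property (RIE), the sums of the second level weighted by a path of
finite `q`-variation, over arbitrary blocks, vanish uniformly. The block sums of the second level
tend to zero uniformly and have bounded `p/2`-variation, hence tend to zero in any slightly weaker
variation, and the discrete sewing lemma applies. -/
theorem IsPricePath.weighted_blockSum_small (hS : IsPricePath p S Pn) (hT : 0 < T) (hp : 0 < p)
    (hq : 0 < q) (hpq : 1 < 2 / p + 1 / q) {L : ℝ≥0 → Vec d →L[ℝ] Vec d} {M : ℝ}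
    (hM : ∀ t ≤ T, ‖L t‖ ≤ M) (hL : VarBound T (1 / q) fun s t => L t - L s) {ε : ℝ}
    (hε : 0 < ε) : ∀ᶠ n in atTop, ∀ i j, i ≤ j → j ≤ ((Pn n).restrict T).N →
      |∑ k ∈ Finset.Ico i j, pair (L (((Pn n).restrict T).seq k))
        (secondLevel S Pn (((Pn n).restrict T).seq k) (((Pn n).restrict T).seq (k + 1)))| ≤ ε := by
  obtain ⟨c, hc, -, -, hcb⟩ := hS.exists_control hp hT
  obtain ⟨ω, hω, hLω⟩ := hL.exists_control (by positivity)
  have hM0 : 0 ≤ M := (norm_nonneg _).trans (hM 0 zero_le)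
  set W : ℝ≥0 → ℝ≥0 → ℝ≥0 := fun s t => ω s t + c s t with hWdef
  have hW : IsControl T W := hω.add hc
  set θ := 2 / p + 1 / q with hθ
  set θ' := (1 + θ) / 2 with hθ'
  have h1θ' : 1 < θ' := by linarith
  have hθ'θ : θ' < θ := by linarith
  obtain ⟨D, hD⟩ : ∃ D : ℝ, D = d * d := ⟨_, rfl⟩
  have hD0 : 0 ≤ D := by rw [hD]; positivity
  have hpD : ∀ (L : Vec d →L[ℝ] Vec d) (Z : Tensor d), |pair L Z| ≤ D * (‖L‖ * ‖Z‖) :=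
    hD ▸ abs_pair_le
  set K : ℝ := 2 / (1 - 2 ^ (1 - θ')) with hK
  have hK0 : 0 ≤ K := div_nonneg zero_le_two (by
    linarith [Real.rpow_lt_one_of_one_lt_of_neg (x := 2) (by norm_num) (by linarith : 1 - θ' < 0)])
  have hκ : 0 < 1 - θ' / θ := by
    rw [sub_pos, div_lt_one (by linarith)]
    exact hθ'θ
  obtain ⟨η, hη, hηε⟩ := exists_pos_lt_of_continuous (f := fun η : ℝ => D * (M * η) +
      K * ((2 * D) ^ (θ' / θ) * (D * (2 * M * η)) ^ (1 - θ' / θ)) * (W 0 T : ℝ) ^ θ')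
    (by
      have := Real.continuous_rpow_const hκ.le
      fun_prop) (ε := ε) (by simpa [Real.zero_rpow hκ.ne'] using hε)
  filter_upwards [hS.blockSum_small hT hη] with n hn i j hij hj
  set P := (Pn n).restrict T
  have hadd : ∀ i j k, i ≤ j → j ≤ k → blockSum S Pn P i k =
      blockSum S Pn P i j + blockSum S Pn P j k := fun i j k h1 h2 =>
    (Finset.sum_Ico_consecutive _ h1 h2).symm
  have key := norm_sub_sum_le_of_defect (Ξ := fun i j => pair (L (P.seq i)) (blockSum S Pn P i j))
    (ω := fun i j => (W (P.seq i) (P.seq j) : ℝ)) (a := 0) (n := P.N) h1θ'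
    (B := (2 * D) ^ (θ' / θ) * (D * (2 * M * η)) ^ (1 - θ' / θ)) (by positivity)
    (fun _ _ => NNReal.coe_nonneg _)
    (fun i j k _ h1 h2 _ => by
      exact_mod_cast hW _ _ _ (P.seq_mono h1) (P.seq_mono h2) (P.seq_le k))
    (fun i j k _ h1 h2 h3 => by
      have e : pair (L (P.seq i)) (blockSum S Pn P i k) - pair (L (P.seq i)) (blockSum S Pn P i j) -
          pair (L (P.seq j)) (blockSum S Pn P j k) =
          pair (L (P.seq i) - L (P.seq j)) (blockSum S Pn P j k) := by
        rw [hadd i j k h1 h2, pair_add_right, pair_sub_left]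
        ring
      simp only [e]
      have hpr := hpD (L (P.seq i) - L (P.seq j)) (blockSum S Pn P j k)
      refine le_interpolate (norm_nonneg _) (by positivity) (NNReal.coe_nonneg _) (by linarith)
        hθ'θ.le (hpr.trans ?_) (hpr.trans ?_)
      · rw [mul_comm 2 D, mul_assoc D]
        refine mul_le_mul_of_nonneg_left ?_ hD0
        have b1 : ‖L (P.seq i) - L (P.seq j)‖ ≤ (W (P.seq i) (P.seq k) : ℝ) ^ (1 / q) := by
          rw [norm_sub_rev]
          refine (hLω _ _ (P.seq_mono h1) (P.seq_le _)).trans ?_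
          gcongr
          exact (hω.mono le_rfl (P.seq_mono h1) (P.seq_mono h2) (P.seq_le _)).trans le_self_add
        have b2 : ‖blockSum S Pn P j k‖ ≤ 2 * (W (P.seq i) (P.seq k) : ℝ) ^ (2 / p) := by
          refine (hcb n j k h2 h3).trans ?_
          gcongr
          exact (hc.mono (P.seq_mono h1) (P.seq_mono h2) le_rfl (P.seq_le _)).trans le_add_self
        refine (mul_le_mul b1 b2 (norm_nonneg _) (by positivity)).trans_eq ?_
        rw [hθ, Real.rpow_add_of_nonneg (NNReal.coe_nonneg _) (by positivity) (by positivity)]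
        ring
      · refine mul_le_mul_of_nonneg_left ?_ hD0
        refine mul_le_mul ?_ (hn j k h2 h3) (norm_nonneg _) (by positivity)
        refine (norm_sub_le _ _).trans ?_
        linarith [hM _ (P.seq_le i), hM _ (P.seq_le j)])
    i j (Nat.zero_le _) hij hj
  have hcons : ∀ k, blockSum S Pn P k (k + 1) = secondLevel S Pn (P.seq k) (P.seq (k + 1)) :=
    fun k => by simp [blockSum]
  simp only [hcons] at key
  rw [← Real.norm_eq_abs]
  have hij0 : (W (P.seq i) (P.seq j) : ℝ) ≤ W 0 T := by
    exact_mod_cast hW.mono zero_le (P.seq_mono hij) (P.seq_le _) le_rfl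
  have hpair : ‖pair (L (P.seq i)) (blockSum S Pn P i j)‖ ≤ D * (M * η) :=
    (hpD _ _).trans (mul_le_mul_of_nonneg_left (mul_le_mul (hM _ (P.seq_le _))
      (hn i j hij hj) (norm_nonneg _) hM0) hD0)
  refine le_trans ?_ hηε.le
  refine (norm_le_norm_add_norm_sub _ _).trans (add_le_add hpair (key.trans ?_))
  gcongr

/-- Weighted sums of the second level over arbitrary partitions with vanishing mesh tend to zero,
provided the weight `L` has finite `q`-variation and `L_s S_{s,t}` has the variation of a remainder;
this is the situation of the difference of two Gubinelli derivatives of one path. The function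
`L_s 𝕊_{s,t}` is almost additive, so that it differs from its sums along the partitions of
Property (RIE), which vanish in the limit, by a superadditive error. -/
theorem IsPricePath.tendsto_sum_pair (hS : IsPricePath p S Pn) (hT : 0 < T) (hp : 0 < p)
    (hq : 0 < q) (hpq : 1 < 2 / p + 1 / q) {L : ℝ≥0 → Vec d →L[ℝ] Vec d}
    (hLc : ContinuousOn L (Set.Icc 0 T)) (hL : VarBound T (1 / q) fun s t => L t - L s)
    (hLS : VarBound T (1 / p + 1 / q) fun s t => L s (S t - S s)) {t : ℝ≥0} (ht : t ≤ T) :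
    Tendsto (fun P : FinPartition t =>
      ∑ k, pair (L (P.left k)) (secondLevel S Pn (P.left k) (P.right k))) (meshToZero t) (𝓝 0) := by
  obtain ⟨M, hM⟩ := isCompact_Icc.exists_bound_of_continuousOn hLc
  have hM : ∀ t ≤ T, ‖L t‖ ≤ M := fun t ht => hM t ⟨zero_le, ht⟩
  obtain ⟨c, hc, hcS, hcA, -⟩ := hS.exists_control hp hT
  obtain ⟨ω, hω, hLω⟩ := hL.exists_control (by positivity)
  obtain ⟨ω', hω', hLω'⟩ := hLS.exists_control (by positivity)
  set W : ℝ≥0 → ℝ≥0 → ℝ≥0 := fun s t => ω s t + ω' s t + c s t with hWdef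
  have hW : IsControl T W := (hω.add hω').add hc
  set θ := 2 / p + 1 / q with hθ
  set θ' := (1 + θ) / 2 with hθ'
  have h1θ' : 1 < θ' := by linarith
  have hθ'θ : θ' < θ := by linarith
  obtain ⟨D, hD⟩ : ∃ D : ℝ, D = d * d := ⟨_, rfl⟩
  have hD0 : 0 ≤ D := by rw [hD]; positivity
  have hpD : ∀ (L : Vec d →L[ℝ] Vec d) (Z : Tensor d), |pair L Z| ≤ D * (‖L‖ * ‖Z‖) :=
    hD ▸ abs_pair_le
  set K : ℝ := 2 / (1 - 2 ^ (1 - θ')) with hK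
  have hK0 : 0 ≤ K := div_nonneg zero_le_two (by
    linarith [Real.rpow_lt_one_of_one_lt_of_neg (x := 2) (by norm_num) (by linarith : 1 - θ' < 0)])
  have hκ : 0 < 1 - θ' / θ := by
    rw [sub_pos, div_lt_one (by linarith)]
    exact hθ'θ
  set Ξ : ℝ≥0 → ℝ≥0 → ℝ := fun s t => pair (L s) (secondLevel S Pn s t) with hΞ
  have hΞc : ContinuousOn (fun x : ℝ≥0 × ℝ≥0 => Ξ x.1 x.2) (Set.Icc 0 T ×ˢ Set.Icc 0 T) :=
    ContinuousOn.pair (hLc.comp continuousOn_fst fun x hx => hx.1)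
      hS.continuous_secondLevel.continuousOn
  have hdefect : ∀ s u t, s ≤ u → u ≤ t → t ≤ T →
      |Ξ s t - Ξ s u - Ξ u t| ≤ (1 + D) * (W s t : ℝ) ^ θ := fun s u t h1 h2 h3 => by
    have e : Ξ s t - Ξ s u - Ξ u t = pair (L s) (tprod (S u - S s) (S t - S u)) -
        pair (L u - L s) (secondLevel S Pn u t) := by
      rw [← secondLevel_chen S Pn s u t, pair_sub_left]
      have : pair (L s) (secondLevel S Pn s t) = pair (L s) (secondLevel S Pn s t -
          secondLevel S Pn s u - secondLevel S Pn u t) + pair (L s) (secondLevel S Pn s u) +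
          pair (L s) (secondLevel S Pn u t) := by
        rw [← pair_add_right, ← pair_add_right]
        congr 1
        abel
      simp only [hΞ, this]
      ring
    have w1 : (ω s u : ℝ) ≤ W s t := by
      exact_mod_cast (hω.mono le_rfl h1 h2 h3).trans
        (le_self_add.trans le_self_add : ω s t ≤ ω s t + ω' s t + c s t)
    have w2 : (ω' s u : ℝ) ≤ W s t := by
      exact_mod_cast (hω'.mono le_rfl h1 h2 h3).trans
        (le_add_self.trans le_self_add : ω' s t ≤ ω s t + ω' s t + c s t)
    have w3 : (c u t : ℝ) ≤ W s t := by
      exact_mod_cast (hc.mono h1 h2 le_rfl h3).trans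
        (le_add_self : c s t ≤ ω s t + ω' s t + c s t)
    have hw0 := NNReal.coe_nonneg (W s t)
    have b1 := (abs_pair_tprod_le (L s) (S u - S s) (S t - S u)).trans
      (mul_le_mul (hLω' s u h1 (h2.trans h3)) (hcS u t h2 h3) (norm_nonneg _) (by positivity))
    have b2 := (hpD (L u - L s) (secondLevel S Pn u t)).trans
      (mul_le_mul_of_nonneg_left (mul_le_mul (hLω s u h1 (h2.trans h3)) (hcA u t h2 h3)
        (norm_nonneg _) (by positivity)) hD0)
    rw [e, add_mul, one_mul]
    refine (abs_sub _ _).trans (add_le_add (b1.trans ?_) (b2.trans ?_))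
    · calc (ω' s u : ℝ) ^ (1 / p + 1 / q) * (c u t : ℝ) ^ (1 / p)
          ≤ (W s t : ℝ) ^ (1 / p + 1 / q) * (W s t : ℝ) ^ (1 / p) := by gcongr
        _ = (W s t : ℝ) ^ θ := by
          rw [← Real.rpow_add_of_nonneg hw0 (by positivity) (by positivity), hθ]
          congr 1
          ring
    · refine mul_le_mul_of_nonneg_left ?_ hD0
      calc (ω s u : ℝ) ^ (1 / q) * (c u t : ℝ) ^ (2 / p)
          ≤ (W s t : ℝ) ^ (1 / q) * (W s t : ℝ) ^ (2 / p) := by gcongr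
        _ = (W s t : ℝ) ^ θ := by
          rw [← Real.rpow_add_of_nonneg hw0 (by positivity) (by positivity), hθ]
          congr 1
          ring
  rw [Metric.tendsto_nhds]
  intro ε hε
  obtain ⟨η, hη, hηε⟩ := exists_pos_lt_of_continuous (f := fun η : ℝ =>
      K * ((1 + D) ^ (θ' / θ) * (3 * η) ^ (1 - θ' / θ)) * (W 0 t : ℝ) ^ θ')
    (by
      have := Real.continuous_rpow_const hκ.le
      fun_prop) (ε := ε) (by simpa [Real.zero_rpow hκ.ne'] using hε)
  set B : ℝ := (1 + D) ^ (θ' / θ) * (3 * η) ^ (1 - θ' / θ) with hB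
  have hB0 : 0 ≤ B := by positivity
  obtain ⟨δ, hδ, hmod⟩ := exists_modulus hΞc (fun s => by simp [hΞ]) hη
  -- the defect of additivity on short intervals carries a small constant and an exponent above one
  have hsmall : ∀ s u t, s ≤ u → u ≤ t → t ≤ T → t - s < δ →
      |Ξ s t - Ξ s u - Ξ u t| ≤ B * (W s t : ℝ) ^ θ' := fun s u t h1 h2 h3 h4 => by
    refine le_interpolate (abs_nonneg _) (by positivity) (NNReal.coe_nonneg _) (by linarith)
      hθ'θ.le (hdefect s u t h1 h2 h3) ?_
    have m1 := hmod s t (h1.trans h2) h3 h4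
    have m2 := hmod s u h1 (h2.trans h3) ((tsub_le_tsub_right h2 s).trans_lt h4)
    have m3 := hmod u t h2 h3 ((tsub_le_tsub_left h1 t).trans_lt h4)
    rw [Real.norm_eq_abs] at m1 m2 m3
    have := abs_sub (Ξ s t - Ξ s u) (Ξ u t)
    have := abs_sub (Ξ s t) (Ξ s u)
    linarith
  have hlocal : ∀ u v, u ≤ v → v ≤ T → v - u < δ → |Ξ u v| ≤ K * B * (W u v : ℝ) ^ θ' := by
    intro u v huv hv hδuv
    rcases huv.eq_or_lt with rfl | huv
    · simp only [hΞ, secondLevel_self, pair_zero_right, abs_zero]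
      positivity
    obtain ⟨a, b, hab, ha, hb⟩ := exists_seq_tendsto (hS.rie T hT).mesh_tendsto huv hv
    refine le_of_forall_pos_le_add fun ε' hε' => ?_
    set P := fun n => (Pn n).restrict T
    have hlim : Tendsto (fun n => |Ξ ((P n).seq (a n)) ((P n).seq (b n))|) atTop
        (𝓝 |Ξ u v|) :=
      (tendsto_of_continuousOn_prod hΞc (fun n => (P n).seq_le _) (fun n => (P n).seq_le _)
        ha hb).abs
    refine le_of_tendsto hlim ?_
    filter_upwards [hab, hS.weighted_blockSum_small hT hp hq hpq hM hL hε']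
      with n ⟨g1, g2, g3, g4, g5⟩ hn
    have key := norm_sub_sum_le_of_defect (Ξ := fun i j => Ξ ((P n).seq i) ((P n).seq j))
      (ω := fun i j => (W ((P n).seq i) ((P n).seq j) : ℝ)) (a := a n) (n := b n) h1θ' hB0
      (fun _ _ => NNReal.coe_nonneg _)
      (fun i j k _ h1 h2 _ => by
        exact_mod_cast hW _ _ _ ((P n).seq_mono h1) ((P n).seq_mono h2) ((P n).seq_le k))
      (fun i j k h0 h1 h2 h3 => hsmall _ _ _ ((P n).seq_mono h1) ((P n).seq_mono h2)
        ((P n).seq_le k) ((tsub_le_tsub (((P n).seq_mono h3).trans g5)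
          (g3.trans ((P n).seq_mono h0))).trans_lt hδuv))
      (a n) (b n) le_rfl g1 le_rfl
    have hsum := hn (a n) (b n) g1 g2
    rw [Real.norm_eq_abs] at key
    have hWle : K * B * (W ((P n).seq (a n)) ((P n).seq (b n)) : ℝ) ^ θ' ≤
        K * B * (W u v : ℝ) ^ θ' := by
      gcongr
      exact hW.mono g3 g4 g5 hv
    have := abs_sub_abs_le_abs_sub (Ξ ((P n).seq (a n)) ((P n).seq (b n)))
      (∑ k ∈ Finset.Ico (a n) (b n), Ξ ((P n).seq k) ((P n).seq (k + 1)))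
    linarith
  filter_upwards [eventually_mesh_lt hδ] with P hP
  rw [dist_zero_right, Real.norm_eq_abs]
  refine lt_of_le_of_lt ?_ hηε
  calc |∑ k, Ξ (P.left k) (P.right k)|
      ≤ ∑ k, K * B * (W (P.left k) (P.right k) : ℝ) ^ θ' :=
        (Finset.abs_sum_le_sum_abs _ _).trans (Finset.sum_le_sum fun k _ =>
          hlocal _ _ (P.left_le_right k) ((P.right_le k).trans ht)
            ((P.right_sub_left_le_mesh k).trans_lt hP))
    _ ≤ K * B * (W 0 t : ℝ) ^ θ' := by
        rw [← Finset.mul_sum]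
        gcongr
        exact (hW.restrict ht).sum_partition_rpow_le h1θ'.le P

/-! ### Monotonicity of the bracket -/

/-- The quadratic form of the bracket is nondecreasing in time: along the partitions of
Property (RIE) its increments are squares up to block sums of the second level. -/
theorem IsPricePath.monotone_bracket (hS : IsPricePath p S Pn) (ξ : Fin d → ℝ) :
    Monotone fun t => ∑ i, ∑ j, ξ i * ξ j * bracket S Pn i j t := by
  intro s t hst
  rcases hst.eq_or_lt with rfl | hst
  · rfl
  have hT : 0 < t := zero_le.trans_lt hst
  set Q : ℝ≥0 → ℝ := fun t => ∑ i, ∑ j, ξ i * ξ j * bracket S Pn i j t with hQ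
  have hQc : Continuous Q := by
    have := hS.continuous_bracket
    fun_prop
  set ℓ : Tensor d → ℝ := fun Z => ∑ i, ∑ j, ξ i * ξ j * (Z (i, j) + Z (j, i)) with hℓ
  have hℓc : Continuous ℓ := by fun_prop
  have hℓ0 : ℓ 0 = 0 := by simp [hℓ]
  have hinc : ∀ u v, Q v - Q u =
      (∑ i, ξ i * (S v i - S u i)) ^ 2 - ℓ (secondLevel S Pn u v) := fun u v => by
    simp only [hQ, hℓ, sq, Finset.sum_mul_sum, ← Finset.sum_sub_distrib, ← mul_sub, bracket_sub]
    exact Finset.sum_congr rfl fun i _ => Finset.sum_congr rfl fun j _ => by ring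
  have hℓadd : ∀ (P : FinPartition t) a b, ℓ (blockSum S Pn P a b) =
      ∑ k ∈ Finset.Ico a b, ℓ (secondLevel S Pn (P.seq k) (P.seq (k + 1))) := fun P a b => by
    simp only [hℓ, blockSum, WithLp.ofLp_sum, Finset.sum_apply, ← Finset.sum_add_distrib,
      Finset.mul_sum]
    rw [Finset.sum_comm]
    rw [Finset.sum_congr rfl fun i _ => Finset.sum_comm]
    rw [Finset.sum_comm]
    rw [Finset.sum_congr rfl fun i _ => Finset.sum_comm]
  set P := fun n => (Pn n).restrict t
  obtain ⟨a, b, hab, ha, hb⟩ := exists_seq_tendsto (hS.rie t hT).mesh_tendsto hst le_rfl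
  have hblock : Tendsto (fun n => blockSum S Pn (P n) (a n) (b n)) atTop (𝓝 0) := by
    rw [Metric.tendsto_nhds]
    intro ε hε
    filter_upwards [hab, hS.blockSum_small hT (half_pos hε)] with n ⟨g1, g2, _⟩ hn
    rw [dist_zero_right]
    linarith [hn _ _ g1 g2]
  have hlim : Tendsto (fun n => Q ((P n).seq (b n)) - Q ((P n).seq (a n)) +
      ℓ (blockSum S Pn (P n) (a n) (b n))) atTop (𝓝 (Q t - Q s + ℓ 0)) :=
    (((hQc.tendsto t).comp hb).sub ((hQc.tendsto s).comp ha)).add ((hℓc.tendsto 0).comp hblock)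
  have := ge_of_tendsto hlim (b := 0) (by
    filter_upwards [hab] with n ⟨g1, _⟩
    rw [← Finset.sum_Ico_sub (fun k => Q ((P n).seq k)) g1, hℓadd, ← Finset.sum_add_distrib]
    refine Finset.sum_nonneg fun k _ => ?_
    rw [hinc]
    linarith [sq_nonneg (∑ i, ξ i * (S ((P n).seq (k + 1)) i - S ((P n).seq k) i))])
  rw [hℓ0] at this
  linarith

end Vanishing

/-! ### Riemann–Stieltjes integrals -/

section RiemannStieltjes

variable {f g A B : ℝ≥0 → ℝ} {t : ℝ≥0} {I J : ℝ}

theorem HasRSIntegral.tendsto (h : HasRSIntegral f A t I) :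
    Tendsto (fun P : FinPartition t => ∑ k, f (P.left k) * (A (P.right k) - A (P.left k)))
      (meshToZero t) (𝓝 I) := by
  rw [Metric.tendsto_nhds]
  intro ε hε
  obtain ⟨δ, hδ, h⟩ := h ε hε
  filter_upwards [eventually_mesh_lt hδ] with P hP
  exact h P hP _ fun k => ⟨le_rfl, P.left_le_right k⟩

theorem HasRSIntegral.unique (h : HasRSIntegral f A t I) (h' : HasRSIntegral f A t J) : I = J :=
  tendsto_nhds_unique h.tendsto h'.tendsto

theorem HasRSIntegral.rsIntegral_eq (h : HasRSIntegral f A t I) : rsIntegral f A t = I := by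
  have hex : RSIntegrable f A t := ⟨I, h⟩
  rw [rsIntegral, dif_pos hex]
  exact hex.choose_spec.unique h

theorem RSIntegrable.hasRSIntegral (h : RSIntegrable f A t) :
    HasRSIntegral f A t (rsIntegral f A t) := by
  obtain ⟨I, hI⟩ := h
  rwa [hI.rsIntegral_eq]

theorem HasRSIntegral.add (h : HasRSIntegral f A t I) (h' : HasRSIntegral g A t J) :
    HasRSIntegral (fun s => f s + g s) A t (I + J) := by
  intro ε hε
  obtain ⟨δ, hδ, h⟩ := h (ε / 2) (half_pos hε)
  obtain ⟨δ', hδ', h'⟩ := h' (ε / 2) (half_pos hε)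
  refine ⟨min δ δ', lt_min hδ hδ', fun P hP ξ hξ => ?_⟩
  have e1 := h P (hP.trans_le (min_le_left _ _)) ξ hξ
  have e2 := h' P (hP.trans_le (min_le_right _ _)) ξ hξ
  simp only [add_mul, Finset.sum_add_distrib]
  rw [add_sub_add_comm]
  exact (abs_add_le _ _).trans_lt (by linarith)

theorem HasRSIntegral.integrator_sub (h : HasRSIntegral f A t I) (h' : HasRSIntegral f B t J) :
    HasRSIntegral f (fun s => A s - B s) t (I - J) := by
  intro ε hε
  obtain ⟨δ, hδ, h⟩ := h (ε / 2) (half_pos hε)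
  obtain ⟨δ', hδ', h'⟩ := h' (ε / 2) (half_pos hε)
  refine ⟨min δ δ', lt_min hδ hδ', fun P hP ξ hξ => ?_⟩
  have e1 := h P (hP.trans_le (min_le_left _ _)) ξ hξ
  have e2 := h' P (hP.trans_le (min_le_right _ _)) ξ hξ
  simp only [sub_sub_sub_comm (A _) (B _), mul_sub (f _) (A _ - A _), Finset.sum_sub_distrib]
  rw [sub_sub_sub_comm]
  exact (abs_sub _ _).trans_lt (by linarith)

theorem HasRSIntegral.integrator_const_mul (h : HasRSIntegral f A t I) (c : ℝ) :
    HasRSIntegral f (fun s => c * A s) t (c * I) := by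
  intro ε hε
  obtain ⟨δ, hδ, h⟩ := h (ε / (|c| + 1)) (by positivity)
  refine ⟨δ, hδ, fun P hP ξ hξ => ?_⟩
  have e := h P hP ξ hξ
  rw [lt_div_iff₀ (by positivity)] at e
  have : ∑ k, f (ξ k) * (c * A (P.right k) - c * A (P.left k)) - c * I =
      c * (∑ k, f (ξ k) * (A (P.right k) - A (P.left k)) - I) := by
    rw [mul_sub, Finset.mul_sum]
    congr 1
    exact Finset.sum_congr rfl fun k _ => by ring
  rw [this, abs_mul]
  nlinarith [abs_nonneg (∑ k, f (ξ k) * (A (P.right k) - A (P.left k)) - I), abs_nonneg c]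

theorem rsIntegral_add (hf : RSIntegrable f A t) (hg : RSIntegrable g A t) :
    rsIntegral (fun s => f s + g s) A t = rsIntegral f A t + rsIntegral g A t :=
  (hf.hasRSIntegral.add hg.hasRSIntegral).rsIntegral_eq

theorem hasRSIntegral_zero (A : ℝ≥0 → ℝ) (t : ℝ≥0) : HasRSIntegral (fun _ => 0) A t 0 :=
  fun ε hε => ⟨1, one_pos, fun P _ ξ _ => by simpa using hε⟩

theorem hasRSIntegral_sum {ι : Type*} (s : Finset ι) {F : ι → ℝ≥0 → ℝ}
    (h : ∀ i ∈ s, RSIntegrable (F i) A t) :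
    HasRSIntegral (fun x => ∑ i ∈ s, F i x) A t (∑ i ∈ s, rsIntegral (F i) A t) := by
  classical
  induction s using Finset.induction_on with
  | empty => simpa using hasRSIntegral_zero A t
  | insert i s hi ih =>
    simp only [Finset.sum_insert hi]
    exact (h i (Finset.mem_insert_self i s)).hasRSIntegral.add
      (ih fun j hj => h j (Finset.mem_insert_of_mem hj))

/-- A continuous function is Riemann–Stieltjes integrable against a continuous nondecreasing
function; the limit is the integral against the Stieltjes measure. -/
theorem rsIntegrable_of_monotone (hf : Continuous f) (hA : Monotone A) (hAc : Continuous A)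
    (t : ℝ≥0) : RSIntegrable f A t := by
  let F : StieltjesFunction ℝ≥0 := ⟨A, hA, fun x => hAc.continuousWithinAt⟩
  have hFA : ∀ x, F x = A x := fun _ => rfl
  have hint : ∀ a b : ℝ≥0, MeasureTheory.IntegrableOn f (Set.Ioc a b) F.measure := fun a b =>
    (hf.continuousOn.integrableOn_compact isCompact_Icc).mono_set Set.Ioc_subset_Icc_self
  refine ⟨∫ x in Set.Ioc 0 t, f x ∂F.measure, fun ε hε => ?_⟩
  have hA0 : 0 ≤ A t - A 0 := sub_nonneg.mpr (hA zero_le)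
  have hη : 0 < ε / (A t - A 0 + 1) := by positivity
  obtain ⟨δ, hδ, hmod⟩ := exists_modulus (T := t) (g := fun s t => f t - f s)
    (Continuous.continuousOn (by fun_prop)) (fun s => sub_self _) hη
  refine ⟨δ, hδ, fun P hP ξ hξ => ?_⟩
  have hsplit : ∀ n,
      ∑ i ∈ Finset.range n, ∫ x in Set.Ioc (P.seq i) (P.seq (i + 1)), f x ∂F.measure =
      ∫ x in Set.Ioc 0 (P.seq n), f x ∂F.measure := fun n => by
    induction n with
    | zero => simp [P.seq_zero]
    | succ n ih =>
      rw [Finset.sum_range_succ, ih, ← MeasureTheory.setIntegral_union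
        (Set.Ioc_disjoint_Ioc_of_le le_rfl) measurableSet_Ioc (hint _ _) (hint _ _),
        Set.Ioc_union_Ioc_eq_Ioc zero_le (P.seq_mono (Nat.le_succ n))]
  have hI : ∫ x in Set.Ioc 0 t, f x ∂F.measure =
      ∑ k, ∫ x in Set.Ioc (P.left k) (P.right k), f x ∂F.measure := by
    rw [P.sum_eq_sum_range (fun a b => ∫ x in Set.Ioc a b, f x ∂F.measure), hsplit, P.seq_last]
  rw [hI, ← Finset.sum_sub_distrib]
  have hreal : ∀ k, F.measure.real (Set.Ioc (P.left k) (P.right k)) =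
      A (P.right k) - A (P.left k) := fun k => by
    rw [MeasureTheory.measureReal_def, F.measure_Ioc, hFA, hFA,
      ENNReal.toReal_ofReal (sub_nonneg.mpr (hA (P.left_le_right k)))]
  have hfin : ∀ k, F.measure (Set.Ioc (P.left k) (P.right k)) < ⊤ := fun k => by
    rw [F.measure_Ioc]; exact ENNReal.ofReal_lt_top
  have hterm : ∀ k, |f (ξ k) * (A (P.right k) - A (P.left k)) -
      ∫ x in Set.Ioc (P.left k) (P.right k), f x ∂F.measure| ≤
      ε / (A t - A 0 + 1) * (A (P.right k) - A (P.left k)) := fun k => by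
    have hc : f (ξ k) * (A (P.right k) - A (P.left k)) =
        ∫ _ in Set.Ioc (P.left k) (P.right k), f (ξ k) ∂F.measure := by
      rw [MeasureTheory.setIntegral_const, hreal, smul_eq_mul, mul_comm]
    have hci : MeasureTheory.IntegrableOn (fun _ : ℝ≥0 => f (ξ k))
        (Set.Ioc (P.left k) (P.right k)) F.measure :=
      MeasureTheory.integrableOn_const (hfin k).ne
    rw [hc, ← MeasureTheory.integral_sub hci (hint _ _), ← hreal k, ← Real.norm_eq_abs]
    refine MeasureTheory.norm_setIntegral_le_of_norm_le_const (hfin k) fun x hx => ?_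
    have hδk := (P.right_sub_left_le_mesh k).trans_lt hP
    have hx1 := hx.1.le
    rcases le_total (ξ k) x with h | h
    · rw [norm_sub_rev]
      exact (hmod _ _ h (hx.2.trans (P.right_le k))
        ((tsub_le_tsub hx.2 (hξ k).1).trans_lt hδk)).le
    · exact (hmod _ _ h ((hξ k).2.trans (P.right_le k))
        ((tsub_le_tsub (hξ k).2 hx1).trans_lt hδk)).le
  calc _ ≤ ∑ k, ε / (A t - A 0 + 1) * (A (P.right k) - A (P.left k)) :=
        (Finset.abs_sum_le_sum_abs _ _).trans (Finset.sum_le_sum fun k _ => hterm k)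
    _ = ε * ((A t - A 0) / (A t - A 0 + 1)) := by
        rw [← Finset.mul_sum, P.sum_sub A]; ring
    _ < ε * 1 := by
        gcongr
        rw [div_lt_one (by positivity)]
        linarith
    _ = ε := mul_one ε

/-- Continuous functions are integrable against the components of the bracket, which by
polarization are differences of nondecreasing functions. -/
theorem IsPricePath.rsIntegrable_bracket {d : ℕ} {p : ℝ} {S : ℝ≥0 → Vec d}
    {Pn : ℕ → InfPartition} (hS : IsPricePath p S Pn) (hf : Continuous f) (i j : Fin d)
    (t : ℝ≥0) : RSIntegrable f (bracket S Pn i j) t := by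
  classical
  set Q : (Fin d → ℝ) → ℝ≥0 → ℝ := fun ξ t => ∑ i, ∑ j, ξ i * ξ j * bracket S Pn i j t with hQ
  have hint : ∀ ξ, RSIntegrable f (Q ξ) t := fun ξ => by
    have := hS.continuous_bracket
    exact rsIntegrable_of_monotone hf (hS.monotone_bracket ξ) (by fun_prop) t
  have hpol : bracket S Pn i j = fun t => 1 / 2 * (Q (Pi.single i 1 + Pi.single j 1) t -
      Q (Pi.single i 1) t - Q (Pi.single j 1) t) := by
    funext t
    simp only [hQ, Pi.add_apply, Pi.single_apply, add_mul, mul_add, Finset.sum_add_distrib,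
      ite_mul, mul_ite, one_mul, mul_one, zero_mul, mul_zero, Finset.sum_ite_eq',
      Finset.mem_univ, if_true]
    rw [bracket_comm S Pn j i]
    ring
  rw [hpol]
  exact ⟨_, (((hint _).hasRSIntegral.integrator_sub (hint _).hasRSIntegral).integrator_sub
    (hint _).hasRSIntegral).integrator_const_mul (1 / 2)⟩

end RiemannStieltjes

/-! ### Locally Hölder continuous functions -/

/-- `f` is `γ`-Hölder continuous near every point of `U`. -/
def LocHolder {X E : Type*} [NormedAddCommGroup X] [NormedAddCommGroup E] (γ : ℝ) (U : Set X)
    (f : X → E) : Prop :=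
  ∀ x ∈ U, ∃ V ∈ 𝓝 x, ∃ C : ℝ, 0 ≤ C ∧ ∀ y ∈ V, ∀ z ∈ V, ‖f y - f z‖ ≤ C * ‖y - z‖ ^ γ

namespace LocHolder

variable {X Y E F G : Type*} [NormedAddCommGroup X] [NormedAddCommGroup Y] [NormedAddCommGroup E]
  [NormedAddCommGroup F] [NormedAddCommGroup G] {γ : ℝ} {U : Set X} {f : X → E} {g : X → F}

theorem continuousAt (hγ : 0 < γ) (h : LocHolder γ U f) {x : X} (hx : x ∈ U) :
    ContinuousAt f x := by
  obtain ⟨V, hV, C, hC, h⟩ := h x hx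
  rw [ContinuousAt, tendsto_iff_norm_sub_tendsto_zero]
  have hlim : Tendsto (fun y => C * ‖y - x‖ ^ γ) (𝓝 x) (𝓝 0) := by
    have : Continuous fun y : X => C * ‖y - x‖ ^ γ :=
      continuous_const.mul ((Real.continuous_rpow_const hγ.le).comp (by fun_prop))
    simpa [Real.zero_rpow hγ.ne'] using this.tendsto x
  refine squeeze_zero' (.of_forall fun _ => norm_nonneg _) ?_ hlim
  filter_upwards [hV] with y hy
  exact h y hy x (mem_of_mem_nhds hV)

theorem of_contDiffAt [NormedSpace ℝ X] [NormedSpace ℝ E] (hγ1 : γ ≤ 1)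
    (h : ∀ x ∈ U, ContDiffAt ℝ 1 f x) : LocHolder γ U f := by
  intro x hx
  obtain ⟨K, V, hV, hK⟩ := (h x hx).exists_lipschitzOnWith
  refine ⟨V ∩ Metric.ball x (1 / 2), inter_mem hV (Metric.ball_mem_nhds x (by norm_num)), K, K.2,
    fun y hy z hz => ?_⟩
  have h1 := hK.dist_le_mul y hy.1 z hz.1
  rw [dist_eq_norm, dist_eq_norm] at h1
  refine h1.trans (mul_le_mul_of_nonneg_left ?_ K.2)
  have h2 : ‖y - z‖ ≤ 1 := by
    rw [← dist_eq_norm]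
    have a1 := Metric.mem_ball.mp hy.2
    have a2 := Metric.mem_ball'.mp hz.2
    linarith [dist_triangle y x z]
  rcases (norm_nonneg (y - z)).eq_or_lt with h0 | h0
  · rw [← h0]; positivity
  · calc ‖y - z‖ = ‖y - z‖ ^ (1 : ℝ) := (Real.rpow_one _).symm
      _ ≤ _ := Real.rpow_le_rpow_of_exponent_ge h0 h2 hγ1

theorem of_le_add (h : LocHolder γ U f) (h' : LocHolder γ U g) {k : X → G}
    (hk : ∀ x ∈ U, ∃ V ∈ 𝓝 x, ∃ C : ℝ, 0 ≤ C ∧ ∀ y ∈ V, ∀ z ∈ V,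
      ‖k y - k z‖ ≤ C * (‖f y - f z‖ + ‖g y - g z‖)) : LocHolder γ U k := by
  intro x hx
  obtain ⟨V, hV, C, hC, h⟩ := h x hx
  obtain ⟨V', hV', C', hC', h'⟩ := h' x hx
  obtain ⟨W, hW, D, hD, hk⟩ := hk x hx
  refine ⟨W ∩ (V ∩ V'), inter_mem hW (inter_mem hV hV'), D * (C + C'), by positivity,
    fun y hy z hz => (hk y hy.1 z hz.1).trans ?_⟩
  rw [mul_assoc, add_mul]
  exact mul_le_mul_of_nonneg_left (add_le_add (h y hy.2.1 z hz.2.1) (h' y hy.2.2 z hz.2.2)) hD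

theorem sub {g : X → E} (h : LocHolder γ U f) (h' : LocHolder γ U g) :
    LocHolder γ U fun x => f x - g x :=
  h.of_le_add h' fun x _ => ⟨Set.univ, univ_mem, 1, zero_le_one, fun y _ z _ => by
    rw [sub_sub_sub_comm, one_mul]
    exact norm_sub_le _ _⟩

theorem clm_bilinear [NormedSpace ℝ E] [NormedSpace ℝ F] [NormedSpace ℝ G] (hγ : 0 < γ)
    (B : E →L[ℝ] F →L[ℝ] G) (h : LocHolder γ U f) (h' : LocHolder γ U g) :
    LocHolder γ U fun x => B (f x) (g x) :=
  h.of_le_add h' fun x hx => by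
    have b1 : ∀ᶠ y in 𝓝 x, ‖f y‖ < ‖f x‖ + 1 :=
      (h.continuousAt hγ hx).norm.eventually (gt_mem_nhds (lt_add_one _))
    have b2 : ∀ᶠ y in 𝓝 x, ‖g y‖ < ‖g x‖ + 1 :=
      (h'.continuousAt hγ hx).norm.eventually (gt_mem_nhds (lt_add_one _))
    refine ⟨_, b1.and b2, ‖B‖ * (‖f x‖ + 1 + (‖g x‖ + 1)), by positivity, fun y hy z hz => ?_⟩
    have e : B (f y) (g y) - B (f z) (g z) = B (f y - f z) (g y) + B (f z) (g y - g z) := by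
      simp
    rw [e]
    have h1 := B.le_opNorm₂ (f y - f z) (g y)
    have h2 := B.le_opNorm₂ (f z) (g y - g z)
    have h3 : ‖B‖ * ‖f y - f z‖ * ‖g y‖ ≤ ‖B‖ * ‖f y - f z‖ * (‖g x‖ + 1) := by
      gcongr
      exact hy.2.le
    have h4 : ‖B‖ * ‖f z‖ * ‖g y - g z‖ ≤ ‖B‖ * (‖f x‖ + 1) * ‖g y - g z‖ := by
      gcongr
      exact hz.1.le
    have h5 : 0 ≤ ‖B‖ * (‖f x‖ + 1) * ‖f y - f z‖ := by positivity
    have h6 : 0 ≤ ‖B‖ * (‖g x‖ + 1) * ‖g y - g z‖ := by positivity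
    refine (norm_add_le _ _).trans ?_
    linarith

theorem smul [NormedSpace ℝ E] (hγ : 0 < γ) {c : X → ℝ} (hc : LocHolder γ U c)
    (h : LocHolder γ U f) : LocHolder γ U fun x => c x • f x :=
  clm_bilinear hγ (ContinuousLinearMap.lsmul ℝ ℝ) hc h

theorem clm_comp [NormedSpace ℝ E] [NormedSpace ℝ F] [NormedSpace ℝ G] (hγ : 0 < γ)
    {a : X → F →L[ℝ] G} {b : X → E →L[ℝ] F} (ha : LocHolder γ U a) (hb : LocHolder γ U b) :
    LocHolder γ U fun x => (a x).comp (b x) :=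
  clm_bilinear (G := E →L[ℝ] G) hγ (ContinuousLinearMap.compL ℝ E F G) ha hb

theorem comp {V : Set Y} {m : Y → X} (hγ : 0 ≤ γ) (h : LocHolder γ U f)
    (hm : LocHolder 1 V m) (hVU : Set.MapsTo m V U) : LocHolder γ V fun y => f (m y) := by
  intro y hy
  obtain ⟨W, hW, C, hC, h⟩ := h (m y) (hVU hy)
  have hc := hm.continuousAt one_pos hy
  obtain ⟨W', hW', C', hC', h'⟩ := hm y hy
  refine ⟨W' ∩ m ⁻¹' W, inter_mem hW' (hc hW), C * C' ^ γ, by positivity, fun a ha b hb =>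
    (h _ ha.2 _ hb.2).trans ?_⟩
  rw [mul_assoc, ← Real.mul_rpow hC' (norm_nonneg _)]
  gcongr
  have := h' a ha.1 b hb.1
  rwa [Real.rpow_one] at this

/-- On a compact set a locally Hölder continuous function is Hölder continuous. -/
theorem exists_bound (hγ : 0 < γ) (h : LocHolder γ U f) {K : Set X} (hK : IsCompact K)
    (hKU : K ⊆ U) : ∃ C : ℝ, 0 ≤ C ∧ ∀ x ∈ K, ∀ y ∈ K, ‖f x - f y‖ ≤ C * ‖x - y‖ ^ γ := by
  have key : ∃ C : ℝ, 0 ≤ C ∧ ∀ z ∈ K ×ˢ K, ‖f z.1 - f z.2‖ ≤ C * ‖z.1 - z.2‖ ^ γ := by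
    refine (hK.prod hK).induction_on
      (p := fun A => ∃ C : ℝ, 0 ≤ C ∧ ∀ z ∈ A, ‖f z.1 - f z.2‖ ≤ C * ‖z.1 - z.2‖ ^ γ)
      ⟨0, le_rfl, by simp⟩ ?_ ?_ ?_
    · rintro A B hAB ⟨C, hC, h⟩
      exact ⟨C, hC, fun z hz => h z (hAB hz)⟩
    · rintro A B ⟨C, hC, h⟩ ⟨C', hC', h'⟩
      refine ⟨max C C', le_max_of_le_left hC, ?_⟩
      rintro z (hz | hz)
      · exact (h z hz).trans (by gcongr; exact le_max_left _ _)
      · exact (h' z hz).trans (by gcongr; exact le_max_right _ _)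
    · rintro ⟨x, y⟩ ⟨hx, hy⟩
      by_cases hxy : x = y
      · subst hxy
        obtain ⟨V, hV, C, hC, h⟩ := h x (hKU hx)
        exact ⟨V ×ˢ V, mem_nhdsWithin_of_mem_nhds (prod_mem_nhds hV hV), C, hC,
          fun z hz => h _ hz.1 _ hz.2⟩
      · -- away from the diagonal the increments of `f` are bounded
        have hpos : 0 < ‖x - y‖ := norm_pos_iff.mpr (sub_ne_zero.mpr hxy)
        have c1 : ∀ᶠ z : X × X in 𝓝 (x, y), ‖x - y‖ / 2 < ‖z.1 - z.2‖ := by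
          have : Continuous fun z : X × X => ‖z.1 - z.2‖ := by fun_prop
          exact this.continuousAt.eventually (lt_mem_nhds (half_lt_self hpos))
        have c2 : ∀ᶠ z : X × X in 𝓝 (x, y), ‖f z.1 - f z.2‖ < ‖f x - f y‖ + 1 := by
          have h1 : ContinuousAt (fun z : X × X => f z.1) (x, y) :=
            (h.continuousAt hγ (hKU hx)).comp (f := Prod.fst) (x := (x, y)) continuousAt_fst
          have h2 : ContinuousAt (fun z : X × X => f z.2) (x, y) :=
            (h.continuousAt hγ (hKU hy)).comp (f := Prod.snd) (x := (x, y)) continuousAt_snd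
          exact (h1.sub h2).norm.eventually (gt_mem_nhds (lt_add_one _))
        refine ⟨_, mem_nhdsWithin_of_mem_nhds (c1.and c2),
          (‖f x - f y‖ + 1) / (‖x - y‖ / 2) ^ γ, by positivity, fun z hz => hz.2.le.trans ?_⟩
        rw [div_mul_eq_mul_div, le_div_iff₀ (by positivity)]
        gcongr
        exact hz.1.le
  obtain ⟨C, hC, h⟩ := key
  exact ⟨C, hC, fun x hx y hy => h (x, y) ⟨hx, hy⟩⟩

end LocHolder

/-! ### Taylor estimates -/

section Taylor

variable {X E : Type*} [NormedAddCommGroup X] [NormedSpace ℝ X] [NormedAddCommGroup E]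
  [NormedSpace ℝ E] {K : Set X} {C γ : ℝ}

theorem norm_taylor_one_le (hK : Convex ℝ K) (hC : 0 ≤ C) (hγ : 0 ≤ γ) {h : X → E}
    {h' : X → X →L[ℝ] E} (hd : ∀ x ∈ K, HasFDerivAt h (h' x) x)
    (hh : ∀ x ∈ K, ∀ y ∈ K, ‖h' x - h' y‖ ≤ C * ‖x - y‖ ^ γ) {x y : X} (hx : x ∈ K)
    (hy : y ∈ K) : ‖h y - h x - h' x (y - x)‖ ≤ C * ‖y - x‖ ^ γ * ‖y - x‖ := by
  have hs := hK.segment_subset hx hy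
  refine Convex.norm_image_sub_le_of_norm_hasFDerivWithin_le' (s := segment ℝ x y)
    (fun z hz => (hd z (hs hz)).hasFDerivWithinAt) (fun z hz => ?_) (convex_segment x y)
    (left_mem_segment ℝ x y) (right_mem_segment ℝ x y)
  refine (hh z (hs hz) x hx).trans ?_
  have := norm_sub_le_of_mem_segment hz
  gcongr

theorem norm_taylor_two_le (hK : Convex ℝ K) (hC : 0 ≤ C) (hγ : 0 ≤ γ) {h : X → E}
    {h' : X → X →L[ℝ] E} {h'' : X → X →L[ℝ] X →L[ℝ] E} (hd : ∀ x ∈ K, HasFDerivAt h (h' x) x)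
    (hd' : ∀ x ∈ K, HasFDerivAt h' (h'' x) x) (hsymm : ∀ x ∈ K, ∀ v w, h'' x v w = h'' x w v)
    (hh : ∀ x ∈ K, ∀ y ∈ K, ‖h'' x - h'' y‖ ≤ C * ‖x - y‖ ^ γ) {x y : X} (hx : x ∈ K)
    (hy : y ∈ K) : ‖h y - h x - h' x (y - x) - (1 / 2 : ℝ) • h'' x (y - x) (y - x)‖ ≤
      C * ‖y - x‖ ^ γ * ‖y - x‖ * ‖y - x‖ := by
  have hs := hK.segment_subset hx hy
  have hd2 : ∀ z ∈ K, HasFDerivAt (fun z => h z - (1 / 2 : ℝ) • h'' x (z - x) (z - x))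
      (h' z - h'' x (z - x)) z := fun z hz => by
    have h1 : HasFDerivAt (fun z : X => z - x) (ContinuousLinearMap.id ℝ X) z :=
      (hasFDerivAt_id z).sub_const x
    have h2 : HasFDerivAt (fun z => h'' x (z - x)) (h'' x) z :=
      (h'' x).hasFDerivAt.comp z h1
    have h3 := (hd z hz).sub ((h2.clm_apply h1).const_smul (1 / 2 : ℝ))
    refine h3.congr_fderiv ?_
    ext v
    simp only [sub_apply, smul_apply,
      add_apply, ContinuousLinearMap.comp_apply, ContinuousLinearMap.id_apply,
      ContinuousLinearMap.flip_apply]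
    rw [hsymm x hx v (z - x), ← two_smul ℝ, smul_smul]
    norm_num
  have := Convex.norm_image_sub_le_of_norm_hasFDerivWithin_le' (s := segment ℝ x y)
    (fun z hz => (hd2 z (hs hz)).hasFDerivWithinAt) (φ := h' x)
    (C := C * ‖y - x‖ ^ γ * ‖y - x‖) (fun z hz => ?_) (convex_segment x y)
    (left_mem_segment ℝ x y) (right_mem_segment ℝ x y)
  · refine le_trans (le_of_eq ?_) this
    congr 1
    simp only [sub_self, map_zero, smul_zero, sub_zero]
    abel
  · have h4 := norm_taylor_one_le hK hC hγ hd' hh hx (hs hz)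
    rw [sub_right_comm]
    refine h4.trans ?_
    have := norm_sub_le_of_mem_segment hz
    gcongr

end Taylor

/-! ### Controlled paths -/

section Controlled

variable {d : ℕ} {p q γ : ℝ} {S F H : ℝ≥0 → Vec d} {F' H' : ℝ≥0 → Vec d →L[ℝ] Vec d} {T : ℝ≥0}

theorem isControlledPath_iff (hp : 0 < p) (hq : 0 < q) : IsControlledPath p q S T F F' ↔
    ContinuousOn F (Set.Icc 0 T) ∧ ContinuousOn F' (Set.Icc 0 T) ∧
      (VarBound T (1 / q) fun s t => F' t - F' s) ∧
      VarBound T (1 / p + 1 / q) fun s t => F t - F s - F' s (S t - S s) := by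
  have hr : 0 < remainderExponent p q := by unfold remainderExponent; positivity
  have hr' : 1 / remainderExponent p q = 1 / p + 1 / q := by
    rw [remainderExponent, one_div, inv_inv]
  constructor
  · rintro ⟨h1, h2, h3, h4⟩
    exact ⟨h1, h2, h3.varBound hq (by simp), hr' ▸ h4.varBound hr (by simp)⟩
  · rintro ⟨h1, h2, h3, h4⟩
    exact ⟨h1, h2, h3.hasFiniteVariation hq, (hr'.symm ▸ h4 : VarBound T
      (1 / remainderExponent p q) _).hasFiniteVariation hr⟩

theorem exists_norm_le_of_continuousOn {E : Type*} [NormedAddCommGroup E] {f : ℝ≥0 → E}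
    (hf : ContinuousOn f (Set.Icc 0 T)) : ∃ M, 0 ≤ M ∧ ∀ t ≤ T, ‖f t‖ ≤ M := by
  obtain ⟨M, hM⟩ := isCompact_Icc.exists_bound_of_continuousOn hf
  exact ⟨M, (norm_nonneg _).trans (hM 0 ⟨le_rfl, zero_le⟩), fun t ht => hM t ⟨zero_le, ht⟩⟩

theorem IsControlledPath.varBound_path (hp : 0 < p) (hq : 0 < q)
    (hS : VarBound T (1 / p) fun s t => S t - S s) (h : IsControlledPath p q S T F F') :
    VarBound T (1 / p) fun s t => F t - F s := by
  obtain ⟨-, h2, -, h4⟩ := (isControlledPath_iff hp hq).mp h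
  obtain ⟨M, hM0, hM⟩ := exists_norm_le_of_continuousOn h2
  have h5 : VarBound T (1 / p) fun s t => F' s (S t - S s) :=
    hS.of_le M hM0 fun s t hst ht =>
      ((F' s).le_opNorm _).trans (by gcongr; exact hM s (hst.trans ht))
  refine h5.of_le_add (by positivity) (h4.exponent_le (by positivity) ?_) fun s t _ _ => ?_
  · have : 0 < 1 / q := by positivity
    linarith
  · refine (norm_add_le _ _).trans_eq' ?_
    congr 1
    abel

/-- Product rule: a continuous bilinear image of two controlled paths is controlled. -/
theorem IsControlledPath.bilinear (hp : 0 < p) (hpq : p ≤ q)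
    (hS : VarBound T (1 / p) fun s t => S t - S s) (B : Vec d →L[ℝ] Vec d →L[ℝ] Vec d)
    (hF : IsControlledPath p q S T F F') (hH : IsControlledPath p q S T H H') :
    IsControlledPath p q S T (fun t => B (F t) (H t))
      (fun t => (B (F t)).comp (H' t) + (B.flip (H t)).comp (F' t)) := by
  have hq : 0 < q := hp.trans_le hpq
  have hqp : 1 / q ≤ 1 / p := one_div_le_one_div_of_le hp hpq
  have hq0 : 0 < 1 / q := by positivity
  have hp0 : 0 < 1 / p := by positivity
  have vF := hF.varBound_path hp hq hS
  have vH := hH.varBound_path hp hq hS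
  obtain ⟨f1, f2, f3, f4⟩ := (isControlledPath_iff hp hq).mp hF
  obtain ⟨h1, h2, h3, h4⟩ := (isControlledPath_iff hp hq).mp hH
  obtain ⟨M1, hM1, bF⟩ := exists_norm_le_of_continuousOn f1
  obtain ⟨M2, hM2, bF'⟩ := exists_norm_le_of_continuousOn f2
  obtain ⟨M3, hM3, bH⟩ := exists_norm_le_of_continuousOn h1
  obtain ⟨M4, hM4, bH'⟩ := exists_norm_le_of_continuousOn h2
  refine (isControlledPath_iff hp hq).mpr ⟨by fun_prop, ?_, ?_, ?_⟩
  · have c1 : ContinuousOn (fun t => B (F t)) (Set.Icc 0 T) := by fun_prop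
    have c2 : ContinuousOn (fun t => B.flip (H t)) (Set.Icc 0 T) := by fun_prop
    exact (c1.clm_comp h2).add (c2.clm_comp f2)
  · have e1 : VarBound T (1 / q) fun s t => (B (F t - F s)).comp (H' t) :=
      (vF.exponent_le hq0.le hqp).of_le (‖B‖ * M4) (by positivity) fun s t hst ht => by
        refine (ContinuousLinearMap.opNorm_comp_le _ _).trans ?_
        calc _ ≤ ‖B‖ * ‖F t - F s‖ * M4 := by
              gcongr
              · exact B.le_opNorm _
              · exact bH' t ht
          _ = _ := by ring
    have e2 : VarBound T (1 / q) fun s t => (B (F s)).comp (H' t - H' s) :=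
      h3.of_le (‖B‖ * M1) (by positivity) fun s t hst ht => by
        refine (ContinuousLinearMap.opNorm_comp_le _ _).trans ?_
        gcongr
        exact (B.le_opNorm _).trans (by gcongr; exact bF s (hst.trans ht))
    have e3 : VarBound T (1 / q) fun s t => (B.flip (H t - H s)).comp (F' t) :=
      (vH.exponent_le hq0.le hqp).of_le (‖B.flip‖ * M2) (by positivity) fun s t hst ht => by
        refine (ContinuousLinearMap.opNorm_comp_le _ _).trans ?_
        calc _ ≤ ‖B.flip‖ * ‖H t - H s‖ * M2 := by
              gcongr
              · exact B.flip.le_opNorm _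
              · exact bF' t ht
          _ = _ := by ring
    have e4 : VarBound T (1 / q) fun s t => (B.flip (H s)).comp (F' t - F' s) :=
      f3.of_le (‖B.flip‖ * M3) (by positivity) fun s t hst ht => by
        refine (ContinuousLinearMap.opNorm_comp_le _ _).trans ?_
        gcongr
        exact (B.flip.le_opNorm _).trans (by gcongr; exact bH s (hst.trans ht))
    have e12 := e1.of_le_add (Λ := fun s t => (B (F t)).comp (H' t) - (B (F s)).comp (H' s))
      hq0.le e2 fun s t _ _ => by
        refine (norm_add_le _ _).trans_eq' (congrArg _ ?_)
        ext1 v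
        simp
    have e34 := e3.of_le_add (Λ := fun s t => (B.flip (H t)).comp (F' t) -
      (B.flip (H s)).comp (F' s)) hq0.le e4 fun s t _ _ => by
        refine (norm_add_le _ _).trans_eq' (congrArg _ ?_)
        ext1 v
        simp
    refine e12.of_le_add hq0.le e34 fun s t _ _ => ?_
    refine (norm_add_le _ _).trans_eq' (congrArg _ ?_)
    abel
  · have e1 : VarBound T (1 / p + 1 / q) fun s t => B (F s) (H t - H s - H' s (S t - S s)) :=
      h4.of_le (‖B‖ * M1) (by positivity) fun s t hst ht =>
        (B.le_opNorm₂ _ _).trans (by gcongr; exact bF s (hst.trans ht))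
    have e2 : VarBound T (1 / p + 1 / q) fun s t => B (F t - F s - F' s (S t - S s)) (H s) :=
      f4.of_le (‖B‖ * M3) (by positivity) fun s t hst ht => by
        refine (B.le_opNorm₂ _ _).trans ?_
        rw [mul_right_comm]
        gcongr
        exact bH s (hst.trans ht)
    have e3 : VarBound T (1 / p + 1 / q) fun s t => B (F t - F s) (H t - H s) :=
      vF.of_le_mul hp0.le hq0.le (vH.exponent_le hq0.le hqp) ‖B‖ (by positivity)
        fun s t _ _ => by
          rw [← mul_assoc]
          exact B.le_opNorm₂ _ _
    have e12 := e1.of_le_add (Λ := fun s t => B (F s) (H t - H s - H' s (S t - S s)) +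
      B (F t - F s - F' s (S t - S s)) (H s)) (by positivity) e2 fun s t _ _ => norm_add_le _ _
    refine e12.of_le_add (by positivity) e3 fun s t _ _ => ?_
    refine (norm_add_le _ _).trans_eq' (congrArg _ ?_)
    simp only [map_sub, sub_apply, add_apply,
      ContinuousLinearMap.comp_apply, ContinuousLinearMap.flip_apply]
    abel

/-- The open positive orthant. -/
def orthant (d : ℕ) : Set (Vec d) := {x | ∀ i, 0 < x i}

/-- On `[0, T]` a continuous path in the open orthant stays in a compact box of the orthant. -/
theorem exists_box (hS : Continuous S) (hpos : ∀ t, S t ∈ orthant d) (T : ℝ≥0) :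
    ∃ K ⊆ orthant d, IsCompact K ∧ Convex ℝ K ∧ ∀ t ≤ T, S t ∈ K := by
  have hne : (Set.Icc 0 T).Nonempty := ⟨0, le_rfl, zero_le⟩
  have hcont : ∀ i, ContinuousOn (fun t => S t i) (Set.Icc 0 T) := fun i =>
    Continuous.continuousOn (by fun_prop)
  choose a _ ha using fun i => isCompact_Icc.exists_isMinOn hne (hcont i)
  choose b _ hb using fun i => isCompact_Icc.exists_isMaxOn hne (hcont i)
  refine ⟨{x | ∀ i, S (a i) i ≤ x i ∧ x i ≤ S (b i) i}, fun x hx i =>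
    (hpos (a i) i).trans_le (hx i).1, ?_, ?_, fun t ht i => ⟨?_, ?_⟩⟩
  · have : {x : Vec d | ∀ i, S (a i) i ≤ x i ∧ x i ≤ S (b i) i} = WithLp.toLp 2 ''
        Set.Icc (fun i => S (a i) i) (fun i => S (b i) i) := by
      ext x
      refine ⟨fun h => ⟨x.ofLp, ⟨fun i => (h i).1, fun i => (h i).2⟩, rfl⟩, ?_⟩
      rintro ⟨y, ⟨h1, h2⟩, rfl⟩ i
      exact ⟨h1 i, h2 i⟩
    rw [this]
    exact isCompact_Icc.image (PiLp.continuous_toLp 2 _)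
  · intro x hx y hy u v hu hv huv i
    simp only [PiLp.add_apply, PiLp.smul_apply, smul_eq_mul]
    have hv' : v = 1 - u := by linarith
    subst hv'
    have := hx i
    have := hy i
    constructor <;> nlinarith
  · exact ha i ⟨zero_le, ht⟩
  · exact hb i ⟨zero_le, ht⟩

/-- A function of class `C^{1,γ}` of the path is controlled, for every `q ≥ p / γ`. -/
theorem isControlledPath_comp (hp : 0 < p) (hγ : 0 < γ) (hq : 0 < q) (hqγ : 1 / q ≤ γ / p)
    (hSc : Continuous S) (hpos : ∀ t, S t ∈ orthant d)
    (hS : VarBound T (1 / p) fun s t => S t - S s) {h : Vec d → Vec d}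
    {h' : Vec d → Vec d →L[ℝ] Vec d} (hd : ∀ x ∈ orthant d, HasFDerivAt h (h' x) x)
    (hh : LocHolder γ (orthant d) h') :
    IsControlledPath p q S T (fun t => h (S t)) (fun t => h' (S t)) := by
  obtain ⟨K, hKO, hK, hKc, hSK⟩ := exists_box hSc hpos T
  obtain ⟨C, hC, hCK⟩ := hh.exists_bound hγ hK hKO
  have hq0 : 0 < 1 / q := by positivity
  refine (isControlledPath_iff hp hq).mpr ⟨?_, ?_, ?_, ?_⟩
  · exact (continuous_iff_continuousAt.mpr fun t => ((hd _ (hpos t)).continuousAt.comp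
      (f := S) hSc.continuousAt)).continuousOn
  · exact (continuous_iff_continuousAt.mpr fun t => ((hh.continuousAt hγ (hpos t)).comp
      (f := S) hSc.continuousAt)).continuousOn
  · have : VarBound T (1 / p * γ) fun s t => h' (S t) - h' (S s) :=
      hS.of_le_rpow hγ.le C hC fun s t hst ht => hCK _ (hSK t ht) _ (hSK s (hst.trans ht))
    refine this.exponent_le hq0.le (hqγ.trans_eq (by ring))
  · have : VarBound T (1 / p * (1 + γ)) fun s t => h (S t) - h (S s) - h' (S s) (S t - S s) :=
      hS.of_le_rpow (by positivity) C hC fun s t hst ht => by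
        refine (norm_taylor_one_le hKc hC hγ.le (fun x hx => hd x (hKO hx)) hCK
          (hSK s (hst.trans ht)) (hSK t ht)).trans_eq ?_
        rw [mul_assoc, Real.rpow_one_add' (norm_nonneg _) (by positivity), mul_comm (‖_‖ ^ γ)]
    refine this.exponent_le (by positivity) ?_
    calc 1 / p + 1 / q ≤ 1 / p + γ / p := by gcongr
      _ = _ := by ring

end Controlled

/-! ### Itô's formula and the rough integral of a gradient -/

section Ito

variable {d : ℕ} {p q γ : ℝ} {S : ℝ≥0 → Vec d} {Pn : ℕ → InfPartition} {T t : ℝ≥0}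
  {Φ : Vec d → ℝ} {Φ' : Vec d → Vec d →L[ℝ] ℝ} {Φ'' : Vec d → Vec d →L[ℝ] Vec d →L[ℝ] ℝ}

/-- The identification of a linear form on `ℝ^d` with the vector of its coefficients. -/
def coeffCLM (d : ℕ) : (Vec d →L[ℝ] ℝ) →L[ℝ] Vec d :=
  LinearMap.toContinuousLinearMap
    { toFun := fun L => WithLp.toLp 2 fun i => L (stdVec i)
      map_add' := fun _ _ => rfl
      map_smul' := fun _ _ => rfl }

@[simp]
theorem coeffCLM_apply (L : Vec d →L[ℝ] ℝ) (i : Fin d) : coeffCLM d L i = L (stdVec i) := rfl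

theorem clm_apply_eq_sum {E : Type*} [NormedAddCommGroup E] [NormedSpace ℝ E]
    (L : Vec d →L[ℝ] E) (v : Vec d) : L v = ∑ i, v i • L (stdVec i) := by
  conv_lhs => rw [← sum_smul_stdVec v]
  simp only [map_sum, map_smul]

theorem clm_apply_apply_eq_sum (A : Vec d →L[ℝ] Vec d →L[ℝ] ℝ) (v w : Vec d) :
    A v w = ∑ i, ∑ j, v i * w j * A (stdVec i) (stdVec j) := by
  rw [clm_apply_eq_sum A v, sum_apply]
  refine Finset.sum_congr rfl fun i _ => ?_
  rw [smul_apply, clm_apply_eq_sum (A (stdVec i)) w, Finset.smul_sum]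
  exact Finset.sum_congr rfl fun j _ => by simp only [smul_eq_mul]; ring

theorem compensatedSum_eq (X : ℝ≥0 → Vec d) (XX : ℝ≥0 → ℝ≥0 → Tensor d) (F : ℝ≥0 → Vec d)
    (F' : ℝ≥0 → Vec d →L[ℝ] Vec d) (P : FinPartition t) : compensatedSum X XX F F' P =
      ∑ k, (∑ i, F (P.left k) i * (X (P.right k) i - X (P.left k) i) +
        pair (F' (P.left k)) (XX (P.left k) (P.right k))) := rfl

/-- Sums of terms of order `2 + γ > p` in the increments of the path vanish with the mesh. -/
theorem IsPricePath.tendsto_sum_of_le_rpow (hS : IsPricePath p S Pn) (hp : 0 < p)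
    (hγ : p < 2 + γ) {ρ : ℝ≥0 → ℝ≥0 → ℝ} {C : ℝ} (hC : 0 ≤ C) (hT : 0 < T) (ht : t ≤ T)
    (hρ : ∀ s u, s ≤ u → u ≤ T → |ρ s u| ≤ C * ‖S u - S s‖ ^ (2 + γ)) :
    Tendsto (fun P : FinPartition t => ∑ k, ρ (P.left k) (P.right k)) (meshToZero t) (𝓝 0) := by
  obtain ⟨c, hc, hcS, -⟩ := hS.exists_control hp hT
  have hSc := hS.continuous
  rw [Metric.tendsto_nhds]
  intro ε hε
  have hκ : 0 < 2 + γ - p := by linarith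
  obtain ⟨η, hη, hηε⟩ := exists_pos_lt_of_continuous
    (f := fun η : ℝ => C * η ^ (2 + γ - p) * (c 0 t : ℝ)) (by
      have := Real.continuous_rpow_const hκ.le
      fun_prop) (ε := ε) (by simpa [Real.zero_rpow hκ.ne'] using hε)
  obtain ⟨δ, hδ, hmod⟩ := exists_modulus (T := T) (g := fun s t => S t - S s)
    (Continuous.continuousOn (by fun_prop)) (fun s => sub_self _) hη
  filter_upwards [eventually_mesh_lt hδ] with P hP
  rw [dist_zero_right, Real.norm_eq_abs]
  refine lt_of_le_of_lt ?_ hηε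
  calc |∑ k, ρ (P.left k) (P.right k)|
      ≤ ∑ k, C * η ^ (2 + γ - p) * (c (P.left k) (P.right k) : ℝ) := by
        refine (Finset.abs_sum_le_sum_abs _ _).trans (Finset.sum_le_sum fun k _ => ?_)
        have h1 := P.left_le_right k
        have h2 := (P.right_le k).trans ht
        have h3 := (hmod _ _ h1 h2 ((P.right_sub_left_le_mesh k).trans_lt hP)).le
        have h4 := hcS _ _ h1 h2
        refine (hρ _ _ h1 h2).trans ?_
        rw [mul_assoc]
        refine mul_le_mul_of_nonneg_left ?_ hC
        calc ‖S (P.right k) - S (P.left k)‖ ^ (2 + γ)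
            = ‖S (P.right k) - S (P.left k)‖ ^ (2 + γ - p) *
                ‖S (P.right k) - S (P.left k)‖ ^ p := by
              rw [← Real.rpow_add_of_nonneg (norm_nonneg _) hκ.le hp.le]
              congr 1
              ring
          _ ≤ η ^ (2 + γ - p) * ((c (P.left k) (P.right k) : ℝ) ^ (1 / p)) ^ p := by gcongr
          _ = _ := by
              rw [← Real.rpow_mul (NNReal.coe_nonneg _), one_div_mul_cancel hp.ne',
                Real.rpow_one]
    _ = C * η ^ (2 + γ - p) * ((∑ k, c (P.left k) (P.right k) : ℝ≥0) : ℝ) := by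
        rw [← Finset.mul_sum]; push_cast; rfl
    _ ≤ _ := by
        gcongr
        exact_mod_cast (hc.restrict ht).sum_partition_le P

/-- Itô's formula: the compensated Riemann sums of the gradient of `Φ` along the path converge, and
the limit is identified by Taylor's formula. The products of increments are the increments of the
bracket plus the symmetric part of the second level. -/
theorem IsPricePath.hasRoughIntegral_gradient (hS : IsPricePath p S Pn) (hp : 0 < p)
    (hγ0 : 0 < γ) (hγ : p < 2 + γ) (hd : ∀ x ∈ orthant d, HasFDerivAt Φ (Φ' x) x)
    (hd' : ∀ x ∈ orthant d, HasFDerivAt Φ' (Φ'' x) x)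
    (hsymm : ∀ x ∈ orthant d, ∀ v w, Φ'' x v w = Φ'' x w v)
    (hh : LocHolder γ (orthant d) Φ'') (t : ℝ≥0) :
    HasRoughIntegral S (secondLevel S Pn) (fun s => coeffCLM d (Φ' (S s)))
      (fun s => (coeffCLM d).comp (Φ'' (S s))) t
      (Φ (S t) - Φ (S 0) - 1 / 2 * ∑ i, ∑ j,
        rsIntegral (fun s => Φ'' (S s) (stdVec i) (stdVec j)) (bracket S Pn i j) t) := by
  have hT : 0 < t + 1 := by positivity
  have htT : t ≤ t + 1 := le_self_add
  have hpos : ∀ t, S t ∈ orthant d := hS.pos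
  have hSc := hS.continuous
  obtain ⟨K, hKO, hK, hKc, hSK⟩ := exists_box hS.continuous hpos (t + 1)
  obtain ⟨C, hC, hCK⟩ := hh.exists_bound hγ0 hK hKO
  set ρ : ℝ≥0 → ℝ≥0 → ℝ := fun s u => Φ (S u) - Φ (S s) - Φ' (S s) (S u - S s) -
    1 / 2 * Φ'' (S s) (S u - S s) (S u - S s) with hρ
  have hρlim := hS.tendsto_sum_of_le_rpow hp hγ (ρ := ρ) hC hT htT fun s u hsu hu => by
    have := norm_taylor_two_le hKc hC hγ0.le (fun x hx => hd x (hKO hx))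
      (fun x hx => hd' x (hKO hx)) (fun x hx => hsymm x (hKO hx)) hCK (hSK s (hsu.trans hu))
      (hSK u hu)
    rw [smul_eq_mul, Real.norm_eq_abs] at this
    refine this.trans_eq ?_
    rw [mul_assoc, mul_assoc, ← sq, add_comm 2 γ,
      Real.rpow_add_of_nonneg (norm_nonneg _) hγ0.le zero_le_two]
    norm_cast
  have hcont : ∀ i j, Continuous fun s => Φ'' (S s) (stdVec i) (stdVec j) := fun i j => by
    have h1 : Continuous fun s => Φ'' (S s) := continuous_iff_continuousAt.mpr fun s =>
      (hh.continuousAt hγ0 (hpos s)).comp (f := S) hS.continuous.continuousAt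
    exact (h1.clm_apply continuous_const).clm_apply continuous_const
  have hrs : Tendsto (fun P : FinPartition t => ∑ i, ∑ j, ∑ k,
      Φ'' (S (P.left k)) (stdVec i) (stdVec j) *
        (bracket S Pn i j (P.right k) - bracket S Pn i j (P.left k))) (meshToZero t)
      (𝓝 (∑ i, ∑ j, rsIntegral (fun s => Φ'' (S s) (stdVec i) (stdVec j))
        (bracket S Pn i j) t)) :=
    tendsto_finsetSum _ fun i _ => tendsto_finsetSum _ fun j _ =>
      (hS.rsIntegrable_bracket (hcont i j) i j t).hasRSIntegral.tendsto
  have hlim := ((tendsto_const_nhds (x := Φ (S t) - Φ (S 0))).sub (hrs.const_mul (1 / 2))).sub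
    hρlim
  rw [sub_zero] at hlim
  refine hlim.congr fun P => ?_
  have hswap : ∑ i, ∑ j, ∑ k, Φ'' (S (P.left k)) (stdVec i) (stdVec j) *
        (bracket S Pn i j (P.right k) - bracket S Pn i j (P.left k)) =
      ∑ k, ∑ i, ∑ j, Φ'' (S (P.left k)) (stdVec i) (stdVec j) *
        (bracket S Pn i j (P.right k) - bracket S Pn i j (P.left k)) := by
    rw [Finset.sum_comm' (s := Finset.univ) (t := fun _ => Finset.univ) (s' := fun _ => Finset.univ)
      (t' := Finset.univ) (by simp)]
    rw [Finset.sum_congr rfl fun i _ => Finset.sum_comm]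
    rw [Finset.sum_comm]
    rw [Finset.sum_congr rfl fun i _ => Finset.sum_comm]
  rw [compensatedSum_eq, hswap, ← P.sum_sub (fun s => Φ (S s)), Finset.mul_sum,
    ← Finset.sum_sub_distrib, ← Finset.sum_sub_distrib]
  refine Finset.sum_congr rfl fun k _ => ?_
  have hs := hsymm _ (hpos (P.left k))
  generalize P.left k = s at hs
  generalize P.right k = u
  have e1 : ∑ i, coeffCLM d (Φ' (S s)) i * (S u i - S s i) = Φ' (S s) (S u - S s) := by
    rw [clm_apply_eq_sum (Φ' (S s))]
    exact Finset.sum_congr rfl fun i _ => by simp [mul_comm]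
  have e2 : Φ'' (S s) (S u - S s) (S u - S s) =
      ∑ i, ∑ j, Φ'' (S s) (stdVec i) (stdVec j) * (bracket S Pn i j u - bracket S Pn i j s) +
      2 * pair ((coeffCLM d).comp (Φ'' (S s))) (secondLevel S Pn s u) := by
    have e3 : pair ((coeffCLM d).comp (Φ'' (S s))) (secondLevel S Pn s u) =
        ∑ i, ∑ j, Φ'' (S s) (stdVec i) (stdVec j) * secondLevel S Pn s u (i, j) := by
      rw [pair, Finset.sum_comm]
      rfl
    have e4 : pair ((coeffCLM d).comp (Φ'' (S s))) (secondLevel S Pn s u) =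
        ∑ i, ∑ j, Φ'' (S s) (stdVec i) (stdVec j) * secondLevel S Pn s u (j, i) :=
      Finset.sum_congr rfl fun i _ => Finset.sum_congr rfl fun j _ => by
        rw [hs (stdVec i) (stdVec j)]
        rfl
    rw [two_mul]
    nth_rewrite 1 [e3]
    rw [e4, clm_apply_apply_eq_sum]
    simp only [← Finset.sum_add_distrib]
    refine Finset.sum_congr rfl fun i _ => Finset.sum_congr rfl fun j _ => ?_
    rw [bracket_sub]
    simp only [PiLp.sub_apply]
    ring
  rw [e1, hρ]
  simp only [e2]
  ring

/-- The rough integral of the gradient of `Φ` has the same value for every Gubinelli derivative and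
every admissible exponent `q`. -/
theorem IsPricePath.hasRoughIntegral_of_controlled (hS : IsPricePath p S Pn)
    (hpq : RegularityParams p q) (hγ0 : 0 < γ) (hγ : p < 2 + γ)
    (hd : ∀ x ∈ orthant d, HasFDerivAt Φ (Φ' x) x)
    (hd' : ∀ x ∈ orthant d, HasFDerivAt Φ' (Φ'' x) x)
    (hsymm : ∀ x ∈ orthant d, ∀ v w, Φ'' x v w = Φ'' x w v)
    (hh : LocHolder γ (orthant d) Φ'') {K' : ℝ≥0 → Vec d →L[ℝ] Vec d} (hT : 0 < T)
    (hK : IsControlledPath p q S T (fun s => coeffCLM d (Φ' (S s))) K') (ht : t ≤ T) :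
    HasRoughIntegral S (secondLevel S Pn) (fun s => coeffCLM d (Φ' (S s))) K' t
      (Φ (S t) - Φ (S 0) - 1 / 2 * ∑ i, ∑ j,
        rsIntegral (fun s => Φ'' (S s) (stdVec i) (stdVec j)) (bracket S Pn i j) t) := by
  have hp : 0 < p := by linarith [hpq.two_lt]
  have hq : 0 < q := hp.trans_le hpq.le
  have hpos : ∀ t, S t ∈ orthant d := hS.pos
  have hSV : VarBound T (1 / p) fun s t => S t - S s := by
    obtain ⟨c, hc, h, -⟩ := hS.exists_control hp hT
    exact ⟨c, 1, hc, zero_le_one, fun s t h1 h2 => by simpa using h s t h1 h2⟩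
  -- an exponent that works for both Gubinelli derivatives
  obtain ⟨Q, hQ, hQq, hQγ, hpQ⟩ : ∃ Q, 0 < Q ∧ 1 / Q ≤ 1 / q ∧ 1 / Q ≤ γ / p ∧
      1 < 2 / p + 1 / Q := by
    have h1 : 1 / (p / γ) = γ / p := one_div_div p γ
    rcases le_total q (p / γ) with h | h
    · refine ⟨p / γ, by positivity, one_div_le_one_div_of_le hq h, h1.le, ?_⟩
      rw [h1, ← add_div, lt_div_iff₀ hp]
      linarith
    · exact ⟨q, hq, le_rfl, (one_div_le_one_div_of_le (by positivity) h).trans h1.le,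
        hpq.one_lt⟩
  have hQ0 : 0 < 1 / Q := by positivity
  have hp0 : 0 < 1 / p := by positivity
  have hΦ : IsControlledPath p Q S T (fun s => coeffCLM d (Φ' (S s)))
      (fun s => (coeffCLM d).comp (Φ'' (S s))) := by
    refine isControlledPath_comp hp hγ0 hQ hQγ hS.continuous hpos hSV
      (h := fun x => coeffCLM d (Φ' x)) (h' := fun x => (coeffCLM d).comp (Φ'' x))
      (fun x hx => (coeffCLM d).hasFDerivAt.comp x (hd' x hx)) ?_
    refine hh.of_le_add hh fun x _ => ⟨Set.univ, univ_mem, ‖coeffCLM d‖, by positivity,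
      fun y _ z _ => ?_⟩
    rw [← ContinuousLinearMap.comp_sub]
    refine (ContinuousLinearMap.opNorm_comp_le _ _).trans ?_
    gcongr
    linarith [norm_nonneg (Φ'' y - Φ'' z)]
  obtain ⟨-, a2, a3, a4⟩ := (isControlledPath_iff hp hq).mp hK
  obtain ⟨-, b2, b3, b4⟩ := (isControlledPath_iff hp hQ).mp hΦ
  have hvan := hS.tendsto_sum_pair hT hp hQ hpQ
    (L := fun s => K' s - (coeffCLM d).comp (Φ'' (S s))) (a2.sub b2)
    ((a3.exponent_le hQ0.le hQq).of_le_add hQ0.le b3 fun s t _ _ => by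
      rw [sub_sub_sub_comm]
      exact norm_sub_le _ _)
    ((b4.of_le_add (by positivity) (a4.exponent_le (by positivity) (by linarith))
      fun s t _ _ => by
        refine (norm_sub_le _ _).trans_eq' (congrArg _ ?_)
        rw [sub_apply]
        abel)) ht
  have hI := hS.hasRoughIntegral_gradient hp hγ0 hγ hd hd' hsymm hh t
  unfold HasRoughIntegral at hI ⊢
  have := hI.add hvan
  rw [add_zero] at this
  refine this.congr fun P => ?_
  rw [compensatedSum_eq, compensatedSum_eq, ← Finset.sum_add_distrib]
  refine Finset.sum_congr rfl fun k _ => ?_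
  rw [pair_sub_left]
  ring

end Ito

/-! ### The generating function on the orthant -/

section Generating

variable {d : ℕ}

/-- The linear form `x ↦ ∑_i x_i`. -/
def total (d : ℕ) : Vec d →L[ℝ] ℝ := ∑ i, EuclideanSpace.proj i

theorem total_apply (x : Vec d) : total d x = ∑ i, x i := by
  simp [total, sum_apply]

@[simp]
theorem total_stdVec (i : Fin d) : total d (stdVec i) = 1 := by
  simp [total_apply, stdVec]

theorem total_pos (hd : 0 < d) {x : Vec d} (hx : x ∈ orthant d) : 0 < total d x := by
  rw [total_apply]
  have : Nonempty (Fin d) := ⟨⟨0, hd⟩⟩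
  exact Finset.sum_pos (fun i _ => hx i) Finset.univ_nonempty

/-- The radial projection of the orthant to the simplex, which maps prices to market weights. -/
def weights (x : Vec d) : Vec d := (total d x)⁻¹ • x

theorem weights_mem (hd : 0 < d) {x : Vec d} (hx : x ∈ orthant d) : weights x ∈ openSimplex d := by
  have h := total_pos hd hx
  refine ⟨?_, fun i => ?_⟩
  · rw [← total_apply, weights, map_smul, smul_eq_mul, inv_mul_cancel₀ h.ne']
  · have := hx i
    simp only [weights, PiLp.smul_apply, smul_eq_mul]
    positivity

theorem marketPortfolio_eq (S : ℝ≥0 → Vec d) (t : ℝ≥0) : marketPortfolio S t = weights (S t) := by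
  ext i
  simp only [marketPortfolio, weights, PiLp.smul_apply, smul_eq_mul, total_apply]
  rw [div_eq_inv_mul]

/-- The derivative of the radial projection. -/
def weightsDeriv (x : Vec d) : Vec d →L[ℝ] Vec d :=
  (total d x)⁻¹ • (ContinuousLinearMap.id ℝ (Vec d) - (total d).smulRight (weights x))

theorem weightsDeriv_apply (x v : Vec d) :
    weightsDeriv x v = (total d x)⁻¹ • (v - total d v • weights x) := rfl

theorem contDiffAt_weights (hd : 0 < d) {x : Vec d} (hx : x ∈ orthant d) {n : WithTop ℕ∞} :
    ContDiffAt ℝ n weights x :=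
  ((total d).contDiff.contDiffAt.inv (total_pos hd hx).ne').smul contDiffAt_id

theorem contDiffAt_weightsDeriv (hd : 0 < d) {x : Vec d} (hx : x ∈ orthant d)
    {n : WithTop ℕ∞} : ContDiffAt ℝ n weightsDeriv x := by
  have h1 : ContDiffAt ℝ n (fun x : Vec d => (total d).smulRight (weights x)) x :=
    (ContinuousLinearMap.smulRightL ℝ (Vec d) (Vec d) (total d)).contDiff.contDiffAt.comp x
      (contDiffAt_weights hd hx)
  exact ((total d).contDiff.contDiffAt.inv (total_pos hd hx).ne').smul (contDiffAt_const.sub h1)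

theorem hasFDerivAt_weights (hd : 0 < d) {x : Vec d} (hx : x ∈ orthant d) :
    HasFDerivAt weights (weightsDeriv x) x := by
  have h0 := (total_pos hd hx).ne'
  have h1 := ((hasFDerivAt_inv h0).comp x (total d).hasFDerivAt).smul (hasFDerivAt_id x)
  refine h1.congr_fderiv ?_
  ext1 v
  simp only [add_apply, smul_apply, ContinuousLinearMap.smulRight_apply,
    ContinuousLinearMap.comp_apply, ContinuousLinearMap.id_apply, weightsDeriv_apply,
    ContinuousLinearMap.toSpanSingleton_apply, Function.comp_apply, id_eq, weights, smul_sub,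
    smul_smul, smul_eq_mul]
  rw [sub_eq_add_neg, ← neg_smul]
  congr 2
  field_simp

variable (G : Vec d → ℝ)

/-- The extension of `G` from the simplex to the orthant which is homogeneous of degree one. -/
def homExt (x : Vec d) : ℝ := total d x * G (weights x)

/-- The derivative of the homogeneous extension of `G`. -/
def homExtDeriv (x : Vec d) : Vec d →L[ℝ] ℝ :=
  fderiv ℝ G (weights x) + (G (weights x) - fderiv ℝ G (weights x) (weights x)) • total d

/-- The second derivative of the homogeneous extension of `G`. The first derivatives of `G` do not
enter. -/
def homExtDeriv2 (x : Vec d) : Vec d →L[ℝ] Vec d →L[ℝ] ℝ :=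
  ((ContinuousLinearMap.compL ℝ (Vec d) (Vec d) ℝ).flip (total d x • weightsDeriv x)).comp
    ((fderiv ℝ (fderiv ℝ G) (weights x)).comp (weightsDeriv x))

/-- The logarithm of the homogeneous extension of `G`. -/
def logExt (x : Vec d) : ℝ := Real.log (homExt G x)

/-- The derivative of `logExt G`. -/
def logExtDeriv (x : Vec d) : Vec d →L[ℝ] ℝ := (homExt G x)⁻¹ • homExtDeriv G x

/-- The second derivative of `logExt G`. -/
def logExtDeriv2 (x : Vec d) : Vec d →L[ℝ] Vec d →L[ℝ] ℝ :=
  (homExt G x)⁻¹ • homExtDeriv2 G x - (logExtDeriv G x).smulRight (logExtDeriv G x)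

theorem homExtDeriv2_apply (x v w : Vec d) : homExtDeriv2 G x v w =
    fderiv ℝ (fderiv ℝ G) (weights x) (weightsDeriv x v) (total d x • weightsDeriv x w) := rfl

theorem logExtDeriv2_apply (x v w : Vec d) : logExtDeriv2 G x v w =
    (homExt G x)⁻¹ * homExtDeriv2 G x v w - logExtDeriv G x v * logExtDeriv G x w := rfl

/-- The regularity of the generating function used below: positivity on the simplex and a locally
`γ`-Hölder continuous second derivative near the simplex. -/
structure IsRegularGenerator (γ : ℝ) : Prop where
  pos : ∀ x ∈ openSimplex d, 0 < G x
  contDiffAt : ∀ x ∈ openSimplex d, ContDiffAt ℝ 2 G x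
  locHolder : LocHolder γ (openSimplex d) (fderiv ℝ (fderiv ℝ G))

variable {G} {γ : ℝ}

theorem homExt_pos (hd : 0 < d) (hG : IsRegularGenerator G γ) {x : Vec d} (hx : x ∈ orthant d) :
    0 < homExt G x :=
  mul_pos (total_pos hd hx) (hG.pos _ (weights_mem hd hx))

theorem hasFDerivAt_homExt (hd : 0 < d) (hG : IsRegularGenerator G γ) {x : Vec d}
    (hx : x ∈ orthant d) : HasFDerivAt (homExt G) (homExtDeriv G x) x := by
  have h0 := (total_pos hd hx).ne'
  have h1 : HasFDerivAt (fun y => G (weights y)) ((fderiv ℝ G (weights x)).comp (weightsDeriv x))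
      x := (((hG.contDiffAt _ (weights_mem hd hx)).differentiableAt (by norm_num)).hasFDerivAt).comp
        x (hasFDerivAt_weights hd hx)
  refine ((total d).hasFDerivAt.mul h1).congr_fderiv ?_
  ext v
  simp only [add_apply, smul_apply, ContinuousLinearMap.comp_apply, weightsDeriv_apply,
    homExtDeriv, map_smul, map_sub, smul_eq_mul]
  field_simp
  ring

theorem hasFDerivAt_homExtDeriv (hd : 0 < d) (hG : IsRegularGenerator G γ) {x : Vec d}
    (hx : x ∈ orthant d) : HasFDerivAt (homExtDeriv G) (homExtDeriv2 G x) x := by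
  have h0 := (total_pos hd hx).ne'
  have hm := hasFDerivAt_weights hd hx
  have hC := hG.contDiffAt _ (weights_mem hd hx)
  have h1 : HasFDerivAt (fun y => G (weights y)) ((fderiv ℝ G (weights x)).comp (weightsDeriv x))
      x := ((hC.differentiableAt (by norm_num)).hasFDerivAt).comp x hm
  have h2 : HasFDerivAt (fun y => fderiv ℝ G (weights y))
      ((fderiv ℝ (fderiv ℝ G) (weights x)).comp (weightsDeriv x)) x :=
    (((hC.fderiv_right (m := 1) (by norm_num)).differentiableAt (by norm_num)).hasFDerivAt).comp
      x hm
  refine (h2.add ((h1.sub (h2.clm_apply hm)).smul_const (total d))).congr_fderiv ?_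
  ext v w
  simp only [add_apply, sub_apply, ContinuousLinearMap.comp_apply, ContinuousLinearMap.flip_apply,
    ContinuousLinearMap.smulRight_apply, smul_apply, homExtDeriv2_apply, smul_eq_mul]
  rw [weightsDeriv_apply x w, smul_smul, mul_inv_cancel₀ h0, one_smul, map_sub, map_smul,
    smul_eq_mul]
  ring

theorem homExtDeriv2_symm (hd : 0 < d) (hG : IsRegularGenerator G γ) {x : Vec d}
    (hx : x ∈ orthant d) (v w : Vec d) : homExtDeriv2 G x v w = homExtDeriv2 G x w v := by
  have hs := (hG.contDiffAt _ (weights_mem hd hx)).isSymmSndFDerivAt (by simp)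
  rw [homExtDeriv2_apply, homExtDeriv2_apply, map_smul, map_smul, hs.eq]

theorem locHolder_homExtDeriv2 (hd : 0 < d) (hγ : 0 < γ) (hγ1 : γ ≤ 1)
    (hG : IsRegularGenerator G γ) : LocHolder γ (orthant d) (homExtDeriv2 G) := by
  have h1 : LocHolder γ (orthant d) fun x => fderiv ℝ (fderiv ℝ G) (weights x) :=
    hG.locHolder.comp hγ.le (.of_contDiffAt le_rfl fun x hx => contDiffAt_weights hd hx)
      fun x hx => weights_mem hd hx
  have h2 : LocHolder γ (orthant d) (weightsDeriv (d := d)) :=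
    .of_contDiffAt hγ1 fun x hx => contDiffAt_weightsDeriv hd hx
  have h3 : LocHolder γ (orthant d) fun x =>
      (ContinuousLinearMap.compL ℝ (Vec d) (Vec d) ℝ).flip (total d x • weightsDeriv x) :=
    .of_contDiffAt hγ1 fun x hx => by
      have : ContDiffAt ℝ 1 (fun y => total d y • weightsDeriv y) x :=
        (total d).contDiff.contDiffAt.smul (contDiffAt_weightsDeriv hd hx)
      exact (ContinuousLinearMap.contDiff (F := (Vec d →L[ℝ] ℝ) →L[ℝ] Vec d →L[ℝ] ℝ)
        (ContinuousLinearMap.compL ℝ (Vec d) (Vec d) ℝ).flip).contDiffAt.comp x this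
  exact h3.clm_comp hγ (h1.clm_comp hγ h2)

theorem hasFDerivAt_logExt (hd : 0 < d) (hG : IsRegularGenerator G γ) {x : Vec d}
    (hx : x ∈ orthant d) : HasFDerivAt (logExt G) (logExtDeriv G x) x :=
  (hasFDerivAt_homExt hd hG hx).log (homExt_pos hd hG hx).ne'

theorem hasFDerivAt_logExtDeriv (hd : 0 < d) (hG : IsRegularGenerator G γ) {x : Vec d}
    (hx : x ∈ orthant d) : HasFDerivAt (logExtDeriv G) (logExtDeriv2 G x) x := by
  have h0 := (homExt_pos hd hG hx).ne'
  have h1 := ((hasFDerivAt_inv h0).comp x (hasFDerivAt_homExt hd hG hx)).smul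
    (hasFDerivAt_homExtDeriv hd hG hx)
  refine h1.congr_fderiv ?_
  ext v w
  simp only [add_apply, smul_apply, ContinuousLinearMap.smulRight_apply,
    ContinuousLinearMap.comp_apply, ContinuousLinearMap.toSpanSingleton_apply, Function.comp_apply,
    logExtDeriv2_apply, logExtDeriv, smul_eq_mul]
  field_simp
  ring

theorem logExtDeriv2_symm (hd : 0 < d) (hG : IsRegularGenerator G γ) {x : Vec d}
    (hx : x ∈ orthant d) (v w : Vec d) : logExtDeriv2 G x v w = logExtDeriv2 G x w v := by
  rw [logExtDeriv2_apply, logExtDeriv2_apply, homExtDeriv2_symm hd hG hx,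
    mul_comm (logExtDeriv G x v)]

theorem locHolder_logExtDeriv2 (hd : 0 < d) (hγ : 0 < γ) (hγ1 : γ ≤ 1)
    (hG : IsRegularGenerator G γ) : LocHolder γ (orthant d) (logExtDeriv2 G) := by
  have hH : ∀ x ∈ orthant d, ContDiffAt ℝ 1 (homExt G) x := fun x hx =>
    (total d).contDiff.contDiffAt.mul (((hG.contDiffAt _ (weights_mem hd hx)).of_le
      (by norm_num)).comp x (contDiffAt_weights hd hx))
  have hH' : ∀ x ∈ orthant d, ContDiffAt ℝ 1 (homExtDeriv G) x := fun x hx => by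
    have hm := contDiffAt_weights hd hx (n := 1)
    have h1 : ContDiffAt ℝ 1 (fun y => fderiv ℝ G (weights y)) x :=
      ((hG.contDiffAt _ (weights_mem hd hx)).fderiv_right (m := 1) (by norm_num)).comp x hm
    have h2 : ContDiffAt ℝ 1 (fun y => G (weights y)) x :=
      ((hG.contDiffAt _ (weights_mem hd hx)).of_le (by norm_num)).comp x hm
    exact h1.add ((h2.sub (h1.clm_apply hm)).smul contDiffAt_const)
  have hi : ∀ x ∈ orthant d, ContDiffAt ℝ 1 (fun x => (homExt G x)⁻¹) x := fun x hx =>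
    (hH x hx).inv (homExt_pos hd hG hx).ne'
  have h1 : LocHolder γ (orthant d) (logExtDeriv G) :=
    .of_contDiffAt hγ1 fun x hx => (hi x hx).smul (hH' x hx)
  have h2 := LocHolder.clm_bilinear (G := Vec d →L[ℝ] Vec d →L[ℝ] ℝ) hγ
    (ContinuousLinearMap.smulRightL ℝ (Vec d) (Vec d →L[ℝ] ℝ)) h1 h1
  have h3 := (LocHolder.of_contDiffAt hγ1 hi).smul hγ (locHolder_homExtDeriv2 hd hγ hγ1 hG)
  exact h3.sub h2

/-- The regularity assumption of class `C^{p + ε}` with `p > 2` yields a locally Hölder continuous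
second derivative with an exponent above `p - 2`. -/
theorem IsGeneratingFunction.exists_regular {p ε : ℝ} (hp2 : 2 < p) (hp3 : p < 3) (hε : 0 < ε)
    (hG : IsGeneratingFunction (p + ε) G) :
    ∃ γ, 0 < γ ∧ γ ≤ 1 ∧ p < 2 + γ ∧ IsRegularGenerator G γ := by
  obtain ⟨hpos, U, hU, hsub, k, γ₀, hγ0, hγ1, hk, hcd, hhol⟩ := hG
  have hγ1' : (γ₀ : ℝ) ≤ 1 := by exact_mod_cast hγ1
  have hγ0' : (0 : ℝ) < γ₀ := by exact_mod_cast hγ0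
  have hk2 : 2 ≤ k := by
    by_contra! h
    have : (k : ℝ) ≤ 1 := by exact_mod_cast Nat.lt_succ_iff.mp h
    linarith
  have hat : ∀ x ∈ openSimplex d, ContDiffAt ℝ k G x := fun x hx =>
    hcd.contDiffAt (hU.mem_nhds (hsub hx))
  have h2 : ∀ x ∈ openSimplex d, ContDiffAt ℝ 2 G x := fun x hx =>
    (hat x hx).of_le (by exact_mod_cast hk2)
  rcases hk2.eq_or_lt with rfl | hk3
  · refine ⟨γ₀, hγ0', hγ1', by push_cast at hk; linarith, hpos, h2, fun x hx => ?_⟩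
    obtain ⟨V, hV, C, hC⟩ := hhol x (hsub hx)
    refine ⟨V, hV, C, C.2, fun y hy z hz => ?_⟩
    have hyz := hC.dist_le hy hz
    rw [dist_eq_norm, dist_eq_norm] at hyz
    have h0 : 0 ≤ (C : ℝ) * ‖y - z‖ ^ (γ₀ : ℝ) := by positivity
    refine ContinuousLinearMap.opNorm_le_bound₂ _ h0 fun v w => ?_
    have e : (fderiv ℝ (fderiv ℝ G) y - fderiv ℝ (fderiv ℝ G) z) v w =
        (iteratedFDeriv ℝ 2 G y - iteratedFDeriv ℝ 2 G z) ![v, w] := by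
      rw [sub_apply (iteratedFDeriv ℝ 2 G y), iteratedFDeriv_two_apply G y,
        iteratedFDeriv_two_apply G z]
      rfl
    rw [e]
    refine (ContinuousMultilinearMap.le_opNorm _ _).trans ?_
    rw [Fin.prod_univ_two, ← mul_assoc]
    simp only [Matrix.cons_val_zero, Matrix.cons_val_one]
    gcongr
  · refine ⟨1, one_pos, le_rfl, by linarith, hpos, h2, .of_contDiffAt le_rfl fun x hx => ?_⟩
    have h3 : ContDiffAt ℝ 3 G x := (hat x hx).of_le (by exact_mod_cast hk3)
    exact (h3.fderiv_right (m := 2) (by norm_num)).fderiv_right (m := 1) (by norm_num)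

/-- The constant function `1` generates the market portfolio. -/
theorem isRegularGenerator_one : IsRegularGenerator (fun _ : Vec d => (1 : ℝ)) 1 where
  pos _ _ := one_pos
  contDiffAt _ _ := contDiffAt_const
  locHolder := .of_contDiffAt le_rfl fun x _ => by
    have : fderiv ℝ (fderiv ℝ fun _ : Vec d => (1 : ℝ)) = fun _ => 0 := by
      funext y
      simp
    rw [this]
    exact contDiffAt_const

end Generating

/-! ### Generated portfolios and their wealth processes -/

section Wealth

variable {d : ℕ} {p q γ : ℝ} {S : ℝ≥0 → Vec d} {Pn : ℕ → InfPartition} {G : Vec d → ℝ} {T : ℝ≥0}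

/-- The componentwise product on `ℝ^d`. -/
def hadamard (d : ℕ) : Vec d →L[ℝ] Vec d →L[ℝ] Vec d :=
  ∑ i, (EuclideanSpace.proj i : Vec d →L[ℝ] ℝ).smulRight
    ((EuclideanSpace.proj i : Vec d →L[ℝ] ℝ).smulRight (stdVec i))

theorem hadamard_apply (a b : Vec d) (j : Fin d) : hadamard d a b j = a j * b j := by
  simp [hadamard, sum_apply, stdVec, Pi.single_apply]

theorem IsPricePath.varBound (hS : IsPricePath p S Pn) (hp : 0 < p) (hT : 0 < T) :
    VarBound T (1 / p) fun s t => S t - S s := by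
  obtain ⟨c, hc, h, -⟩ := hS.exists_control hp hT
  exact ⟨c, 1, hc, zero_le_one, fun s t h1 h2 => by simpa using h s t h1 h2⟩

theorem partialDeriv_log (hG : IsRegularGenerator G γ) {x : Vec d} (hx : x ∈ openSimplex d)
    (i : Fin d) : partialDeriv i (fun x => Real.log (G x)) x =
      fderiv ℝ G x (stdVec i) / G x := by
  have h := (((hG.contDiffAt x hx).differentiableAt (by norm_num)).hasFDerivAt).log
    (hG.pos x hx).ne'
  rw [partialDeriv, h.fderiv, smul_apply, smul_eq_mul, div_eq_inv_mul]

theorem partialDeriv_partialDeriv (hG : IsRegularGenerator G γ) {x : Vec d}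
    (hx : x ∈ openSimplex d) (i j : Fin d) : partialDeriv i (partialDeriv j G) x =
      fderiv ℝ (fderiv ℝ G) x (stdVec i) (stdVec j) := by
  have h := (((hG.contDiffAt x hx).fderiv_right (m := 1) (by norm_num)).differentiableAt
    (by norm_num)).hasFDerivAt
  have h2 := h.clm_apply (hasFDerivAt_const (stdVec j) x)
  change fderiv ℝ (fun y => fderiv ℝ G y (stdVec j)) x (stdVec i) = _
  rw [h2.fderiv]
  simp

theorem generatedPortfolio_sum {μ : ℝ≥0 → Vec d} {t : ℝ≥0} (h : ∑ i, μ t i = 1) :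
    ∑ i, generatedPortfolio G μ t i = 1 := by
  simp only [generatedPortfolio, mul_sub, mul_add, Finset.sum_sub_distrib, Finset.sum_add_distrib,
    mul_one, ← Finset.sum_mul, h, one_mul]
  ring

/-- The quotient of the generated portfolio by the prices is the gradient of the logarithm of the
homogeneous extension of the generating function. -/
theorem quotientPath_generatedPortfolio (hd : 0 < d) (hpos : ∀ t, S t ∈ orthant d)
    (hG : IsRegularGenerator G γ) :
    quotientPath (generatedPortfolio G (marketPortfolio S)) S =
      fun t => coeffCLM d (logExtDeriv G (S t)) := by
  funext t
  ext i
  have hm := weights_mem hd (hpos t)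
  have hσ := (total_pos hd (hpos t)).ne'
  have hGp := (hG.pos _ hm).ne'
  have hSi := (hpos t i).ne'
  have hμi : weights (S t) i = (total d (S t))⁻¹ * S t i := rfl
  have hsum : ∑ k, weights (S t) k * (fderiv ℝ G (weights (S t)) (stdVec k) / G (weights (S t))) =
      fderiv ℝ G (weights (S t)) (weights (S t)) / G (weights (S t)) := by
    conv_rhs => rw [clm_apply_eq_sum (fderiv ℝ G (weights (S t))) (weights (S t))]
    rw [Finset.sum_div]
    exact Finset.sum_congr rfl fun k _ => by rw [smul_eq_mul, mul_div_assoc]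
  simp only [quotientPath, generatedPortfolio, marketPortfolio_eq, partialDeriv_log hG hm, hsum,
    coeffCLM_apply, logExtDeriv, homExt, homExtDeriv, smul_apply, add_apply, smul_eq_mul,
    total_stdVec, hμi]
  field_simp
  ring

theorem generatedPortfolio_eq_hadamard (hd : 0 < d) (hpos : ∀ t, S t ∈ orthant d)
    (hG : IsRegularGenerator G γ) : generatedPortfolio G (marketPortfolio S) =
      fun t => hadamard d (coeffCLM d (logExtDeriv G (S t))) (S t) := by
  funext t
  ext i
  rw [← congrFun (quotientPath_generatedPortfolio hd hpos hG) t, hadamard_apply]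
  exact (div_mul_cancel₀ _ (hpos t i).ne').symm

/-- The gradient of the logarithm of the homogeneous extension along the prices is controlled, for
every exponent `q ≥ p / γ`. -/
theorem IsPricePath.isControlledPath_gradient (hd : 0 < d) (hS : IsPricePath p S Pn) (hp : 0 < p)
    (hγ : 0 < γ) (hγ1 : γ ≤ 1) (hq : 0 < q) (hqγ : 1 / q ≤ γ / p) (hG : IsRegularGenerator G γ)
    (hT : 0 < T) : IsControlledPath p q S T (fun t => coeffCLM d (logExtDeriv G (S t)))
      (fun t => (coeffCLM d).comp (logExtDeriv2 G (S t))) :=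
  isControlledPath_comp hp hγ hq hqγ hS.continuous hS.pos (hS.varBound hp hT)
    (h := fun x => coeffCLM d (logExtDeriv G x))
    (fun x hx => (coeffCLM d).hasFDerivAt.comp x (hasFDerivAt_logExtDeriv hd hG hx))
    (LocHolder.clm_comp hγ (.of_contDiffAt hγ1 fun _ _ => contDiffAt_const)
      (locHolder_logExtDeriv2 hd hγ hγ1 hG))

theorem IsPricePath.isPortfolio_generated (hd : 0 < d) (hS : IsPricePath p S Pn)
    (hp2 : 2 < p) (hp3 : p < 3) (hγ : 0 < γ) (hγ1 : γ ≤ 1) (hpγ : p < 2 + γ)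
    (hG : IsRegularGenerator G γ) : RegularityParams p (p / γ) ∧
      IsPortfolio p (p / γ) S (generatedPortfolio G (marketPortfolio S)) := by
  have hp : 0 < p := by linarith
  have hpq : p ≤ p / γ := le_div_self hp.le hγ hγ1
  have hq : 0 < p / γ := by positivity
  refine ⟨⟨hp2, hp3, hpq, ?_⟩, fun T hT => ?_, fun t => generatedPortfolio_sum ?_⟩
  · rw [one_div_div, ← add_div, lt_div_iff₀ hp]
    linarith
  · have h1 := hS.isControlledPath_gradient hd hp hγ hγ1 hq (one_div_div p γ).le hG hT
    have h2 : IsControlledPath p (p / γ) S T S fun _ => ContinuousLinearMap.id ℝ (Vec d) :=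
      isControlledPath_comp hp hγ hq (one_div_div p γ).le hS.continuous hS.pos
        (hS.varBound hp hT) (h := fun x => x) (h' := fun _ => ContinuousLinearMap.id ℝ (Vec d))
        (fun x _ => hasFDerivAt_id x) (.of_contDiffAt hγ1 fun _ _ => contDiffAt_const)
    rw [generatedPortfolio_eq_hadamard hd hS.pos hG]
    exact ⟨_, h1.bilinear hp hpq (hS.varBound hp hT) (hadamard d) h2⟩
  · rw [marketPortfolio_eq]
    exact (weights_mem hd (hS.pos t)).1

/-- The quotient of a controlled path by the prices is controlled with the same exponents. -/
theorem IsPricePath.isControlledPath_quotientPath (hS : IsPricePath p S Pn)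
    (hpq : RegularityParams p q) {F : ℝ≥0 → Vec d} {F' : ℝ≥0 → Vec d →L[ℝ] Vec d} (hT : 0 < T)
    (hF : IsControlledPath p q S T F F') :
    ∃ K' : ℝ≥0 → Vec d →L[ℝ] Vec d, IsControlledPath p q S T (quotientPath F S) K' := by
  have hp : 0 < p := by linarith [hpq.two_lt]
  have hq : 0 < q := hp.trans_le hpq.le
  set h : Vec d → Vec d := fun x => WithLp.toLp 2 fun i => (x i)⁻¹ with hh
  have hcd : ∀ x ∈ orthant d, ContDiffAt ℝ 2 h x := fun x hx => by
    refine contDiffAt_euclidean.mpr fun i => ?_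
    exact ((EuclideanSpace.proj i : Vec d →L[ℝ] ℝ).contDiff.contDiffAt).inv (hx i).ne'
  have h1 : IsControlledPath p q S T (fun t => h (S t)) fun t => fderiv ℝ h (S t) :=
    isControlledPath_comp hp one_pos hq (one_div_le_one_div_of_le hp hpq.le) hS.continuous hS.pos
      (hS.varBound hp hT) (fun x hx => ((hcd x hx).differentiableAt (by norm_num)).hasFDerivAt)
      (.of_contDiffAt le_rfl fun x hx => (hcd x hx).fderiv_right (m := 1) (by norm_num))
  have h2 := hF.bilinear hp hpq.le (hS.varBound hp hT) (hadamard d) h1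
  have e : quotientPath F S = fun t => hadamard d (F t) (h (S t)) := by
    funext t
    ext i
    rw [hadamard_apply]
    exact div_eq_mul_inv _ _
  rw [e]
  exact ⟨_, h2⟩

theorem IsPricePath.continuous_weights (hd : 0 < d) (hS : IsPricePath p S Pn) :
    Continuous fun t => weights (S t) :=
  continuous_iff_continuousAt.mpr fun t =>
    (contDiffAt_weights hd (hS.pos t) (n := 1)).continuousAt.comp (f := S)
      hS.continuous.continuousAt

theorem IsPricePath.tauIntegrable (hd : 0 < d) (hS : IsPricePath p S Pn) (hγ : 0 < γ)
    (hG : IsRegularGenerator G γ) (i j : Fin d) (t : ℝ≥0) :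
    TauIntegrable S Pn (marketPortfolio S) (masterIntegrand G (marketPortfolio S) i j) i j t := by
  intro k l
  refine hS.rsIntegrable_bracket ?_ k l t
  have hm := fun t => weights_mem hd (hS.pos t)
  have hSc := hS.continuous
  have hμ := hS.continuous_weights hd
  have hGc : Continuous fun s => G (weights (S s)) := continuous_iff_continuousAt.mpr fun s =>
    (hG.contDiffAt _ (hm s)).continuousAt.comp (f := fun s => weights (S s)) hμ.continuousAt
  have hD : Continuous fun s => fderiv ℝ (fderiv ℝ G) (weights (S s)) :=
    continuous_iff_continuousAt.mpr fun s =>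
      (hG.locHolder.continuousAt hγ (hm s)).comp (f := fun s => weights (S s)) hμ.continuousAt
  have hD' : Continuous fun s => fderiv ℝ (fderiv ℝ G) (weights (S s)) (stdVec i) (stdVec j) :=
    (hD.clm_apply continuous_const).clm_apply continuous_const
  have e : tauDensity S (marketPortfolio S) (masterIntegrand G (marketPortfolio S) i j) i j k l =
      fun s => 1 / G (weights (S s)) * fderiv ℝ (fderiv ℝ G) (weights (S s)) (stdVec i) (stdVec j) *
        weights (S s) i * weights (S s) j * ((weights (S s) - stdVec i) k *
          (1 / (S s k * S s l)) * (weights (S s) - stdVec j) l) := by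
    funext s
    rw [tauDensity, masterIntegrand, marketPortfolio_eq, partialDeriv_partialDeriv hG (hm s)]
  rw [e]
  have h1 : ∀ s, G (weights (S s)) ≠ 0 := fun s => (hG.pos _ (hm s)).ne'
  have h2 : ∀ s, S s k * S s l ≠ 0 := fun s => (mul_pos (hS.pos s k) (hS.pos s l)).ne'
  have c0 : ∀ v : ℝ≥0 → Vec d, Continuous v → ∀ m, Continuous fun s => v s m :=
    fun v hv m => by fun_prop
  have c1 := c0 _ hμ
  have c2 := fun i => c0 _ (hμ.sub (continuous_const (y := stdVec i)))
  have c3 : Continuous fun s => S s k * S s l := by fun_prop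
  exact ((((continuous_const.div hGc h1).mul hD').mul (c1 i)).mul (c1 j)).mul
    (((c2 i k).mul (continuous_const.div c3 h2)).mul (c2 j l))

/-- The integrands against the bracket in the wealth process and in Itô's formula add up to the
integrand of the master formula: this is the computation of the second derivative of the
homogeneous extension of the generating function. -/
theorem integrand_identity (hd : 0 < d) (hpos : ∀ t, S t ∈ orthant d)
    (hG : IsRegularGenerator G γ) (k l : Fin d) (s : ℝ≥0) :
    logExtDeriv2 G (S s) (stdVec k) (stdVec l) +
      generatedPortfolio G (marketPortfolio S) s k * generatedPortfolio G (marketPortfolio S) s l /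
        (S s k * S s l) =
    ∑ i, ∑ j, tauDensity S (marketPortfolio S) (masterIntegrand G (marketPortfolio S) i j)
      i j k l s := by
  have hq : ∀ i, generatedPortfolio G (marketPortfolio S) s i / S s i =
      logExtDeriv G (S s) (stdVec i) := fun i =>
    congrArg (fun v : Vec d => v i) (congrFun (quotientPath_generatedPortfolio hd hpos hG) s)
  have hm := weights_mem hd (hpos s)
  have hσ := (total_pos hd (hpos s)).ne'
  have hGp := (hG.pos _ hm).ne'
  have hk := (hpos s k).ne'
  have hl := (hpos s l).ne'
  have hμ : ∀ i, S s i = total d (S s) * weights (S s) i := fun i => by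
    simp [weights, mul_inv_cancel_left₀ hσ]
  rw [mul_div_mul_comm, hq, hq, logExtDeriv2_apply, sub_add_cancel, homExtDeriv2_apply,
    clm_apply_apply_eq_sum, Finset.mul_sum]
  refine Finset.sum_congr rfl fun i _ => ?_
  rw [Finset.mul_sum]
  refine Finset.sum_congr rfl fun j _ => ?_
  rw [tauDensity, masterIntegrand, partialDeriv_partialDeriv hG (by rwa [marketPortfolio_eq]),
    marketPortfolio_eq]
  simp only [weightsDeriv_apply, total_stdVec, one_smul, PiLp.smul_apply, PiLp.sub_apply,
    smul_eq_mul, homExt]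
  have hwk : weights (S s) k ≠ 0 := (hm.2 k).ne'
  have hwl : weights (S s) l ≠ 0 := (hm.2 l).ne'
  -- the two sides agree for `i = k`, and otherwise `(e_i)_k = (e_k)_i = 0`
  have hik : ∀ i k : Fin d, weights (S s) i * (weights (S s) k - stdVec i k) =
      weights (S s) k * (weights (S s) i - stdVec k i) := fun i k => by
    rcases eq_or_ne i k with rfl | h
    · rfl
    · simp [stdVec, h, h.symm, mul_comm]
  have e : ∀ A B : ℝ, 1 / G (weights (S s)) * A * weights (S s) i * weights (S s) j *
      ((weights (S s) k - stdVec i k) * B * (weights (S s) l - stdVec j l)) =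
      1 / G (weights (S s)) * A * B * (weights (S s) i * (weights (S s) k - stdVec i k)) *
        (weights (S s) j * (weights (S s) l - stdVec j l)) := fun A B => by ring
  rw [e, hik i k, hik j l, hμ k, hμ l]
  field_simp
  ring

/-- The logarithm of the wealth process of the portfolio generated by `G`. -/
def logWealth (S : ℝ≥0 → Vec d) (Pn : ℕ → InfPartition) (G : Vec d → ℝ) (t : ℝ≥0) : ℝ :=
  logExt G (S t) - logExt G (S 0) - 1 / 2 * ∑ i, ∑ j, tauIntegral S Pn (marketPortfolio S)
    (masterIntegrand G (marketPortfolio S) i j) i j t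

/-- The wealth process of the portfolio generated by `G` is `exp (logWealth S Pn G)`, for every
exponent for which the quotient of the portfolio by the prices is controlled. -/
theorem IsPricePath.isWealthProcess_iff (hd : 0 < d) (hS : IsPricePath p S Pn)
    (hpq : RegularityParams p q) (hγ : 0 < γ) (hγ1 : γ ≤ 1) (hpγ : p < 2 + γ)
    (hG : IsRegularGenerator G γ)
    (hK : ∀ T : ℝ≥0, 0 < T → ∃ K' : ℝ≥0 → Vec d →L[ℝ] Vec d, IsControlledPath p q S T
      (quotientPath (generatedPortfolio G (marketPortfolio S)) S) K') (W : ℝ≥0 → ℝ) :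
    IsWealthProcess p q S Pn (generatedPortfolio G (marketPortfolio S)) W ↔
      ∀ t, W t = Real.exp (logWealth S Pn G t) := by
  set π := generatedPortfolio G (marketPortfolio S) with hπ
  have hquot := quotientPath_generatedPortfolio hd hS.pos hG
  have hcont' : Continuous fun s => logExtDeriv G (S s) := continuous_iff_continuousAt.mpr
    fun s => (hasFDerivAt_logExtDeriv hd hG (hS.pos s)).continuousAt.comp (f := S)
      hS.continuous.continuousAt
  have hcont'' : Continuous fun s => logExtDeriv2 G (S s) := continuous_iff_continuousAt.mpr
    fun s => ((locHolder_logExtDeriv2 hd hγ hγ1 hG).continuousAt hγ (hS.pos s)).comp (f := S)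
      hS.continuous.continuousAt
  have hint1 : ∀ t i j, RSIntegrable (fun s => π s i * π s j / (S s i * S s j))
      (bracket S Pn i j) t := fun t i j => by
    refine hS.rsIntegrable_bracket ?_ i j t
    have e : (fun s => π s i * π s j / (S s i * S s j)) =
        fun s => logExtDeriv G (S s) (stdVec i) * logExtDeriv G (S s) (stdVec j) := by
      funext s
      have h := fun i => congrArg (fun v : Vec d => v i) (congrFun hquot s)
      rw [mul_div_mul_comm]
      exact congrArg₂ _ (h i) (h j)
    rw [e]
    exact (hcont'.clm_apply continuous_const).mul (hcont'.clm_apply continuous_const)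
  have hint2 : ∀ t i j, RSIntegrable (fun s => logExtDeriv2 G (S s) (stdVec i) (stdVec j))
      (bracket S Pn i j) t := fun t i j => hS.rsIntegrable_bracket
    ((hcont''.clm_apply continuous_const).clm_apply continuous_const) i j t
  have hval : ∀ t, logExt G (S t) - logExt G (S 0) - 1 / 2 * ∑ i, ∑ j,
        rsIntegral (fun s => logExtDeriv2 G (S s) (stdVec i) (stdVec j)) (bracket S Pn i j) t -
      1 / 2 * ∑ i, ∑ j, rsIntegral (fun s => π s i * π s j / (S s i * S s j))
        (bracket S Pn i j) t = logWealth S Pn G t := fun t => by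
    have hkl : ∀ k l, rsIntegral (fun s => logExtDeriv2 G (S s) (stdVec k) (stdVec l))
          (bracket S Pn k l) t +
        rsIntegral (fun s => π s k * π s l / (S s k * S s l)) (bracket S Pn k l) t =
        ∑ i, ∑ j, rsIntegral (tauDensity S (marketPortfolio S)
          (masterIntegrand G (marketPortfolio S) i j) i j k l) (bracket S Pn k l) t :=
      fun k l => by
        rw [← rsIntegral_add (hint2 t k l) (hint1 t k l)]
        simp only [hπ, integrand_identity hd hS.pos hG]
        have h1 := fun i => hasRSIntegral_sum Finset.univ fun j (_ : j ∈ Finset.univ) =>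
          hS.tauIntegrable hd hγ hG i j t k l
        rw [(hasRSIntegral_sum Finset.univ fun i _ => ⟨_, h1 i⟩).rsIntegral_eq]
        exact Finset.sum_congr rfl fun i _ => (h1 i).rsIntegral_eq
    have hsum : ∑ i, ∑ j, tauIntegral S Pn (marketPortfolio S)
          (masterIntegrand G (marketPortfolio S) i j) i j t =
        ∑ k, ∑ l, ∑ i, ∑ j, rsIntegral (tauDensity S (marketPortfolio S)
          (masterIntegrand G (marketPortfolio S) i j) i j k l) (bracket S Pn k l) t := by
      simp only [tauIntegral]
      rw [Finset.sum_congr rfl fun i _ => Finset.sum_comm, Finset.sum_comm]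
      refine Finset.sum_congr rfl fun k _ => ?_
      rw [Finset.sum_congr rfl fun i _ => Finset.sum_comm]
      exact Finset.sum_comm
    rw [logWealth, hsum]
    simp only [← hkl, Finset.sum_add_distrib]
    ring
  have hrough : ∀ T : ℝ≥0, 0 < T → ∀ K', IsControlledPath p q S T (quotientPath π S) K' →
      ∀ t ≤ T, HasRoughIntegral S (secondLevel S Pn) (quotientPath π S) K' t
        (logExt G (S t) - logExt G (S 0) - 1 / 2 * ∑ i, ∑ j,
          rsIntegral (fun s => logExtDeriv2 G (S s) (stdVec i) (stdVec j))
            (bracket S Pn i j) t) := fun T hT K' hK' t ht => by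
    rw [hquot] at hK' ⊢
    exact hS.hasRoughIntegral_of_controlled hpq hγ hpγ
      (fun x hx => hasFDerivAt_logExt hd hG hx) (fun x hx => hasFDerivAt_logExtDeriv hd hG hx)
      (fun x hx => logExtDeriv2_symm hd hG hx) (locHolder_logExtDeriv2 hd hγ hγ1 hG) hT hK' ht
  constructor
  · intro hW t
    have hT : 0 < t + 1 := by positivity
    obtain ⟨⟨K', hK'⟩, h⟩ := hW (t + 1) hT
    obtain ⟨-, I, hI, hWt⟩ := h K' hK' t le_self_add
    rw [hWt, tendsto_nhds_unique hI (hrough _ hT K' hK' t le_self_add), hval]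
  · exact fun hW T hT => ⟨hK T hT, fun K' hK' t ht => ⟨hint1 t, _, hrough T hT K' hK' t ht, by
      rw [hW, hval]⟩⟩

theorem generatedPortfolio_one (μ : ℝ≥0 → Vec d) :
    generatedPortfolio (fun _ => (1 : ℝ)) μ = μ := by
  funext t
  ext i
  simp [generatedPortfolio, partialDeriv]

theorem logWealth_one (t : ℝ≥0) : logWealth S Pn (fun _ => (1 : ℝ)) t =
    Real.log (total d (S t)) - Real.log (total d (S 0)) := by
  have h : ∀ i j, tauIntegral S Pn (marketPortfolio S)
      (masterIntegrand (fun _ => (1 : ℝ)) (marketPortfolio S) i j) i j t = 0 := fun i j => by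
    refine Finset.sum_eq_zero fun k _ => Finset.sum_eq_zero fun l _ => ?_
    have e : tauDensity S (marketPortfolio S)
        (masterIntegrand (fun _ => (1 : ℝ)) (marketPortfolio S) i j) i j k l = fun _ => 0 := by
      funext s
      have : partialDeriv j (fun _ : Vec d => (1 : ℝ)) = fun _ => 0 := by
        funext x
        simp [partialDeriv]
      simp [tauDensity, masterIntegrand, this, partialDeriv]
    rw [e]
    exact (hasRSIntegral_zero _ t).rsIntegral_eq
  simp [logWealth, h, logExt, homExt]

end Wealth

end RoughSPT

end

theorem mainTheorem2 (d : ℕ) (hd : 0 < d) (p : ℝ) (hp2 : 2 < p) (hp3 : p < 3)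
    (S : ℝ≥0 → RoughSPT.Vec d) (Pn : ℕ → RoughSPT.InfPartition)
    (hS : RoughSPT.IsPricePath p S Pn)
    (ε : ℝ) (hε : 0 < ε) (G : RoughSPT.Vec d → ℝ)
    (hG : RoughSPT.IsGeneratingFunction (p + ε) G)
    (μ π : ℝ≥0 → RoughSPT.Vec d) (hμ : μ = RoughSPT.marketPortfolio S)
    (hπ : π = RoughSPT.generatedPortfolio G μ) :
    (∃ q, RoughSPT.RegularityParams p q ∧ RoughSPT.IsPortfolio p q S π) ∧
    ∀ q, RoughSPT.RegularityParams p q → RoughSPT.IsPortfolio p q S π →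
      (∃ Wπ, RoughSPT.IsWealthProcess p q S Pn π Wπ) ∧
      (∃ Wμ, RoughSPT.IsWealthProcess p q S Pn μ Wμ) ∧
      (∀ i j t, RoughSPT.TauIntegrable S Pn μ (RoughSPT.masterIntegrand G μ i j) i j t) ∧
      ∀ Wπ Wμ : ℝ≥0 → ℝ, RoughSPT.IsWealthProcess p q S Pn π Wπ →
        RoughSPT.IsWealthProcess p q S Pn μ Wμ →
        ∀ t : ℝ≥0, Real.log (Wπ t / Wμ t) =
          Real.log (G (μ t) / G (μ 0)) - 1 / 2 * ∑ i, ∑ j,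
            RoughSPT.tauIntegral S Pn μ (RoughSPT.masterIntegrand G μ i j) i j t := by
  open RoughSPT in
  obtain ⟨γ, hγ, hγ1, hpγ, hreg⟩ := hG.exists_regular hp2 hp3 hε
  have hp : 0 < p := by linarith
  subst hμ
  subst hπ
  have hport := hS.isPortfolio_generated hd hp2 hp3 hγ hγ1 hpγ hreg
  refine ⟨⟨_, hport⟩, fun q hpq hπ => ?_⟩
  have hiff := hS.isWealthProcess_iff hd hpq hγ hγ1 hpγ hreg fun T hT => by
    obtain ⟨F', hF⟩ := hπ.1 T hT
    exact hS.isControlledPath_quotientPath hpq hT hF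
  have hreg1 : IsRegularGenerator (fun _ : Vec d => (1 : ℝ)) 1 := isRegularGenerator_one
  have hiff1 := hS.isWealthProcess_iff hd hpq one_pos le_rfl (by linarith) hreg1 fun T hT => by
    rw [quotientPath_generatedPortfolio hd hS.pos hreg1]
    exact ⟨_, hS.isControlledPath_gradient hd hp one_pos le_rfl (hp.trans_le hpq.le)
      (one_div_le_one_div_of_le hp hpq.le) hreg1 hT⟩
  rw [generatedPortfolio_one] at hiff1
  refine ⟨⟨_, (hiff _).mpr fun t => rfl⟩, ⟨_, (hiff1 _).mpr fun t => rfl⟩,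
    hS.tauIntegrable hd hγ hreg, fun Wπ Wμ hWπ hWμ t => ?_⟩
  have hσ := fun t => (total_pos hd (hS.pos t)).ne'
  have hGp := fun t => (hreg.pos _ (weights_mem hd (hS.pos t))).ne'
  have hlog : ∀ t, logExt G (S t) =
      Real.log (total d (S t)) + Real.log (G (marketPortfolio S t)) := fun t => by
    rw [logExt, homExt, marketPortfolio_eq, Real.log_mul (hσ t) (hGp t)]
  rw [(hiff _).mp hWπ t, (hiff1 _).mp hWμ t, ← Real.exp_sub, Real.log_exp, logWealth_one,
    logWealth, hlog, hlog, Real.log_div (by rw [marketPortfolio_eq]; exact hGp t)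
    (by rw [marketPortfolio_eq]; exact hGp 0)]
  ring
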